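/- Let \(m\ge 1\) be an integer and let \(N\) be a compact smooth Riemannian manifold (without boundary, not necessarily connected), with geodesic distance \(d_N\), where \(d_N=+\infty\) between different connected components. Let \(\mathbb{S}^m\subset\mathbb{R}^{m+1}\) be the unit sphere with its surface measure. Assume that, for every base point, - either \(m=1\) and every conjugacy class of \(\pi_1(N)\) is finite, - or \(m\ge 2\) and every orbit of the action of \(\pi_1(N)\) on \(\pi_m(N)\) is finite. Then there exists \(\varepsilon_0>0\) such that for every \(\varepsilon\in(0,\varepsilon_0)\) and every \(\lambda>0\) there exists a finite set \(\mathcal{G}^\lambda\subset C(\mathbb{S}^m,N)\) such that every continuous map \(f\colon\mathbb{S}^m\to N\) satisfying \[ \iint_{\{(x,y)\in\mathbb{S}^m\times\mathbb{S}^m \,:\, d_N(f(y),f(x))>\varepsilon\}}\frac{1}{|y-x|^{2m}}\,\mathrm{d}x\,\mathrm{d}y\le\lambda \] is (freely) homotopic to some \(g\in\mathcal{G}^\lambda\). Here \(|y-x|\) is the Euclidean norm in \(\mathbb{R}^{m+1}\). -/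

import Mathlib

open Set MeasureTheory Manifold Topology Topology.Homotopy
open scoped ENNReal unitInterval ContDiff Bundle

noncomputable section

namespace GapPotential

/-- The unit sphere `𝕊ᵐ ⊂ ℝᵐ⁺¹`. As a subtype of Euclidean space it carries the chordal distance
`dist x y = |y - x|`. -/
abbrev Sph (m : ℕ) : Type := Metric.sphere (0 : EuclideanSpace ℝ (Fin (m + 1))) 1

/-- The standard `m`-dimensional surface measure of `𝕊ᵐ`. -/
def surfaceMeasure (m : ℕ) : Measure (Sph m) :=
  (volume : Measure (EuclideanSpace ℝ (Fin (m + 1)))).toSphere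

/-- The gap potential
`∬_{(x, y) ∈ 𝕊ᵐ × 𝕊ᵐ, d(f(y), f(x)) > ε} |y - x|^(-2m) dx dy`, with values in `[0, ∞]`. -/
def gapPotential {m : ℕ} {N : Type*} [PseudoEMetricSpace N] (ε : ℝ) (f : Sph m → N) : ℝ≥0∞ :=
  ∫⁻ p in {p : Sph m × Sph m | ENNReal.ofReal ε < edist (f p.2) (f p.1)},
    ENNReal.ofReal (1 / dist p.2 p.1 ^ (2 * m)) ∂((surfaceMeasure m).prod (surfaceMeasure m))

section Action

variable {ι X : Type*} [Fintype ι] [TopologicalSpace X]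

/-- The distance of a point `s` of the unit cube to the centre in the sup norm, scaled so that it
is equal to `1` exactly on the boundary of the cube. -/
def cubeRadius (s : ι → I) : ℝ := ‖fun i => 2 * (s i : ℝ) - 1‖

/-- The map from the unit cube obtained by shrinking the domain of `γ` to the concentric cube of
half the size and by inserting `β` on each radial segment from the boundary of the unit cube
(where the value is `β 0`) to the boundary of the smaller cube (where the value is `β 1`). -/
def radialInsert (β : I → X) (γ : (ι → I) → X) (s : ι → I) : X :=
  open Classical in
  if cubeRadius s ≤ 1 / 2 then
    γ (fun i => projIcc (0 : ℝ) 1 zero_le_one (2 * (s i : ℝ) - 1 / 2))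
  else β (projIcc (0 : ℝ) 1 zero_le_one (2 - 2 * cubeRadius s))

theorem continuous_cubeRadius : Continuous (cubeRadius : (ι → I) → ℝ) := by
  unfold cubeRadius
  fun_prop

theorem exists_of_cubeRadius_eq {s : ι → I} {r : ℝ} (hr : 0 < r) (h : cubeRadius s = r) :
    ∃ i, |2 * (s i : ℝ) - 1| = r := by
  by_contra! hne
  have hlt : cubeRadius s < r := by
    refine (pi_norm_lt_iff hr).2 fun i => lt_of_le_of_ne ?_ (hne i)
    exact (norm_le_pi_norm (fun i => 2 * (s i : ℝ) - 1) i).trans h.le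
  exact hlt.ne h

theorem cubeRadius_of_mem_boundary {s : ι → I} (hs : s ∈ Cube.boundary ι) :
    cubeRadius s = 1 := by
  apply le_antisymm
  · refine (pi_norm_le_iff_of_nonneg zero_le_one).2 fun i => ?_
    rw [Real.norm_eq_abs, abs_le]
    constructor <;> linarith [(s i).2.1, (s i).2.2]
  · obtain ⟨i, hi⟩ := hs
    refine le_trans ?_ (norm_le_pi_norm (fun i => 2 * (s i : ℝ) - 1) i)
    rcases hi with hi | hi <;> norm_num [hi]

theorem radialInsert_of_mem_boundary {Y : Type*} (β : I → Y) (γ : (ι → I) → Y) {s : ι → I}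
    (hs : s ∈ Cube.boundary ι) : radialInsert β γ s = β 0 := by
  have h := cubeRadius_of_mem_boundary hs
  rw [radialInsert, if_neg (by rw [h]; norm_num), h]
  congr 1
  norm_num

theorem continuous_radialInsert {T : Type*} [TopologicalSpace T] {x : X}
    {β : T → I → X} {γ : T → (ι → I) → X}
    (hβ : Continuous fun p : T × I => β p.1 p.2)
    (hγ : Continuous fun p : T × (ι → I) => γ p.1 p.2)
    (hβ1 : ∀ t, β t 1 = x) (hγx : ∀ t, ∀ s ∈ Cube.boundary ι, γ t s = x) :
    Continuous fun p : T × (ι → I) => radialInsert (β p.1) (γ p.1) p.2 := by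
  unfold radialInsert
  have hr : Continuous fun p : T × (ι → I) => cubeRadius p.2 :=
    continuous_cubeRadius.comp continuous_snd
  refine Continuous.if_le ?_ ?_ hr continuous_const ?_
  · exact hγ.comp (continuous_fst.prodMk (continuous_pi fun i =>
      (continuous_projIcc (h := zero_le_one (α := ℝ))).comp (by fun_prop)))
  · exact hβ.comp (continuous_fst.prodMk
      ((continuous_projIcc (h := zero_le_one (α := ℝ))).comp (by fun_prop)))
  · rintro ⟨t, s⟩ h
    simp only at h ⊢
    have h1 : projIcc (0 : ℝ) 1 zero_le_one (2 - 2 * cubeRadius s) = 1 := by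
      rw [h]; exact projIcc_of_right_le _ (by norm_num)
    rw [h1, hβ1]
    apply hγx
    obtain ⟨i, hi⟩ := exists_of_cubeRadius_eq (by norm_num) h
    refine ⟨i, ?_⟩
    rcases (abs_eq (by norm_num)).1 hi with hi | hi
    · right
      exact projIcc_of_right_le _ (by linarith)
    · left
      exact projIcc_of_le_left _ (by linarith)

/-- The loop `β` at `x` acts on the generalized loop `γ` at `x`. -/
def actLoop {x : X} (β : Path x x) (γ : Ω^ ι X x) : Ω^ ι X x :=
  ⟨⟨radialInsert β γ,
    (continuous_radialInsert (T := Unit) (x := x) (β := fun _ => β) (γ := fun _ => γ)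
      (β.continuous.comp continuous_snd) (γ.1.continuous.comp continuous_snd)
      (fun _ => β.target) (fun _ => γ.2)).comp
      (f := fun s : ι → I => ((), s)) (by fun_prop)⟩,
    fun _ hs => (radialInsert_of_mem_boundary _ _ hs).trans β.source⟩

theorem actLoop_homotopic {x : X} {β β' : Path x x} (hβ : β.Homotopic β') {γ γ' : Ω^ ι X x}
    (hγ : GenLoop.Homotopic γ γ') : GenLoop.Homotopic (actLoop β γ) (actLoop β' γ') := by
  obtain ⟨B⟩ := hβ
  obtain ⟨C⟩ := hγ
  have hC : ∀ t, ∀ s ∈ Cube.boundary ι, C (t, s) = x := fun t s hs =>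
    (C.eq_fst t hs).trans (γ.2 s hs)
  refine ⟨⟨⟨⟨fun p => radialInsert (fun u => B (p.1, u)) (fun s => C (p.1, s)) p.2,
    continuous_radialInsert (x := x) (β := fun t u => B (t, u)) (γ := fun t s => C (t, s))
      B.continuous C.continuous (fun t => B.target t) hC⟩, ?_, ?_⟩, ?_⟩⟩
  · intro s
    simp only [ContinuousMap.HomotopyWith.apply_zero]
    rfl
  · intro s
    simp only [ContinuousMap.HomotopyWith.apply_one]
    rfl
  · intro t s hs
    change radialInsert (fun u => B (t, u)) (fun s => C (t, s)) s = _
    refine (radialInsert_of_mem_boundary _ _ hs).trans ?_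
    exact (B.source t).trans ((actLoop β γ).2 s hs).symm

/-- The action of `π₁(X, x)` on `π_m(X, x)`, by `[β] · [γ] = [actLoop β γ]`. It is a left action for
the product of loops `β β'` that runs through `β` first. -/
def act {m : ℕ} {x : X} (β : FundamentalGroup X x) (γ : π_ m X x) : π_ m X x :=
  Quotient.map₂ actLoop (fun _ _ hβ _ _ hγ => actLoop_homotopic hβ hγ) β.toPath γ

/-- The orbit of `γ ∈ π_m(X, x)` under the action of `π₁(X, x)`. -/
def orbit {m : ℕ} {x : X} (γ : π_ m X x) : Set (π_ m X x) :=
  Set.range fun β : FundamentalGroup X x => act β γ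

end Action

end GapPotential

end

/-! Embed `N` in a Euclidean space together with a retraction of a closed tube around its image, and
let F(x, r) be the average of f near x at scale r, weighted by a tent. F is Lipschitz for the
hyperbolic distance on pairs (x, r), with a constant independent of f
(`exists_dist_tentAverage_le`). Call (x, r) bad when F(x, r) leaves the tube. A bad pair forces a
fixed amount of gap potential onto pairs of points near x whose distance is comparable with r
(`exists_energy_bound`). Hence only K bad pairs can be far apart from each other, with K controlled
by the energy (`exists_card_bad_le`), and all bad pairs below some height lie in at most K boxes.
Merging boxes that are too close (`exists_coarsening`) makes them well separated while their size
stays bounded.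

A positive scale function V whose graph avoids the bad pairs defines a map x ↦ ret F(x, V x) into
`N`, and deforming V through such functions is a homotopy. For V constant and tiny, this map is
homotopic to f. For V constant above all boxes it comes from a Lipschitz map with controlled
constant, so only finitely many homotopy classes occur (`exists_finite_homotopy_representatives`).

In between, V is lifted over the boxes one at a time, the lowest box first. Passing below and
passing above a box give two maps that differ only on a cap. Gluing their two caps gives a map of
the sphere which, after a conformal rescaling, again has controlled Lipschitz constant
(`exists_double`), hence finitely many classes. In π_m(N, y) the class of the lower map is the
product of the class of this double and the class of the upper map (`exists_double_operation`). The
finiteness of orbits enters here: a free homotopy class contains only finitely many based classes at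
y (`finite_classesAt`), so finitely many free classes above the box leave finitely many below it
(`exists_finite_step`). After at most K such steps the class of f itself is confined to a finite
set. -/

noncomputable section

namespace GapPotential

/-! ### Neighbourhood retractions of compact locally Euclidean spaces -/

section Retraction

variable {N E : Type*} [TopologicalSpace N] [PseudoMetricSpace E]

/-- The map `ι` has a retraction that is defined and continuous on a closed neighbourhood of
`ι '' C`. -/
def HasRetractionNear (ι : N → E) (C : Set N) : Prop :=
  ∃ (V : Set E) (ρ : E → N), IsClosed V ∧ V ∈ 𝓝ˢ (ι '' C) ∧ ContinuousOn ρ V ∧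
    ∀ x, ι x ∈ V → ρ (ι x) = x

theorem HasRetractionNear.mono {ι : N → E} {C D : Set N} (h : HasRetractionNear ι D)
    (hCD : C ⊆ D) : HasRetractionNear ι C := by
  obtain ⟨V, ρ, hV, hVn, hρ, hι⟩ := h
  exact ⟨V, ρ, hV, nhdsSet_mono (image_mono hCD) hVn, hρ, hι⟩

/-- Tietze in one chart. On a thin closed neighbourhood B of the image of the small ball, the
partial retraction `τ` (that is, ρ on V and the inverse of ι on the image) takes values in the chart
domain. In the chart it is a map into a closed ball, which extends continuously to all of B. -/
theorem HasRetractionNear.union_chart {F : Type*} [NormedAddCommGroup F] [NormedSpace ℝ F]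
    [FiniteDimensional ℝ F] {ι : N → E} (hι : IsClosedEmbedding ι) {C : Set N}
    (h : HasRetractionNear ι C) (φ : OpenPartialHomeomorph N F) {z : F} {r : ℝ} (hr : 0 < r)
    (hφ : Metric.closedBall z r ⊆ φ.target) :
    HasRetractionNear ι (C ∪ φ.symm '' Metric.closedBall z (r / 2)) := by
  classical
  obtain ⟨V, ρ, hV, hVn, hρ, hρι⟩ := h
  set K := φ.symm '' Metric.closedBall z (r / 2) with hK
  set U := φ.source ∩ φ ⁻¹' Metric.ball z r with hU
  have hUo : IsOpen U := φ.isOpen_inter_preimage Metric.isOpen_ball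
  have hsub : Metric.closedBall z (r / 2) ⊆ φ.target :=
    (Metric.closedBall_subset_closedBall (by linarith)).trans hφ
  have hKc : IsCompact K :=
    (isCompact_closedBall z (r / 2)).image_of_continuousOn (φ.continuousOn_symm.mono hsub)
  have hKU : K ⊆ U := by
    rintro _ ⟨y, hy, rfl⟩
    refine ⟨φ.map_target (hsub hy), ?_⟩
    rw [mem_preimage, φ.right_inv (hsub hy)]
    exact Metric.closedBall_subset_ball (by linarith) hy
  -- Z collects the points where `τ` could leave U. It is closed and misses the compact set ι '' K,
  -- so a whole thickening of ι '' K misses it.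
  set Z := ι '' Uᶜ ∪ V ∩ ρ ⁻¹' Uᶜ with hZ
  have hZc : IsClosed Z := (hι.isClosedMap _ hUo.isClosed_compl).union
    (hρ.preimage_isClosed_of_isClosed hV hUo.isClosed_compl)
  have hdisj : Disjoint (ι '' K) Z := by
    rw [Set.disjoint_left]
    rintro _ ⟨x, hx, rfl⟩ (⟨y, hy, hxy⟩ | ⟨hxV, hxU⟩)
    · exact hy (hι.injective hxy ▸ hKU hx)
    · rw [mem_preimage, hρι x hxV] at hxU
      exact hxU (hKU hx)
  obtain ⟨δ, hδ, hBZ⟩ := hdisj.exists_cthickenings (hKc.image hι.continuous) hZc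
  set B := Metric.cthickening δ (ι '' K) with hB
  have hBZ' : ∀ y ∈ B, y ∉ Z := fun y hy hyZ =>
    Set.disjoint_left.1 hBZ hy (Metric.self_subset_cthickening _ hyZ)
  have hBc : IsClosed B := Metric.isClosed_cthickening
  by_cases hN : Nonempty N
  swap
  · have : IsEmpty N := not_nonempty_iff.1 hN
    exact ⟨V, ρ, hV, by rwa [Subsingleton.elim (C ∪ K) C], hρ, hρι⟩
  set τ : E → N := fun y => if y ∈ V then ρ y else Function.invFun ι y with hσ
  have hinv : ∀ x, Function.invFun ι (ι x) = x := Function.leftInverse_invFun hι.injective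
  have hσV : EqOn τ ρ V := fun y hy => if_pos hy
  have hσι : ∀ x, τ (ι x) = x := by
    intro x
    by_cases hx : ι x ∈ V
    · rw [hσV hx, hρι x hx]
    · simp only [hσ, if_neg hx, hinv]
  have hσc : ContinuousOn τ (V ∪ range ι) := by
    refine ContinuousOn.union_of_isClosed (hρ.congr hσV) ?_ hV hι.isClosed_range
    rw [← image_univ]
    refine (hι.isInducing.continuousOn_image_iff).2 ?_
    exact continuousOn_id.congr fun x _ => hσι x
  set A := (V ∪ range ι) ∩ B with hA
  have hAc : IsClosed A := (hV.union hι.isClosed_range).inter hBc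
  have hAU : ∀ y ∈ A, τ y ∈ U := by
    rintro y ⟨hy, hyB⟩
    by_contra hyU
    refine hBZ' y hyB ?_
    by_cases hyV : y ∈ V
    · exact Or.inr ⟨hyV, by rwa [mem_preimage, ← hσV hyV]⟩
    · obtain ⟨x, rfl⟩ := hy.resolve_left hyV
      exact Or.inl ⟨x, by rwa [hσι] at hyU, rfl⟩
  have hgc : ContinuousOn (fun y => φ (τ y)) A :=
    φ.continuousOn.comp (hσc.mono inter_subset_left) fun y hy => (hAU y hy).1
  have : TietzeExtension (Metric.closedBall z r) :=
    Metric.instTietzeExtensionClosedBall ℝ z hr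
  obtain ⟨g, hg⟩ := ContinuousMap.exists_restrict_eq hAc
    (⟨fun y => ⟨φ (τ y), Metric.ball_subset_closedBall (hAU y y.2).2⟩,
      (continuousOn_iff_continuous_domRestrict.1 hgc).subtype_mk _⟩ :
      C(A, Metric.closedBall z r))
  have hg' : ∀ y ∈ A, (g y : F) = φ (τ y) := fun y hy =>
    congrArg Subtype.val (DFunLike.congr_fun hg ⟨y, hy⟩)
  refine ⟨V ∪ B, fun y => if y ∈ V then ρ y else φ.symm (g y), hV.union hBc, ?_, ?_, ?_⟩
  · rw [image_union]
    exact union_mem_nhdsSet hVn (Metric.cthickening_mem_nhdsSet _ hδ)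
  · refine ContinuousOn.union_of_isClosed (hρ.congr fun y hy => if_pos hy) ?_ hV hBc
    have : ContinuousOn (fun y => φ.symm (g y)) B :=
      φ.continuousOn_symm.comp (by fun_prop) fun y _ => hφ (g y).2
    refine this.congr fun y hy => ?_
    by_cases hyV : y ∈ V
    · have hyA : y ∈ A := ⟨Or.inl hyV, hy⟩
      simp only [if_pos hyV]
      rw [hg' y hyA, φ.left_inv (hAU y hyA).1, hσV hyV]
    · exact if_neg hyV
  · intro x hx
    by_cases hxV : ι x ∈ V
    · simp only [if_pos hxV, hρι x hxV]
    · have hxA : ι x ∈ A := ⟨Or.inr ⟨x, rfl⟩, hx.resolve_left hxV⟩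
      simp only [if_neg hxV]
      rw [hg' _ hxA, φ.left_inv (hAU _ hxA).1, hσι]

/-- A compact locally Euclidean subspace is a retract of a closed thickening. -/
theorem exists_retraction_cthickening {F : Type*} [NormedAddCommGroup F] [NormedSpace ℝ F]
    [FiniteDimensional ℝ F] [ChartedSpace F N] [CompactSpace N] {ι : N → E}
    (hι : IsClosedEmbedding ι) (hN : Nonempty N) :
    ∃ η : ℝ, 0 < η ∧ ∃ ρ : E → N, ContinuousOn ρ (Metric.cthickening η (range ι)) ∧
      ∀ x, ρ (ι x) = x := by
  -- Quantifying over C makes the property stable under unions, so compactness reduces it to one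
  -- half-size chart ball around each point.
  have key : ∀ C, HasRetractionNear ι C → HasRetractionNear ι (C ∪ univ) := by
    refine isCompact_univ.induction_on
      (p := fun s => ∀ C, HasRetractionNear ι C → HasRetractionNear ι (C ∪ s)) ?_ ?_ ?_ ?_
    · intro C hC
      rwa [union_empty]
    · exact fun s t hst ht C hC => (ht C hC).mono (union_subset_union_right C hst)
    · intro s t hs ht C hC
      rw [← union_assoc]
      exact ht _ (hs _ hC)
    · intro x _
      set φ := chartAt F x
      obtain ⟨r, hr, hrt⟩ := Metric.nhds_basis_closedBall.mem_iff.1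
        (φ.open_target.mem_nhds (mem_chart_target F x))
      refine ⟨φ.symm '' Metric.closedBall (φ x) (r / 2), mem_nhdsWithin_of_mem_nhds ?_,
        fun C hC => hC.union_chart hι φ hr hrt⟩
      refine Filter.mem_of_superset ((φ.isOpen_inter_preimage
        (Metric.isOpen_ball (x := φ x) (ε := r / 2))).mem_nhds
        ⟨mem_chart_source F x, Metric.mem_ball_self (by linarith)⟩) ?_
      rintro y ⟨hy, hyb⟩
      exact ⟨φ y, Metric.ball_subset_closedBall hyb, φ.left_inv hy⟩
  have h0 : HasRetractionNear ι ∅ :=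
    ⟨∅, fun _ => hN.some, isClosed_empty, by simp, continuousOn_empty _, by simp⟩
  obtain ⟨V, ρ, -, hVn, hρ, hρι⟩ := key _ h0
  rw [empty_union, image_univ] at hVn
  obtain ⟨O, hO, hsub, hOV⟩ := mem_nhdsSet_iff_exists.1 hVn
  obtain ⟨η, hη, hηO⟩ :=
    (isCompact_range hι.continuous).exists_cthickening_subset_open hO hsub
  exact ⟨η, hη, ρ, hρ.mono (hηO.trans hOV), fun x => hρι x (hOV (hsub ⟨x, rfl⟩))⟩

end Retraction

end GapPotential

end

/-! ### Homotopies inside the tube and finiteness for Lipschitz maps -/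

noncomputable section

namespace GapPotential

/-- Every set has a finite subset that meets every fibre over a finite type that the set meets. -/
theorem exists_finite_representatives {α β : Type*} [Finite β] (S : Set α) (code : α → β) :
    ∃ G ⊆ S, G.Finite ∧ ∀ a ∈ S, ∃ g ∈ G, code a = code g := by
  obtain ⟨G, hGS, hG⟩ := S.exists_subset_bijOn code
  refine ⟨G, hGS, hG.finite_iff_finite.2 (Set.toFinite _), fun a ha => ?_⟩
  obtain ⟨g, hg, hga⟩ := hG.surjOn ⟨a, ha, rfl⟩
  exact ⟨g, hg, hga.symm⟩

/-- A continuous map of `N` into a normed space, together with a retraction of a closed thickening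
of its image. -/
structure RetractionData (N E : Type*) [TopologicalSpace N] [NormedAddCommGroup E] where
  /-- the map into the normed space -/
  emb : C(N, E)
  /-- the size of the thickening -/
  η : ℝ
  η_pos : 0 < η
  /-- the retraction -/
  ret : E → N
  continuousOn_ret : ContinuousOn ret (Metric.cthickening η (range emb))
  ret_emb : ∀ x, ret (emb x) = x

namespace RetractionData

variable {N E : Type*} [TopologicalSpace N] [NormedAddCommGroup E] (R : RetractionData N E)

/-- The thickening on which the retraction is continuous. -/
def tube : Set E := Metric.cthickening R.η (range R.emb)

theorem mem_tube_of_dist_le {z : E} {y : N} (h : dist z (R.emb y) ≤ R.η) : z ∈ R.tube :=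
  Metric.mem_cthickening_of_dist_le _ _ _ _ ⟨y, rfl⟩ h

theorem isCompact_tube [CompactSpace N] [ProperSpace E] : IsCompact R.tube :=
  (isCompact_range R.emb.continuous).cthickening

theorem η_lt_dist_of_notMem_tube {z : E} (h : z ∉ R.tube) (y : N) : R.η < dist z (R.emb y) := by
  contrapose! h
  exact R.mem_tube_of_dist_le h

variable {X : Type*} [TopologicalSpace X]

theorem continuous_ret_comp {u : X → E} (hu : Continuous u) (h : ∀ x, u x ∈ R.tube) :
    Continuous fun x => R.ret (u x) :=
  R.continuousOn_ret.comp_continuous hu h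

theorem homotopic_of_tube {f g : C(X, N)} (u : I × X → E) (hu : Continuous u)
    (h : ∀ p, u p ∈ R.tube) (h0 : ∀ x, R.ret (u (0, x)) = f x)
    (h1 : ∀ x, R.ret (u (1, x)) = g x) : f.Homotopic g :=
  ⟨⟨⟨fun p => R.ret (u p), R.continuous_ret_comp hu h⟩, h0, h1⟩⟩

theorem homotopic_of_dist_le [NormedSpace ℝ E] {f : C(X, N)} {g : C(X, N)} {u : X → E}
    (hu : Continuous u) (hg : ∀ x, R.ret (u x) = g x)
    (h : ∀ x, dist (u x) (R.emb (f x)) ≤ R.η) : f.Homotopic g := by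
  refine R.homotopic_of_tube
    (fun p => R.emb (f p.2) + (p.1 : ℝ) • (u p.2 - R.emb (f p.2))) (by fun_prop) ?_ ?_ ?_
  · rintro ⟨t, x⟩
    refine R.mem_tube_of_dist_le (y := f x) ?_
    rw [dist_eq_norm, add_sub_cancel_left, norm_smul, ← dist_eq_norm, Real.norm_eq_abs,
      abs_of_nonneg t.2.1]
    exact (mul_le_of_le_one_left dist_nonneg t.2.2).trans (h x)
  · intro x
    simp [R.ret_emb]
  · intro x
    simp [hg]

theorem homotopic_of_close [NormedSpace ℝ E] {f g : C(X, N)}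
    (h : ∀ x, dist (R.emb (g x)) (R.emb (f x)) ≤ R.η) : f.Homotopic g :=
  R.homotopic_of_dist_le (u := fun x => R.emb (g x)) (by fun_prop) (fun _ => R.ret_emb _) h

/-- Total boundedness: a C-Lipschitz map into the compact tube is known up to δ from its rounded
values on a finite net, and maps with the same rounded values have retractions close enough to be
joined by segments in the tube. Only C and the retraction data determine the finite set. -/
theorem exists_finite_homotopy_representatives [NormedSpace ℝ E] [ProperSpace E] [CompactSpace N]
    (X : Type*) [PseudoMetricSpace X] [CompactSpace X] (C : ℝ) (hC : 0 < C) :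
    ∃ G : Set C(X, N), G.Finite ∧ ∀ (u : X → E) (f : C(X, N)),
      (∀ x y, dist (u x) (u y) ≤ C * dist x y) → (∀ x, u x ∈ R.tube) →
      (∀ x, f x = R.ret (u x)) → ∃ g ∈ G, f.Homotopic g := by
  have huc : UniformContinuousOn (fun z => R.emb (R.ret z)) R.tube :=
    R.isCompact_tube.uniformContinuousOn_of_continuous
      (R.emb.continuous.comp_continuousOn R.continuousOn_ret)
  obtain ⟨δ, hδ, hδη⟩ := Metric.uniformContinuousOn_iff.1 huc R.η R.η_pos
  -- Four errors of size δ / 4 add up to δ: moving to the net and back by the Lipschitz bounds, and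
  -- rounding the two values.
  obtain ⟨s, -, hs, hsc⟩ := (isCompact_univ (X := X)).finite_cover_balls
    (e := δ / (4 * C)) (by positivity)
  obtain ⟨t, -, ht, htc⟩ := R.isCompact_tube.finite_cover_balls (e := δ / 4) (by positivity)
  have := hs.to_subtype
  have := ht.to_subtype
  have hnet : ∀ z : R.tube, ∃ w : t, dist (z : E) w < δ / 4 := by
    intro z
    obtain ⟨w, hw, hzw⟩ := mem_iUnion₂.1 (htc z.2)
    exact ⟨⟨w, hw⟩, hzw⟩
  choose c hc using hnet
  obtain ⟨G, hGS, hG, hcode⟩ := exists_finite_representatives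
    {p : (X → R.tube) × C(X, N) | (∀ x y, dist (p.1 x : E) (p.1 y) ≤ C * dist x y) ∧
      ∀ x, p.2 x = R.ret (p.1 x)} (fun p => fun x : s => c (p.1 x))
  refine ⟨Prod.snd '' G, hG.image _, ?_⟩
  · intro u f hu hut hf
    obtain ⟨⟨v, g⟩, hv, huv⟩ := hcode (fun x => ⟨u x, hut x⟩, f) ⟨hu, hf⟩
    refine ⟨g, ⟨_, hv, rfl⟩, R.homotopic_of_close fun x => ?_⟩
    obtain ⟨y, hy, hxy⟩ := mem_iUnion₂.1 (hsc (mem_univ x))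
    have h1 := hc ⟨u y, hut y⟩
    have h2 := hc (v y)
    have h3 := congrFun huv ⟨y, hy⟩
    simp only at h3
    rw [← h3] at h2
    have h4 := hu x y
    have h5 := (hGS hv).1 x y
    have h6 : C * dist x y < δ / 4 := by
      rw [Metric.mem_ball, lt_div_iff₀ (by positivity)] at hxy
      linarith
    rw [hf, (hGS hv).2 x]
    refine (hδη _ (v x).2 _ (hut x) ?_).le
    have := dist_triangle4 (v x : E) (v y) (u y) (u x)
    have := dist_triangle_right (v y : E) (u y) (c ⟨u y, hut y⟩)
    rw [dist_comm (u y) (u x)] at *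
    linarith

end RetractionData

end GapPotential

end

noncomputable section

namespace GapPotential

/-! ### Measure of balls of the sphere -/

section Cone

open scoped Pointwise

variable {m : ℕ}

/-- The part below height `1` of the cone of slope `r` around the half-line through `x`. -/
def slopeCone (x : EuclideanSpace ℝ (Fin (m + 1))) (r : ℝ) : Set (EuclideanSpace ℝ (Fin (m + 1))) :=
  {z | 0 < inner ℝ x z ∧ inner ℝ x z < 1 ∧ ‖z - (inner ℝ x z : ℝ) • x‖ ≤ r * inner ℝ x z}

/-- The linear map that contracts the orthogonal complement of the unit vector `x` by `r`. -/
def contractOrth (x : EuclideanSpace ℝ (Fin (m + 1))) (r : ℝ) :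
    EuclideanSpace ℝ (Fin (m + 1)) →ₗ[ℝ] EuclideanSpace ℝ (Fin (m + 1)) :=
  r • LinearMap.transvection (((1 - r) / r) • (innerₗ _ x)) x

theorem contractOrth_apply (x z : EuclideanSpace ℝ (Fin (m + 1))) {r : ℝ} (hr : 0 < r) :
    contractOrth x r z = r • z + ((1 - r) * inner ℝ x z) • x := by
  simp only [contractOrth, LinearMap.smul_apply, LinearMap.transvection.apply, smul_add, smul_smul,
    innerₗ_apply_apply, smul_eq_mul]
  congr 2
  field_simp

/-- The transvection has determinant 1 + (1 - r) / r = 1 / r, and the scalar factor contributes r ^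
(m + 1). -/
theorem det_contractOrth {x : EuclideanSpace ℝ (Fin (m + 1))} (hx : ‖x‖ = 1) {r : ℝ}
    (hr : 0 < r) : LinearMap.det (contractOrth x r) = r ^ m := by
  rw [contractOrth, LinearMap.det_smul, LinearMap.transvection.det]
  simp only [LinearMap.smul_apply, innerₗ_apply_apply, smul_eq_mul, real_inner_self_eq_norm_sq, hx,
    finrank_euclideanSpace, Fintype.card_fin]
  field_simp
  ring

theorem volume_slopeCone {x : EuclideanSpace ℝ (Fin (m + 1))} (hx : ‖x‖ = 1) {r : ℝ}
    (hr : 0 < r) : volume (slopeCone x r) = ENNReal.ofReal (r ^ m) * volume (slopeCone x 1) := by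
  have hpre : contractOrth x r ⁻¹' slopeCone x r = slopeCone x 1 := by
    ext z
    have h1 : inner ℝ x (contractOrth x r z) = (inner ℝ x z : ℝ) := by
      rw [contractOrth_apply x z hr, inner_add_right, real_inner_smul_right, real_inner_smul_right,
        real_inner_self_eq_norm_sq, hx]
      ring
    have h2 : contractOrth x r z - (inner ℝ x z : ℝ) • x = r • (z - (inner ℝ x z : ℝ) • x) := by
      rw [contractOrth_apply x z hr]
      module
    simp only [slopeCone, mem_preimage, mem_ofPred_eq, h1, h2, norm_smul, Real.norm_eq_abs,
      abs_of_pos hr, one_mul, mul_le_mul_iff_right₀ hr]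
  have hdet := det_contractOrth hx hr
  have := Measure.addHaar_preimage_linearMap (volume : Measure (EuclideanSpace ℝ (Fin (m + 1))))
    (f := contractOrth x r) (by rw [hdet]; positivity) (slopeCone x r)
  rw [hpre, hdet, abs_of_pos (by positivity)] at this
  rw [this, ← mul_assoc, ← ENNReal.ofReal_mul (by positivity), mul_inv_cancel₀ (by positivity),
    ENNReal.ofReal_one, one_mul]

theorem slopeCone_one_subset {x : EuclideanSpace ℝ (Fin (m + 1))} (hx : ‖x‖ = 1) :
    slopeCone x 1 ⊆ Metric.ball 0 2 := by
  rintro z ⟨h0, h1, h2⟩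
  rw [mem_ball_zero_iff]
  have h3 : ‖(inner ℝ x z : ℝ) • x‖ = inner ℝ x z := by
    rw [norm_smul, hx, mul_one, Real.norm_eq_abs, abs_of_pos h0]
  have := norm_add_le (z - (inner ℝ x z : ℝ) • x) ((inner ℝ x z : ℝ) • x)
  rw [sub_add_cancel] at this
  linarith

theorem ball_subset_slopeCone_one {x : EuclideanSpace ℝ (Fin (m + 1))} (hx : ‖x‖ = 1) :
    Metric.ball ((1 / 2 : ℝ) • x) (1 / 8) ⊆ slopeCone x 1 := by
  intro z hz
  rw [mem_ball_iff_norm] at hz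
  set w := z - (1 / 2 : ℝ) • x with hw
  have hz' : z = (1 / 2 : ℝ) • x + w := by rw [hw]; abel
  have hin : (inner ℝ x z : ℝ) = 1 / 2 + inner ℝ x w := by
    rw [hz', inner_add_right, real_inner_smul_right, real_inner_self_eq_norm_sq, hx]
    norm_num
  have hb := abs_real_inner_le_norm x w
  rw [hx, one_mul, abs_le] at hb
  refine ⟨by linarith, by linarith, ?_⟩
  have : z - (inner ℝ x z : ℝ) • x = w - (inner ℝ x w : ℝ) • x := by
    rw [hin, hz']
    module
  rw [this]
  have h1 := norm_sub_le w ((inner ℝ x w : ℝ) • x)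
  have h2 : ‖(inner ℝ x w : ℝ) • x‖ ≤ ‖w‖ := by
    rw [norm_smul, hx, mul_one, Real.norm_eq_abs, abs_le]
    exact hb
  linarith

/-- The surface measure of a ball is a multiple of the volume of the solid cone over it, so balls
are compared with slope cones, whose volume scales exactly. For r ≤ 1 the cosine is at least 1 / 2,
hence the slope 2 r. -/
theorem Ioo_smul_ball_subset_slopeCone (x : Sph m) {r : ℝ} (hr : r ≤ 1) :
    Ioo (0 : ℝ) 1 • ((↑) '' Metric.closedBall x r : Set (EuclideanSpace ℝ (Fin (m + 1)))) ⊆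
      slopeCone x (2 * r) := by
  rintro _ ⟨t, ⟨ht0, ht1⟩, _, ⟨y, hy, rfl⟩, rfl⟩
  have hx : ‖(x : EuclideanSpace ℝ (Fin (m + 1)))‖ = 1 := by simp
  have hyn : ‖(y : EuclideanSpace ℝ (Fin (m + 1)))‖ = 1 := by simp
  rw [Metric.mem_closedBall, Subtype.dist_eq, dist_eq_norm] at hy
  have h0 := norm_nonneg ((y : EuclideanSpace ℝ (Fin (m + 1))) - x)
  have hsq := norm_sub_sq_real (y : EuclideanSpace ℝ (Fin (m + 1))) x
  rw [hx, hyn, real_inner_comm] at hsq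
  have hle := real_inner_le_norm (x : EuclideanSpace ℝ (Fin (m + 1))) y
  rw [hx, hyn] at hle
  set c : ℝ := inner ℝ (x : EuclideanSpace ℝ (Fin (m + 1))) y
  have hc : 1 / 2 ≤ c := by nlinarith
  have hperp : ‖(y : EuclideanSpace ℝ (Fin (m + 1))) - c • (x : EuclideanSpace ℝ (Fin (m + 1)))‖
      ≤ r := by
    refine le_trans (le_of_sq_le_sq ?_ h0) hy
    rw [norm_sub_sq_real, hsq, real_inner_smul_right, real_inner_comm, norm_smul, hx, hyn,
      Real.norm_eq_abs, mul_one, sq_abs]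
    change 1 ^ 2 - 2 * (c * c) + c ^ 2 ≤ _
    nlinarith
  have h1 : (inner ℝ (x : EuclideanSpace ℝ (Fin (m + 1))) (t • (y : EuclideanSpace ℝ (Fin (m + 1))))
      : ℝ) = t * c := real_inner_smul_right _ _ _
  refine ⟨?_, ?_, ?_⟩
  · simp only [h1]; positivity
  · simp only [h1]; nlinarith
  · simp only [h1]
    rw [mul_smul, ← smul_sub, norm_smul, Real.norm_eq_abs, abs_of_pos ht0]
    have : 0 ≤ r := h0.trans hy
    calc t * _ ≤ t * r := by gcongr
      _ ≤ 2 * r * (t * c) := by nlinarith [mul_nonneg ht0.le this]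

/-- The slope cone is truncated by height and not by norm; its points have norm below 1 + r < 2, so
halving brings them into the unit ball. -/
theorem smul_slopeCone_subset (x : Sph m) {r : ℝ} (hr0 : 0 < r) (hr : r < 1) :
    (1 / 2 : ℝ) • slopeCone (x : EuclideanSpace ℝ (Fin (m + 1))) r ⊆
      Ioo (0 : ℝ) 1 • ((↑) '' Metric.closedBall x (2 * r) :
        Set (EuclideanSpace ℝ (Fin (m + 1)))) := by
  rintro _ ⟨z, ⟨h0, h1, h2⟩, rfl⟩
  have hx : ‖(x : EuclideanSpace ℝ (Fin (m + 1)))‖ = 1 := by simp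
  set a : ℝ := inner ℝ (x : EuclideanSpace ℝ (Fin (m + 1))) z
  have hax : ‖a • (x : EuclideanSpace ℝ (Fin (m + 1)))‖ = a := by
    rw [norm_smul, hx, mul_one, Real.norm_eq_abs, abs_of_pos h0]
  have hz0 : z ≠ 0 := by
    rintro rfl
    simp [a] at h0
  have hzn : 0 < ‖z‖ := norm_pos_iff.2 hz0
  have habs : |‖z‖ - a| ≤ r * a := by
    have := abs_norm_sub_norm_le z (a • (x : EuclideanSpace ℝ (Fin (m + 1))))
    rw [hax] at this
    exact this.trans h2
  rw [abs_le] at habs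
  refine ⟨‖z‖ / 2, ⟨by positivity, by nlinarith⟩, ‖z‖⁻¹ • z,
    ⟨⟨‖z‖⁻¹ • z, by simp [norm_smul, hzn.ne']⟩, ?_, rfl⟩, ?_⟩
  · rw [Metric.mem_closedBall, Subtype.dist_eq, dist_eq_norm]
    have h3 : a • (‖z‖⁻¹ • z - (x : EuclideanSpace ℝ (Fin (m + 1)))) =
        (z - a • (x : EuclideanSpace ℝ (Fin (m + 1)))) + (a - ‖z‖) • (‖z‖⁻¹ • z) := by
      rw [smul_sub, sub_smul, smul_smul ‖z‖, mul_inv_cancel₀ hzn.ne', one_smul]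
      abel
    have h4 : ‖(a - ‖z‖) • (‖z‖⁻¹ • z)‖ ≤ r * a := by
      rw [norm_smul, norm_smul, norm_inv, norm_norm, inv_mul_cancel₀ hzn.ne', mul_one,
        Real.norm_eq_abs, abs_le]
      constructor <;> linarith
    have h5 := norm_add_le (z - a • (x : EuclideanSpace ℝ (Fin (m + 1))))
      ((a - ‖z‖) • (‖z‖⁻¹ • z))
    rw [← h3, norm_smul, Real.norm_eq_abs, abs_of_pos h0] at h5
    refine le_of_mul_le_mul_left ?_ h0
    linarith
  · change (‖z‖ / 2) • ‖z‖⁻¹ • z = (1 / 2 : ℝ) • z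
    rw [smul_smul]
    congr 1
    field_simp

instance (m : ℕ) : IsFiniteMeasure (surfaceMeasure m) :=
  inferInstanceAs (IsFiniteMeasure (Measure.toSphere volume))

theorem exists_surfaceMeasure_ball_bounds (m : ℕ) :
    ∃ c C : ℝ, 0 < c ∧ 0 < C ∧ ∀ (x : Sph m) (r : ℝ), 0 < r →
      (r ≤ 1 → c * r ^ m ≤ (surfaceMeasure m).real (Metric.ball x r)) ∧
      (surfaceMeasure m).real (Metric.closedBall x r) ≤ C * r ^ m := by
  set v₁ := (volume : Measure (EuclideanSpace ℝ (Fin (m + 1)))).real (Metric.ball 0 (1 / 8))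
    with hv₁
  set v₂ := (volume : Measure (EuclideanSpace ℝ (Fin (m + 1)))).real (Metric.ball 0 2) with hv₂
  have hv₁0 : 0 < v₁ := ENNReal.toReal_pos (Metric.measure_ball_pos _ _ (by norm_num)).ne'
    measure_ball_lt_top.ne
  have hv₂0 : 0 < v₂ := ENNReal.toReal_pos (Metric.measure_ball_pos _ _ (by norm_num)).ne'
    measure_ball_lt_top.ne
  have hfin : ∀ x : Sph m, ∀ r, volume (slopeCone (x : EuclideanSpace ℝ (Fin (m + 1))) 1) ≠ ⊤ ∧
      (0 < r → volume (slopeCone (x : EuclideanSpace ℝ (Fin (m + 1))) r) ≠ ⊤) := by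
    intro x r
    have h1 : volume (slopeCone (x : EuclideanSpace ℝ (Fin (m + 1))) 1) ≠ ⊤ :=
      ((measure_mono (slopeCone_one_subset (by simp))).trans_lt measure_ball_lt_top).ne
    exact ⟨h1, fun hr => by
      rw [volume_slopeCone (by simp) hr]
      exact ENNReal.mul_ne_top ENNReal.ofReal_ne_top h1⟩
  have hcone : ∀ (x : Sph m) (r : ℝ), 0 < r →
      r ^ m * v₁ ≤ volume.real (slopeCone (x : EuclideanSpace ℝ (Fin (m + 1))) r) ∧
      volume.real (slopeCone (x : EuclideanSpace ℝ (Fin (m + 1))) r) ≤ r ^ m * v₂ := by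
    intro x r hr
    have h1 := measureReal_mono (μ := volume) (slopeCone_one_subset (norm_eq_of_mem_sphere x))
      (h₂ := measure_ball_lt_top.ne)
    have h2 := measureReal_mono (μ := volume) (ball_subset_slopeCone_one (norm_eq_of_mem_sphere x))
      (h₂ := (hfin x 1).1)
    rw [measureReal_def, measureReal_def, Measure.addHaar_ball_center] at h2
    rw [measureReal_def, volume_slopeCone (by simp) hr, ENNReal.toReal_mul,
      ENNReal.toReal_ofReal (by positivity)]
    exact ⟨by gcongr; exact h2, by gcongr; exact h1⟩
  have hsph : ∀ (x : Sph m) (r : ℝ), (surfaceMeasure m).real (Metric.closedBall x r) =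
      (m + 1) * volume.real (Ioo (0 : ℝ) 1 •
        ((↑) '' Metric.closedBall x r : Set (EuclideanSpace ℝ (Fin (m + 1))))) := by
    intro x r
    rw [measureReal_def, surfaceMeasure, Measure.toSphere_apply' _ measurableSet_closedBall,
      ENNReal.toReal_mul, finrank_euclideanSpace, Fintype.card_fin, measureReal_def,
      ENNReal.toReal_natCast, Nat.cast_add, Nat.cast_one]
  -- The lower constant comes from halving the cone of slope r / 4, whose cap lies in the ball of
  -- radius r / 2. The total mass in the upper constant takes care of radii above 1.
  refine ⟨(m + 1) * ((1 / 2) ^ (m + 1) * ((1 / 4) ^ m * v₁)),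
    (m + 1) * (2 ^ m * v₂) + (surfaceMeasure m).real univ, by positivity, by positivity,
    fun x r hr => ⟨fun hr1 => ?_, ?_⟩⟩
  · have h1 : (surfaceMeasure m).real (Metric.closedBall x (2 * (r / 4))) ≤
        (surfaceMeasure m).real (Metric.ball x r) :=
      measureReal_mono (Metric.closedBall_subset_ball (by linarith))
    refine le_trans ?_ h1
    rw [hsph, mul_assoc]
    gcongr
    have h2 := measureReal_mono (μ := volume)
      (smul_slopeCone_subset x (r := r / 4) (by linarith) (by linarith))
      (h₂ := ((measure_mono (Ioo_smul_ball_subset_slopeCone x (by linarith))).trans_lt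
        ((hfin x _).2 (by linarith)).lt_top).ne)
    refine le_trans ?_ h2
    rw [measureReal_def, Measure.addHaar_smul, ENNReal.toReal_mul, finrank_euclideanSpace,
      Fintype.card_fin, abs_of_pos (by positivity), ENNReal.toReal_ofReal (by positivity),
      ← measureReal_def, mul_assoc]
    gcongr
    refine le_trans (le_of_eq ?_) (hcone x (r / 4) (by linarith)).1
    rw [div_pow, div_pow]
    ring
  · rcases le_or_gt r 1 with hr1 | hr1
    · have h1 : (surfaceMeasure m).real (Metric.closedBall x r) ≤
          (m + 1) * (2 ^ m * v₂) * r ^ m := by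
        rw [hsph, mul_assoc]
        gcongr
        refine (measureReal_mono (Ioo_smul_ball_subset_slopeCone x hr1)
          (h₂ := (hfin x _).2 (by linarith))).trans ?_
        refine (hcone x _ (by linarith)).2.trans (le_of_eq ?_)
        rw [mul_pow]
        ring
      refine h1.trans ?_
      gcongr
      exact le_add_of_nonneg_right measureReal_nonneg
    · calc (surfaceMeasure m).real (Metric.closedBall x r)
          ≤ (surfaceMeasure m).real univ := measureReal_mono (subset_univ _)
        _ ≤ (surfaceMeasure m).real univ * r ^ m :=
            le_mul_of_one_le_right measureReal_nonneg (one_le_pow₀ hr1.le)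
        _ ≤ _ := by
            gcongr
            exact le_add_of_nonneg_left (by positivity)

end Cone

end GapPotential

end

noncomputable section

namespace GapPotential

/-! ### Averages and their hyperbolic Lipschitz bound -/

section Average

theorem integrable_of_continuous_sphere {m : ℕ} {E : Type*} [NormedAddCommGroup E]
    {F : Sph m → E} (hF : Continuous F) :
    Integrable F (surfaceMeasure m) := by
  rw [← integrableOn_univ]
  exact hF.continuousOn.integrableOn_compact isCompact_univ

variable {m : ℕ} {E : Type*} [NormedAddCommGroup E] [NormedSpace ℝ E]

/-- The tent of height and radius `r` around `x`. -/
def tent (x : Sph m) (r : ℝ) (y : Sph m) : ℝ := max 0 (r - dist x y)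

theorem tent_nonneg (x : Sph m) (r : ℝ) (y : Sph m) : 0 ≤ tent x r y := le_max_left _ _

theorem continuous_tent (x : Sph m) (r : ℝ) : Continuous (tent x r) := by
  unfold tent
  fun_prop

theorem tent_le {x : Sph m} {r : ℝ} (hr : 0 ≤ r) (y : Sph m) : tent x r y ≤ r :=
  max_le hr (by linarith [dist_nonneg (x := x) (y := y)])

theorem tent_eq_zero {x : Sph m} {r : ℝ} {y : Sph m} (h : r ≤ dist x y) : tent x r y = 0 :=
  max_eq_left (by linarith)

theorem abs_tent_sub_tent_le (x x' : Sph m) (r r' : ℝ) (y : Sph m) :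
    |tent x r y - tent x' r' y| ≤ dist x x' + |r - r'| := by
  unfold tent
  rw [max_comm 0, max_comm 0]
  refine (abs_max_sub_max_le_abs _ _ _).trans ?_
  have h1 := abs_dist_sub_le x x' y
  have h2 := abs_sub (r - r') (dist x y - dist x' y)
  rw [show (r - dist x y) - (r' - dist x' y) = (r - r') - (dist x y - dist x' y) by ring]
  linarith

/-- The total mass of the tent. -/
def tentMass (x : Sph m) (r : ℝ) : ℝ := ∫ y, tent x r y ∂surfaceMeasure m

/-- The average of `F` weighted by the tent around `x` of radius `r`. -/
def tentAverage (F : Sph m → E) (x : Sph m) (r : ℝ) : E :=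
  (tentMass x r)⁻¹ • ∫ y, tent x r y • F y ∂surfaceMeasure m

theorem exists_tentMass_bound (m : ℕ) :
    ∃ c : ℝ, 0 < c ∧ ∀ (x : Sph m) (r : ℝ), 0 < r → r ≤ 1 → c * r ^ (m + 1) ≤ tentMass x r := by
  obtain ⟨c, _, hc, _, h⟩ := exists_surfaceMeasure_ball_bounds m
  refine ⟨c * (1 / 2) ^ (m + 1), by positivity, fun x r hr hr1 => ?_⟩
  have h1 := (h x (r / 2) (by linarith)).1 (by linarith)
  calc c * (1 / 2) ^ (m + 1) * r ^ (m + 1) = (c * (r / 2) ^ m) * (r / 2) := by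
        rw [div_pow, div_pow, pow_succ, pow_succ]
        field_simp
        ring
    _ ≤ (surfaceMeasure m).real (Metric.ball x (r / 2)) * (r / 2) := by gcongr
    _ = ∫ y in Metric.ball x (r / 2), r / 2 ∂surfaceMeasure m := by
        rw [setIntegral_const, smul_eq_mul]
    _ ≤ ∫ y in Metric.ball x (r / 2), tent x r y ∂surfaceMeasure m := by
        refine setIntegral_mono_on (integrable_const _)
          (integrable_of_continuous_sphere (continuous_tent x r)).integrableOn
          measurableSet_ball fun y hy => ?_
        rw [Metric.mem_ball, dist_comm] at hy
        exact le_max_of_le_right (by linarith)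
    _ ≤ tentMass x r := setIntegral_le_integral
        (integrable_of_continuous_sphere (continuous_tent x r))
        (Filter.Eventually.of_forall (tent_nonneg x r))

theorem tentMass_pos (x : Sph m) {r : ℝ} (hr : 0 < r) (hr1 : r ≤ 1) : 0 < tentMass x r := by
  obtain ⟨c, hc, h⟩ := exists_tentMass_bound m
  exact lt_of_lt_of_le (by positivity) (h x r hr hr1)

theorem dist_tentAverage_le [CompleteSpace E] {F : Sph m → E} (hF : Continuous F) {x : Sph m}
    {r : ℝ} (hr : 0 < r) (hr1 : r ≤ 1) (z : E) :
    dist (tentAverage F x r) z ≤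
      (tentMass x r)⁻¹ * ∫ y, tent x r y * dist (F y) z ∂surfaceMeasure m := by
  have hW := tentMass_pos x hr hr1
  have ht := continuous_tent x r
  have h1 : tentAverage F x r - z =
      (tentMass x r)⁻¹ • ∫ y, tent x r y • (F y - z) ∂surfaceMeasure m := by
    simp only [smul_sub]
    rw [integral_sub (integrable_of_continuous_sphere (by fun_prop))
      (integrable_of_continuous_sphere (by fun_prop)), integral_smul_const, smul_sub, smul_smul]
    change _ = _ - (_ * tentMass x r) • z
    rw [inv_mul_cancel₀ hW.ne', one_smul, tentAverage]
  rw [dist_eq_norm, h1, norm_smul, norm_inv, Real.norm_eq_abs, abs_of_pos hW]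
  gcongr
  refine (norm_integral_le_integral_norm _).trans (le_of_eq ?_)
  congr with y
  rw [norm_smul, Real.norm_eq_abs, abs_of_nonneg (tent_nonneg _ _ _), dist_eq_norm]

theorem dist_tentAverage_le_of_forall [CompleteSpace E] {F : Sph m → E} (hF : Continuous F)
    {x : Sph m} {r : ℝ} (hr : 0 < r) (hr1 : r ≤ 1) {z : E} {δ : ℝ}
    (h : ∀ y, dist x y < r → dist (F y) z ≤ δ) : dist (tentAverage F x r) z ≤ δ := by
  have hW := tentMass_pos x hr hr1
  have ht := continuous_tent x r
  refine (dist_tentAverage_le hF hr hr1 z).trans ?_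
  rw [inv_mul_le_iff₀ hW]
  change _ ≤ (∫ y, tent x r y ∂surfaceMeasure m) * δ
  rw [← integral_mul_const]
  refine integral_mono (integrable_of_continuous_sphere (by fun_prop))
    (integrable_of_continuous_sphere (by fun_prop)) fun y => ?_
  rcases lt_or_ge (dist x y) r with hy | hy
  · exact mul_le_mul_of_nonneg_left (h y hy) (tent_nonneg _ _ _)
  · simp [tent_eq_zero hy]

/-- The average of a bounded map is Lipschitz with respect to the hyperbolic distance. -/
theorem exists_dist_tentAverage_le (m : ℕ) (M : ℝ) (hM : 0 < M) :
    ∃ C : ℝ, 0 < C ∧ ∀ (F : Sph m → E), Continuous F → (∀ y, ‖F y‖ ≤ M) →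
      ∀ (x x' : Sph m) (r r' : ℝ), 0 < r → r ≤ 1 → 0 < r' → r' ≤ 1 →
      dist (tentAverage F x r) (tentAverage F x' r') ≤ C * ((dist x x' + |r - r'|) / r) := by
  obtain ⟨c, hc, hmass⟩ := exists_tentMass_bound m
  obtain ⟨_, C, _, hC, hball⟩ := exists_surfaceMeasure_ball_bounds m
  have main : ∀ (F : Sph m → E), Continuous F → (∀ y, ‖F y‖ ≤ M) →
      ∀ (x x' : Sph m) (r r' : ℝ), r ≤ 1 → 0 < r' → r' ≤ r →
      dist (tentAverage F x r) (tentAverage F x' r') ≤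
        4 * C * M / c * ((dist x x' + |r - r'|) / r) := by
    intro F hF hFM x x' r r' hr1 hr' hrr
    have hr : 0 < r := hr'.trans_le hrr
    have hW := tentMass_pos x hr hr1
    have hW' := tentMass_pos x' hr' (hrr.trans hr1)
    have ht := continuous_tent x r
    have ht' := continuous_tent x' r'
    set Δ := dist x x' + |r - r'| with hΔ
    have hΔ0 : 0 ≤ Δ := by positivity
    set S := Metric.closedBall x r ∪ Metric.closedBall x' r' with hS
    have hSm : MeasurableSet S := measurableSet_closedBall.union measurableSet_closedBall
    -- Two tents differ by at most Δ, and only on S, of measure of order r ^ m; the mass of a tent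
    -- is at least of order r ^ (m + 1). The quotient has order Δ / r.
    have hSσ : (surfaceMeasure m).real S ≤ 2 * C * r ^ m := by
      refine (measureReal_union_le _ _).trans ?_
      have h1 := (hball x r hr).2
      have h2 := (hball x' r' hr').2
      have h3 : C * r' ^ m ≤ C * r ^ m := by gcongr
      linarith
    have hdiff : ∫ y, |tent x r y - tent x' r' y| ∂surfaceMeasure m ≤ 2 * C * r ^ m * Δ := by
      calc ∫ y, |tent x r y - tent x' r' y| ∂surfaceMeasure m
          ≤ ∫ y, S.indicator (fun _ => Δ) y ∂surfaceMeasure m := by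
            refine integral_mono (integrable_of_continuous_sphere (by fun_prop))
              ((integrable_const _).indicator hSm) fun y => ?_
            by_cases hy : y ∈ S
            · simp only [indicator_of_mem hy]
              exact abs_tent_sub_tent_le _ _ _ _ _
            · simp only [indicator_of_notMem hy]
              simp only [hS, mem_union, Metric.mem_closedBall, not_or, not_le] at hy
              rw [tent_eq_zero (by rw [dist_comm]; exact hy.1.le),
                tent_eq_zero (by rw [dist_comm]; exact hy.2.le)]
              simp
        _ = (surfaceMeasure m).real S * Δ := by
            rw [integral_indicator hSm, setIntegral_const, smul_eq_mul]
        _ ≤ _ := by gcongr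
    set A := ∫ y, tent x r y • F y ∂surfaceMeasure m with hA
    set A' := ∫ y, tent x' r' y • F y ∂surfaceMeasure m with hA'
    have hAA : ‖A - A'‖ ≤ 2 * C * r ^ m * Δ * M := by
      rw [hA, hA', ← integral_sub (integrable_of_continuous_sphere (by fun_prop))
        (integrable_of_continuous_sphere (by fun_prop))]
      refine (norm_integral_le_integral_norm _).trans ?_
      refine le_trans ?_ (mul_le_mul_of_nonneg_right hdiff hM.le)
      rw [← integral_mul_const]
      refine integral_mono (integrable_of_continuous_sphere (by fun_prop))
        (integrable_of_continuous_sphere (by fun_prop)) fun y => ?_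
      simp only [← sub_smul, norm_smul, Real.norm_eq_abs]
      gcongr
      exact hFM y
    have hWW : |tentMass x' r' - tentMass x r| ≤ 2 * C * r ^ m * Δ := by
      rw [abs_sub_comm, tentMass, tentMass,
        ← integral_sub (integrable_of_continuous_sphere (by fun_prop))
        (integrable_of_continuous_sphere (by fun_prop))]
      exact (abs_integral_le_integral_abs).trans hdiff
    have hA'W : ‖A'‖ ≤ tentMass x' r' * M := by
      refine (norm_integral_le_integral_norm _).trans ?_
      rw [tentMass, ← integral_mul_const]
      refine integral_mono (integrable_of_continuous_sphere (by fun_prop))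
        (integrable_of_continuous_sphere (by fun_prop)) fun y => ?_
      simp only [norm_smul, Real.norm_eq_abs, abs_of_nonneg (tent_nonneg _ _ _)]
      exact mul_le_mul_of_nonneg_left (hFM y) (tent_nonneg _ _ _)
    have hsplit : tentAverage F x r - tentAverage F x' r' = (tentMass x r)⁻¹ • ((A - A') +
        ((tentMass x' r' - tentMass x r) * (tentMass x' r')⁻¹) • A') := by
      rw [tentAverage, tentAverage, ← hA, ← hA', smul_add, smul_sub, smul_smul]
      have : (tentMass x r)⁻¹ * ((tentMass x' r' - tentMass x r) * (tentMass x' r')⁻¹) =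
          (tentMass x r)⁻¹ - (tentMass x' r')⁻¹ := by
        field_simp
      rw [this, sub_smul]
      abel
    rw [dist_eq_norm, hsplit, norm_smul, norm_inv, Real.norm_eq_abs, abs_of_pos hW,
      inv_mul_le_iff₀ hW]
    have h1 : ‖((tentMass x' r' - tentMass x r) * (tentMass x' r')⁻¹) • A'‖ ≤
        2 * C * r ^ m * Δ * M := by
      rw [norm_smul, Real.norm_eq_abs, abs_mul, abs_inv, abs_of_pos hW']
      calc |tentMass x' r' - tentMass x r| * (tentMass x' r')⁻¹ * ‖A'‖
          ≤ (2 * C * r ^ m * Δ) * (tentMass x' r')⁻¹ * (tentMass x' r' * M) := by gcongr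
        _ = _ := by field_simp
    have h2 : 4 * C * M * r ^ m * Δ ≤ tentMass x r * (4 * C * M / c * (Δ / r)) := by
      calc 4 * C * M * r ^ m * Δ = (c * r ^ (m + 1)) * (4 * C * M / c * (Δ / r)) := by
            rw [pow_succ]
            field_simp
        _ ≤ _ := by gcongr; exact hmass x r hr hr1
    have h3 := norm_add_le (A - A') (((tentMass x' r' - tentMass x r) * (tentMass x' r')⁻¹) • A')
    linarith
  refine ⟨4 * C * M / c, by positivity, fun F hF hFM x x' r r' hr hr1 hr' hr1' => ?_⟩
  rcases le_total r' r with h | h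
  · exact main F hF hFM x x' r r' hr1 hr' h
  -- `main` divides by the larger radius, which is stronger than dividing by r.
  · rw [dist_comm, dist_comm x, abs_sub_comm]
    refine (main F hF hFM x' x r' r hr1' hr h).trans ?_
    gcongr

end Average

end GapPotential

end

noncomputable section

namespace GapPotential

/-! ### Bad balls carry energy -/

section Energy

variable {m : ℕ} {N E : Type*} [EMetricSpace N] [NormedAddCommGroup E]

/-- The pairs of points of a ball whose distance is comparable with its radius. -/
def spreadPairs (θ : ℝ) (x : Sph m) (r : ℝ) : Set (Sph m × Sph m) :=
  {p | dist p.1 x < r ∧ dist p.2 x < r ∧ θ * r ≤ dist p.2 p.1}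

theorem measurableSet_spreadPairs (θ : ℝ) (x : Sph m) (r : ℝ) :
    MeasurableSet (spreadPairs θ x r) := by
  have h1 : MeasurableSet {p : Sph m × Sph m | dist p.1 x < r} :=
    (isOpen_lt (by fun_prop) continuous_const).measurableSet
  have h2 : MeasurableSet {p : Sph m × Sph m | dist p.2 x < r} :=
    (isOpen_lt (by fun_prop) continuous_const).measurableSet
  have h3 : MeasurableSet {p : Sph m × Sph m | θ * r ≤ dist p.2 p.1} :=
    (isClosed_le continuous_const (by fun_prop)).measurableSet
  exact h1.inter (h2.inter h3)

theorem measurableSet_gap (ε : ℝ) (f : C(Sph m, N)) :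
    MeasurableSet {p : Sph m × Sph m | ENNReal.ofReal ε < edist (f p.2) (f p.1)} :=
  (isOpen_lt continuous_const (by fun_prop)).measurableSet

theorem disjoint_spreadPairs_of_lt {θ : ℝ} {x x' : Sph m} {r r' : ℝ} (h : 2 * r' < θ * r) :
    Disjoint (spreadPairs θ x r) (spreadPairs θ x' r') := by
  rw [Set.disjoint_left]
  rintro p ⟨-, -, h3⟩ ⟨h1, h2, -⟩
  have := dist_triangle_right p.2 p.1 x'
  linarith

theorem disjoint_spreadPairs_of_add_le {θ : ℝ} {x x' : Sph m} {r r' : ℝ}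
    (h : r + r' ≤ dist x x') : Disjoint (spreadPairs θ x r) (spreadPairs θ x' r') := by
  rw [Set.disjoint_left]
  rintro p ⟨h1, -, -⟩ ⟨h2, -, -⟩
  have := dist_triangle_left x x' p.1
  linarith

variable [NormedSpace ℝ E]

namespace RetractionData

variable (R : RetractionData N E)

/-- The average of `f` at `x` at scale `r` is far from the image of `N`. -/
def IsBad (f : C(Sph m, N)) (x : Sph m) (r : ℝ) : Prop :=
  tentAverage (fun y => R.emb (f y)) x r ∉ R.tube

/-- A bad average is at distance more than η from the image of f y'. Points y with f y within ε of f
y' account for at most η / 2 of this, so the other points, each contributing at most 2 M times the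
weight, must fill a fixed proportion of the ball. -/
theorem exists_measure_gap_bound [CompleteSpace E] (m : ℕ) {M : ℝ} (hM : 0 < M)
    (hRM : ∀ y, ‖R.emb y‖ ≤ M) :
    ∃ c : ℝ, 0 < c ∧ ∀ (ε : ℝ),
      (∀ y y', edist y y' ≤ ENNReal.ofReal ε → dist (R.emb y) (R.emb y') ≤ R.η / 2) →
      ∀ (f : C(Sph m, N)) (x : Sph m) (r : ℝ), 0 < r → r ≤ 1 → R.IsBad f x r → ∀ y',
      c * r ^ m ≤ (surfaceMeasure m).real
        ({y | ENNReal.ofReal ε < edist (f y) (f y')} ∩ Metric.ball x r) := by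
  obtain ⟨c, hc, hmass⟩ := exists_tentMass_bound m
  have hη := R.η_pos
  refine ⟨R.η * c / (4 * M), by positivity, fun ε hε f x r hr hr1 hbad y' => ?_⟩
  have hW := tentMass_pos x hr hr1
  have ht := continuous_tent x r
  have hF : Continuous fun y => R.emb (f y) := by fun_prop
  set A := {y | ENNReal.ofReal ε < edist (f y) (f y')} ∩ Metric.ball x r with hA
  have hAm : MeasurableSet A :=
    (isOpen_lt continuous_const (by fun_prop)).measurableSet.inter measurableSet_ball
  have h1 := (R.η_lt_dist_of_notMem_tube hbad (f y')).trans_le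
    (dist_tentAverage_le hF hr hr1 (R.emb (f y')))
  have h2 : ∫ y, tent x r y * dist (R.emb (f y)) (R.emb (f y')) ∂surfaceMeasure m ≤
      tentMass x r * (R.η / 2) + (surfaceMeasure m).real A * (r * (2 * M)) := by
    have hind : Integrable (A.indicator fun _ => r * (2 * M)) (surfaceMeasure m) :=
      (integrable_const _).indicator hAm
    calc ∫ y, tent x r y * dist (R.emb (f y)) (R.emb (f y')) ∂surfaceMeasure m
        ≤ ∫ y, (tent x r y * (R.η / 2) + A.indicator (fun _ => r * (2 * M)) y)
            ∂surfaceMeasure m := by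
          refine integral_mono (integrable_of_continuous_sphere (by fun_prop))
            ((integrable_of_continuous_sphere (by fun_prop)).add hind) fun y => ?_
          have h0 := tent_nonneg x r y
          by_cases hy : y ∈ A
          · simp only [indicator_of_mem hy]
            have h3 : dist (R.emb (f y)) (R.emb (f y')) ≤ 2 * M := by
              have h4 := dist_le_norm_add_norm (R.emb (f y)) (R.emb (f y'))
              linarith [hRM (f y), hRM (f y')]
            have h5 : tent x r y * dist (R.emb (f y)) (R.emb (f y')) ≤ r * (2 * M) :=
              mul_le_mul (tent_le hr.le y) h3 dist_nonneg hr.le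
            have : 0 ≤ tent x r y * (R.η / 2) := by positivity
            linarith
          · simp only [indicator_of_notMem hy, add_zero]
            by_cases hyb : y ∈ Metric.ball x r
            · refine mul_le_mul_of_nonneg_left (hε _ _ ?_) h0
              by_contra hlt
              exact hy ⟨not_le.1 hlt, hyb⟩
            · rw [Metric.mem_ball, not_lt, dist_comm] at hyb
              simp [tent_eq_zero hyb]
      _ = _ := by
          rw [integral_add (integrable_of_continuous_sphere (by fun_prop)) hind,
            integral_mul_const, integral_indicator hAm, setIntegral_const, smul_eq_mul, tentMass]
  rw [lt_inv_mul_iff₀ hW] at h1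
  have h3 := hmass x r hr hr1
  have h4 : (c * r ^ (m + 1)) * (R.η / 2) ≤ (surfaceMeasure m).real A * (r * (2 * M)) := by
    calc (c * r ^ (m + 1)) * (R.η / 2) ≤ tentMass x r * (R.η / 2) := by gcongr
      _ ≤ _ := by linarith
  refine le_of_mul_le_mul_right (le_trans (le_of_eq ?_) h4) (by positivity : 0 < r * (2 * M))
  rw [pow_succ]
  field_simp
  ring

/-- The previous bound holds for each y' in the ball, so the pairs with a gap have product measure
of order r ^ (2 m). The kernel is at least (2 r) ^ (-2 m) there, and the powers of r cancel. -/
theorem exists_energy_bound [CompleteSpace E] (hm : 1 ≤ m) {M : ℝ} (hM : 0 < M)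
    (hRM : ∀ y, ‖R.emb y‖ ≤ M) :
    ∃ θ c : ℝ, 0 < θ ∧ θ ≤ 1 ∧ 0 < c ∧ ∀ (ε : ℝ),
      (∀ y y', edist y y' ≤ ENNReal.ofReal ε → dist (R.emb y) (R.emb y') ≤ R.η / 2) →
      ∀ (f : C(Sph m, N)) (x : Sph m) (r : ℝ), 0 < r → r ≤ 1 → R.IsBad f x r →
      ENNReal.ofReal c ≤ ∫⁻ p in spreadPairs θ x r ∩
        {p : Sph m × Sph m | ENNReal.ofReal ε < edist (f p.2) (f p.1)},
        ENNReal.ofReal (1 / dist p.2 p.1 ^ (2 * m))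
          ∂((surfaceMeasure m).prod (surfaceMeasure m)) := by
  obtain ⟨c₁, hc₁, hgap⟩ := R.exists_measure_gap_bound m hM hRM
  obtain ⟨c₀, C, hc₀, hC, hball⟩ := exists_surfaceMeasure_ball_bounds m
  -- θ is so small that removing the ball of radius θ r around y' loses at most half of the gap set;
  -- since m ≥ 1, θ ^ m ≤ θ.
  set θ := min 1 (c₁ / (2 * C)) with hθ
  have hθ0 : 0 < θ := lt_min one_pos (by positivity)
  have hθ1 : θ ≤ 1 := min_le_left _ _
  have hθm : C * θ ^ m ≤ c₁ / 2 := by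
    have h1 : θ ^ m ≤ θ := pow_le_of_le_one hθ0.le hθ1 (by omega)
    have h2 : θ ≤ c₁ / (2 * C) := min_le_right _ _
    calc C * θ ^ m ≤ C * (c₁ / (2 * C)) := by gcongr; exact h1.trans h2
      _ = c₁ / 2 := by field_simp
  refine ⟨θ, c₁ / 2 * c₀ / 2 ^ (2 * m), hθ0, hθ1, by positivity,
    fun ε hε f x r hr hr1 hbad => ?_⟩
  set P := spreadPairs θ x r ∩
    {p : Sph m × Sph m | ENNReal.ofReal ε < edist (f p.2) (f p.1)} with hP
  have hPm : MeasurableSet P := (measurableSet_spreadPairs _ _ _).inter (measurableSet_gap _ _)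
  have hslice : ∀ y' ∈ Metric.ball x r, ENNReal.ofReal (c₁ / 2 * r ^ m) ≤
      surfaceMeasure m (Prod.mk y' ⁻¹' P) := by
    intro y' hy'
    have h1 := hgap ε hε f x r hr hr1 hbad y'
    set A := {y | ENNReal.ofReal ε < edist (f y) (f y')} ∩ Metric.ball x r with hA
    have hsub : A ⊆ (Prod.mk y' ⁻¹' P) ∪ Metric.closedBall y' (θ * r) := by
      rintro y ⟨hy, hyb⟩
      by_cases hyy : y ∈ Metric.closedBall y' (θ * r)
      · exact Or.inr hyy
      · rw [Metric.mem_closedBall, not_le] at hyy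
        exact Or.inl ⟨⟨hy', hyb, hyy.le⟩, hy⟩
    have h2 := (measureReal_mono hsub (measure_ne_top (surfaceMeasure m) _)).trans
      (measureReal_union_le _ _)
    have h3 := (hball y' (θ * r) (by positivity)).2
    have h4 : C * (θ * r) ^ m ≤ c₁ / 2 * r ^ m := by
      rw [mul_pow, ← mul_assoc]
      gcongr
    rw [ENNReal.ofReal_le_iff_le_toReal (measure_ne_top _ _), ← measureReal_def]
    linarith
  have hprod : ENNReal.ofReal (c₁ / 2 * r ^ m * (c₀ * r ^ m)) ≤
      ((surfaceMeasure m).prod (surfaceMeasure m)) P := by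
    rw [Measure.prod_apply hPm]
    calc ENNReal.ofReal (c₁ / 2 * r ^ m * (c₀ * r ^ m))
        ≤ ENNReal.ofReal (c₁ / 2 * r ^ m) * surfaceMeasure m (Metric.ball x r) := by
          rw [ENNReal.ofReal_mul (by positivity)]
          gcongr
          rw [ENNReal.ofReal_le_iff_le_toReal (measure_ne_top _ _), ← measureReal_def]
          exact (hball x r hr).1 hr1
      _ = ∫⁻ _ in Metric.ball x r, ENNReal.ofReal (c₁ / 2 * r ^ m) ∂surfaceMeasure m := by
          rw [setLIntegral_const]
      _ ≤ ∫⁻ y' in Metric.ball x r, surfaceMeasure m (Prod.mk y' ⁻¹' P) ∂surfaceMeasure m :=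
          setLIntegral_mono' measurableSet_ball hslice
      _ ≤ _ := setLIntegral_le_lintegral _ _
  calc ENNReal.ofReal (c₁ / 2 * c₀ / 2 ^ (2 * m))
      = ENNReal.ofReal (1 / (2 * r) ^ (2 * m)) *
          ENNReal.ofReal (c₁ / 2 * r ^ m * (c₀ * r ^ m)) := by
        rw [← ENNReal.ofReal_mul (by positivity)]
        congr 1
        rw [mul_pow, two_mul m, pow_add r, pow_add 2]
        field_simp
    _ ≤ ENNReal.ofReal (1 / (2 * r) ^ (2 * m)) *
          ((surfaceMeasure m).prod (surfaceMeasure m)) P := by gcongr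
    _ = ∫⁻ _ in P, ENNReal.ofReal (1 / (2 * r) ^ (2 * m))
          ∂((surfaceMeasure m).prod (surfaceMeasure m)) := by rw [setLIntegral_const]
    _ ≤ _ := by
        refine setLIntegral_mono' hPm fun p hp => ENNReal.ofReal_le_ofReal ?_
        obtain ⟨⟨h1, h2, h3⟩, -⟩ := hp
        have h4 := dist_triangle_right p.2 p.1 x
        have h5 : 0 < dist p.2 p.1 := lt_of_lt_of_le (by positivity) h3
        gcongr
        linarith

/-- A family of bad balls with disjoint sets of spread pairs has a number of elements bounded by
the energy. -/
theorem exists_card_bad_le [CompleteSpace E] (hm : 1 ≤ m) {M : ℝ} (hM : 0 < M)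
    (hRM : ∀ y, ‖R.emb y‖ ≤ M) :
    ∃ θ : ℝ, 0 < θ ∧ θ ≤ 1 ∧ ∀ Λ : ℝ, ∃ K : ℕ, ∀ (ε : ℝ),
      (∀ y y', edist y y' ≤ ENNReal.ofReal ε → dist (R.emb y) (R.emb y') ≤ R.η / 2) →
      ∀ f : C(Sph m, N), gapPotential ε f ≤ ENNReal.ofReal Λ →
      ∀ Q : Finset (Sph m × ℝ), (∀ q ∈ Q, 0 < q.2 ∧ q.2 ≤ 1 ∧ R.IsBad f q.1 q.2) →
      (Q : Set (Sph m × ℝ)).PairwiseDisjoint (fun q => spreadPairs θ q.1 q.2) → Q.card ≤ K := by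
  obtain ⟨θ, c, hθ0, hθ1, hc, h⟩ := R.exists_energy_bound hm hM hRM
  refine ⟨θ, hθ0, hθ1, fun Λ => ⟨⌊Λ / c⌋₊, fun ε hε f hf Q hQ hdisj => ?_⟩⟩
  rcases Q.eq_empty_or_nonempty with rfl | hne
  · simp
  have h1 : (Q.card : ℝ≥0∞) * ENNReal.ofReal c ≤ gapPotential ε f := by
    calc (Q.card : ℝ≥0∞) * ENNReal.ofReal c = ∑ q ∈ Q, ENNReal.ofReal c := by
          rw [Finset.sum_const, nsmul_eq_mul]
      _ ≤ ∑ q ∈ Q, ∫⁻ p in spreadPairs θ q.1 q.2 ∩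
            {p : Sph m × Sph m | ENNReal.ofReal ε < edist (f p.2) (f p.1)},
            ENNReal.ofReal (1 / dist p.2 p.1 ^ (2 * m))
              ∂((surfaceMeasure m).prod (surfaceMeasure m)) :=
          Finset.sum_le_sum fun q hq =>
            h ε hε f q.1 q.2 (hQ q hq).1 (hQ q hq).2.1 (hQ q hq).2.2
      _ = ∫⁻ p in ⋃ q ∈ Q, spreadPairs θ q.1 q.2 ∩
            {p : Sph m × Sph m | ENNReal.ofReal ε < edist (f p.2) (f p.1)},
            ENNReal.ofReal (1 / dist p.2 p.1 ^ (2 * m))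
              ∂((surfaceMeasure m).prod (surfaceMeasure m)) := by
          rw [lintegral_biUnion_finset]
          · exact fun q hq q' hq' hne =>
              (hdisj hq hq' hne).mono inter_subset_left inter_subset_left
          · exact fun q _ => (measurableSet_spreadPairs _ _ _).inter (measurableSet_gap _ _)
      _ ≤ gapPotential ε f :=
          lintegral_mono_set (iUnion₂_subset fun q _ => inter_subset_right)
  have h2 := h1.trans hf
  rw [← ENNReal.ofReal_natCast, ← ENNReal.ofReal_mul (by positivity)] at h2
  have h3 : (Q.card : ℝ) * c ≤ Λ := by
    by_contra hlt
    have h4 : 0 < (Q.card : ℝ) * c := by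
      have := hne.card_pos
      positivity
    -- Λ may be negative, and `ENNReal.ofReal` truncates it to 0; positivity of the left side rules
    -- this out.
    have := (ENNReal.ofReal_le_ofReal_iff' (p := (Q.card : ℝ) * c) (q := Λ)).1 h2
    rcases this with h5 | h5 <;> linarith
  exact Nat.le_floor ((le_div_iff₀ hc).2 h3)

end RetractionData

end Energy

end GapPotential

end

noncomputable section

namespace GapPotential

/-! ### The sphere as a quotient of the cube -/

section Collapse

variable {m : ℕ}

/-- The point of `[-1, 1]ᵐ` that corresponds to a point of the unit cube. -/
def centered (s : Fin m → I) (i : Fin m) : ℝ := 2 * (s i : ℝ) - 1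

theorem cubeRadius_eq_norm_centered (s : Fin m → I) : cubeRadius s = ‖centered s‖ := rfl

theorem cubeRadius_le_one (s : Fin m → I) : cubeRadius s ≤ 1 := by
  refine (pi_norm_le_iff_of_nonneg zero_le_one).2 fun i => ?_
  rw [Real.norm_eq_abs, abs_le]
  constructor <;> linarith [(s i).2.1, (s i).2.2]

theorem mem_boundary_iff_cubeRadius {s : Fin m → I} :
    s ∈ Cube.boundary (Fin m) ↔ cubeRadius s = 1 := by
  refine ⟨cubeRadius_of_mem_boundary, fun h => ?_⟩
  obtain ⟨i, hi⟩ := exists_of_cubeRadius_eq one_pos h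
  refine ⟨i, ?_⟩
  rcases (abs_eq zero_le_one).1 hi with h | h
  · exact Or.inr (Subtype.ext (show (s i : ℝ) = 1 by linarith))
  · exact Or.inl (Subtype.ext (show (s i : ℝ) = 0 by linarith))

/-- The denominator of the collapse. -/
def collapseDen (s : Fin m → I) : ℝ := ∑ i, centered s i ^ 2 + (1 - cubeRadius s) ^ 2

theorem collapseDen_pos (s : Fin m → I) : 0 < collapseDen s := by
  have h0 : 0 ≤ ∑ i, centered s i ^ 2 := Finset.sum_nonneg fun i _ => sq_nonneg _
  rcases h0.lt_or_eq with h | h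
  · exact add_pos_of_pos_of_nonneg h (sq_nonneg _)
  · have h1 : centered s = 0 := by
      funext i
      have := (Finset.sum_eq_zero_iff_of_nonneg fun i _ => sq_nonneg (centered s i)).1 h.symm i
        (Finset.mem_univ i)
      exact pow_eq_zero_iff two_ne_zero |>.1 this
    rw [collapseDen, ← h, cubeRadius_eq_norm_centered, h1]
    norm_num

/-- The coordinates of the collapse. -/
def collapseCoord (s : Fin m → I) : Fin (m + 1) → ℝ :=
  Fin.snoc (α := fun _ => ℝ) (fun i => 2 * (1 - cubeRadius s) * centered s i / collapseDen s)
    ((∑ i, centered s i ^ 2 - (1 - cubeRadius s) ^ 2) / collapseDen s)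

/-- With v the centred point, the collapse is inverse stereographic projection applied to v / (1 -
‖v‖) in the sup norm. Numerator and denominator are multiplied by (1 - ‖v‖) ^ 2, which makes the
formula continuous up to the boundary. -/
theorem continuous_collapseCoord : Continuous (collapseCoord (m := m)) := by
  have hr : Continuous (cubeRadius : (Fin m → I) → ℝ) := continuous_cubeRadius
  have hc : ∀ i, Continuous fun s : Fin m → I => centered s i := fun i => by
    unfold centered
    fun_prop
  have hd : Continuous (collapseDen : (Fin m → I) → ℝ) := by
    unfold collapseDen
    fun_prop
  refine continuous_pi fun j => ?_
  refine Fin.lastCases ?_ (fun i => ?_) j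
  · simp only [collapseCoord, Fin.snoc_last]
    exact Continuous.div (by fun_prop) hd fun s => (collapseDen_pos s).ne'
  · simp only [collapseCoord, Fin.snoc_castSucc]
    exact Continuous.div (by fun_prop) hd fun s => (collapseDen_pos s).ne'

theorem norm_collapseCoord (s : Fin m → I) : ‖WithLp.toLp 2 (collapseCoord s)‖ = 1 := by
  have hd := collapseDen_pos s
  rw [← sq_eq_sq₀ (norm_nonneg _) zero_le_one, EuclideanSpace.norm_sq_eq, Fin.sum_univ_castSucc]
  simp only [collapseCoord, Fin.snoc_last, Fin.snoc_castSucc, Real.norm_eq_abs, sq_abs, div_pow,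
    mul_pow]
  rw [← Finset.sum_div, ← Finset.mul_sum, ← add_div, div_eq_iff (by positivity)]
  unfold collapseDen
  ring

/-- The map of the cube onto the sphere that collapses the boundary of the cube to the pole. -/
def collapse (m : ℕ) : C(Fin m → I, Sph m) where
  toFun s := ⟨WithLp.toLp 2 (collapseCoord s), by simp [norm_collapseCoord]⟩
  continuous_toFun := by
    have := continuous_collapseCoord (m := m)
    fun_prop

theorem collapse_apply_castSucc (s : Fin m → I) (i : Fin m) :
    (collapse m s : EuclideanSpace ℝ (Fin (m + 1))) i.castSucc =
      2 * (1 - cubeRadius s) * centered s i / collapseDen s := by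
  simp [collapse, collapseCoord]

theorem collapse_apply_last (s : Fin m → I) :
    (collapse m s : EuclideanSpace ℝ (Fin (m + 1))) (Fin.last m) =
      (∑ i, centered s i ^ 2 - (1 - cubeRadius s) ^ 2) / collapseDen s := by
  simp [collapse, collapseCoord]

/-- The pole of the sphere. -/
def pole (m : ℕ) : Sph m := ⟨EuclideanSpace.single (Fin.last m) 1, by simp⟩

theorem sum_sq_castSucc (w : Sph m) :
    ∑ i : Fin m, (w : EuclideanSpace ℝ (Fin (m + 1))) i.castSucc ^ 2 =
      1 - (w : EuclideanSpace ℝ (Fin (m + 1))) (Fin.last m) ^ 2 := by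
  have h := EuclideanSpace.norm_sq_eq (w : EuclideanSpace ℝ (Fin (m + 1)))
  rw [norm_eq_of_mem_sphere, Fin.sum_univ_castSucc] at h
  simp only [Real.norm_eq_abs, sq_abs] at h
  linarith

theorem last_le_one (w : Sph m) : (w : EuclideanSpace ℝ (Fin (m + 1))) (Fin.last m) ≤ 1 := by
  have h := sum_sq_castSucc w
  have h0 : 0 ≤ ∑ i : Fin m, (w : EuclideanSpace ℝ (Fin (m + 1))) i.castSucc ^ 2 :=
    Finset.sum_nonneg fun i _ => sq_nonneg _
  nlinarith

theorem eq_pole_of_last_eq_one {w : Sph m}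
    (h : (w : EuclideanSpace ℝ (Fin (m + 1))) (Fin.last m) = 1) : w = pole m := by
  have hs := sum_sq_castSucc w
  rw [h, one_pow, sub_self, Finset.sum_eq_zero_iff_of_nonneg fun i _ => sq_nonneg _] at hs
  refine Subtype.ext (PiLp.ext fun j => ?_)
  refine Fin.lastCases ?_ (fun i => ?_) j
  · simp [pole, h]
  · have := pow_eq_zero_iff two_ne_zero |>.1 (hs i (Finset.mem_univ i))
    simp [pole, this, Fin.castSucc_ne_last]

theorem collapse_of_mem_boundary {s : Fin m → I} (hs : s ∈ Cube.boundary (Fin m)) :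
    collapse m s = pole m := by
  refine eq_pole_of_last_eq_one ?_
  rw [collapse_apply_last, div_eq_one_iff_eq (collapseDen_pos s).ne', collapseDen,
    mem_boundary_iff_cubeRadius.1 hs]
  ring

theorem one_sub_collapse_last (s : Fin m → I) :
    1 - (collapse m s : EuclideanSpace ℝ (Fin (m + 1))) (Fin.last m) =
      2 * (1 - cubeRadius s) ^ 2 / collapseDen s := by
  have := collapseDen_pos s
  rw [collapse_apply_last, eq_div_iff this.ne', sub_mul, div_mul_cancel₀ _ this.ne']
  unfold collapseDen
  ring

theorem collapse_stereographic (s : Fin m → I) (i : Fin m) :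
    (1 - cubeRadius s) * (collapse m s : EuclideanSpace ℝ (Fin (m + 1))) i.castSucc =
      centered s i * (1 - (collapse m s : EuclideanSpace ℝ (Fin (m + 1))) (Fin.last m)) := by
  rw [one_sub_collapse_last, collapse_apply_castSucc]
  ring

/-- The last coordinate equals 1 exactly on the boundary. In the interior the stereographic
coordinate v / (1 - ‖v‖) is determined, hence so is its norm ‖v‖ / (1 - ‖v‖), and therefore ‖v‖ and
v. -/
theorem collapse_eq_iff {s s' : Fin m → I} (h : collapse m s = collapse m s') :
    s = s' ∨ s ∈ Cube.boundary (Fin m) ∧ s' ∈ Cube.boundary (Fin m) := by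
  have hd := collapseDen_pos s
  have hd' := collapseDen_pos s'
  have hl := one_sub_collapse_last s
  have hl' := one_sub_collapse_last s'
  rw [← h] at hl'
  rcases (cubeRadius_le_one s).lt_or_eq with h1 | h1
  · have h2 : cubeRadius s' < 1 := by
      refine (cubeRadius_le_one s').lt_of_ne fun h2 => ?_
      rw [h2, sub_self, zero_pow two_ne_zero, mul_zero, zero_div] at hl'
      rw [hl', eq_comm, div_eq_zero_iff] at hl
      have : 0 < 2 * (1 - cubeRadius s) ^ 2 := by
        have := sub_pos.2 h1
        positivity
      rcases hl with hl | hl <;> linarith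
    left
    set a := 1 - cubeRadius s with ha
    set a' := 1 - cubeRadius s' with ha'
    have ha0 : 0 < a := sub_pos.2 h1
    have ha0' : 0 < a' := sub_pos.2 h2
    set l := 1 - (collapse m s : EuclideanSpace ℝ (Fin (m + 1))) (Fin.last m) with hlf
    have hl0 : 0 < l := by rw [hl]; positivity
    have hc : ∀ i, centered s i * a' = centered s' i * a := by
      intro i
      have e1 := collapse_stereographic s i
      have e2 := collapse_stereographic s' i
      rw [← h, ← ha', ← hlf] at e2
      rw [← ha, ← hlf] at e1
      have : (centered s i * a' - centered s' i * a) * l = 0 := by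
        linear_combination -a' * e1 + a * e2
      rcases mul_eq_zero.1 this with h3 | h3
      · linarith
      · exact absurd h3 hl0.ne'
    have hn : cubeRadius s * a' = cubeRadius s' * a := by
      have e : a' • centered s = a • centered s' := by
        funext i
        simp only [Pi.smul_apply, smul_eq_mul]
        linarith [hc i]
      have e2 := congrArg norm e
      rw [norm_smul, norm_smul, Real.norm_eq_abs, Real.norm_eq_abs, abs_of_pos ha0,
        abs_of_pos ha0', ← cubeRadius_eq_norm_centered, ← cubeRadius_eq_norm_centered] at e2
      linarith
    have haa : a = a' := by
      have h3 : cubeRadius s = 1 - a := by rw [ha]; ring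
      have h4 : cubeRadius s' = 1 - a' := by rw [ha']; ring
      rw [h3, h4] at hn
      linarith
    funext i
    have h5 := hc i
    rw [haa] at h5
    have h6 := mul_right_cancel₀ ha0'.ne' h5
    simp only [centered] at h6
    exact Subtype.ext (by linarith)
  · right
    refine ⟨mem_boundary_iff_cubeRadius.2 h1, mem_boundary_iff_cubeRadius.2 ?_⟩
    rw [h1, sub_self, zero_pow two_ne_zero, mul_zero, zero_div] at hl
    rw [hl, eq_comm, div_eq_zero_iff] at hl'
    rcases hl' with hl' | hl'
    · have := pow_eq_zero_iff two_ne_zero |>.1 (by linarith : (1 - cubeRadius s') ^ 2 = 0)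
      linarith
    · exact absurd hl' hd'.ne'

/-- The inverse away from the pole is stereographic projection followed by z ↦ z / (1 + ‖z‖). The
pole needs a nonempty cube boundary, hence m ≥ 1. -/
theorem collapse_surjective (hm : 1 ≤ m) : Function.Surjective (collapse m) := by
  intro w
  rcases (last_le_one w).lt_or_eq with h | h
  · set l := (w : EuclideanSpace ℝ (Fin (m + 1))) (Fin.last m) with hl
    have hl0 : 0 < 1 - l := sub_pos.2 h
    set z : Fin m → ℝ := fun i => (w : EuclideanSpace ℝ (Fin (m + 1))) i.castSucc / (1 - l) with hz
    have hn : 0 ≤ ‖z‖ := norm_nonneg z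
    have hv : ∀ i, |z i / (1 + ‖z‖)| ≤ 1 := by
      intro i
      rw [abs_div, abs_of_pos (by positivity : 0 < 1 + ‖z‖), div_le_one (by positivity)]
      have := norm_le_pi_norm z i
      rw [Real.norm_eq_abs] at this
      linarith
    set s : Fin m → I := fun i => ⟨(z i / (1 + ‖z‖) + 1) / 2, by
      have := abs_le.1 (hv i)
      constructor <;> linarith⟩ with hs
    have hc : centered s = (1 + ‖z‖)⁻¹ • z := by
      funext i
      simp only [centered, hs, Pi.smul_apply, smul_eq_mul]
      ring
    have hr : cubeRadius s = ‖z‖ / (1 + ‖z‖) := by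
      rw [cubeRadius_eq_norm_centered, hc, norm_smul, norm_inv, Real.norm_eq_abs,
        abs_of_pos (by linarith)]
      ring
    have hr1 : 1 - cubeRadius s = (1 + ‖z‖)⁻¹ := by
      rw [hr]
      field_simp
      ring
    have hzs : ∑ i, z i ^ 2 = (1 + l) / (1 - l) := by
      simp only [hz, div_pow]
      rw [← Finset.sum_div, sum_sq_castSucc w, ← hl]
      field_simp
      ring
    have hS : ∑ i, centered s i ^ 2 = (1 + ‖z‖)⁻¹ ^ 2 * ((1 + l) / (1 - l)) := by
      rw [hc, ← hzs, Finset.mul_sum]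
      simp only [Pi.smul_apply, smul_eq_mul, mul_pow]
    have hd : collapseDen s = (1 + ‖z‖)⁻¹ ^ 2 * (2 / (1 - l)) := by
      rw [collapseDen, hS, hr1]
      field_simp
      ring
    refine ⟨s, Subtype.ext (PiLp.ext fun j => ?_)⟩
    have hz1 : 1 + ‖z‖ ≠ 0 := by positivity
    refine Fin.lastCases ?_ (fun i => ?_) j
    · rw [collapse_apply_last, hS, hr1, hd, ← hl]
      field_simp
      ring
    · rw [collapse_apply_castSucc, hr1, hd, hc]
      simp only [Pi.smul_apply, smul_eq_mul, hz]
      field_simp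
  · refine ⟨fun _ => 0, ?_⟩
    rw [collapse_of_mem_boundary ⟨⟨0, hm⟩, Or.inl rfl⟩, eq_pole_of_last_eq_one h]

variable {N : Type*} [TopologicalSpace N]

/-- A homotopy of boundary-constant maps of the cube descends to the sphere. -/
theorem homotopic_of_collapse (hm : 1 ≤ m) {f g : C(Sph m, N)} (H : C(I × (Fin m → I), N))
    (h0 : ∀ s, H (0, s) = f (collapse m s)) (h1 : ∀ s, H (1, s) = g (collapse m s))
    (hb : ∀ t, ∀ s ∈ Cube.boundary (Fin m), ∀ s' ∈ Cube.boundary (Fin m), H (t, s) = H (t, s')) :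
    f.Homotopic g := by
  set Q : C(I × (Fin m → I), I × Sph m) := (ContinuousMap.id I).prodMap (collapse m) with hQ
  have hsurj : Function.Surjective Q := by
    rintro ⟨t, w⟩
    obtain ⟨s, rfl⟩ := collapse_surjective hm w
    exact ⟨(t, s), rfl⟩
  -- A continuous surjection from a compact space to a Hausdorff space is a quotient map, also with
  -- the interval factor.
  have hq : IsQuotientMap Q := (Q.continuous.isClosedMap).isQuotientMap Q.continuous hsurj
  have hfac : Function.FactorsThrough H Q := by
    rintro ⟨t, s⟩ ⟨t', s'⟩ h
    have ht : t = t' := congrArg Prod.fst h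
    have hs : collapse m s = collapse m s' := congrArg Prod.snd h
    subst ht
    rcases collapse_eq_iff hs with rfl | ⟨hs, hs'⟩
    · rfl
    · exact hb t s hs s' hs'
  have hl : ∀ p, hq.lift H hfac (Q p) = H p := fun p =>
    DFunLike.congr_fun (hq.lift_comp H hfac) p
  refine ⟨⟨hq.lift H hfac, fun w => ?_, fun w => ?_⟩⟩
  · obtain ⟨s, rfl⟩ := collapse_surjective hm w
    exact (hl (0, s)).trans (h0 s)
  · obtain ⟨s, rfl⟩ := collapse_surjective hm w
    exact (hl (1, s)).trans (h1 s)

end Collapse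

end GapPotential

end

noncomputable section

namespace GapPotential

/-! ### Free homotopies, the action of loops, and doubles -/

section FreeHomotopy

variable {ι X : Type*} [Fintype ι] [TopologicalSpace X]

/-- Unlike in `continuous_radialInsert`, the inner end of β may depend on the parameter, as it does
when a free homotopy moves the base point. -/
theorem continuous_radialInsert_family {T : Type*} [TopologicalSpace T]
    {β : T → I → X} {γ : T → (ι → I) → X}
    (hβ : Continuous fun p : T × I => β p.1 p.2)
    (hγ : Continuous fun p : T × (ι → I) => γ p.1 p.2)
    (hβγ : ∀ t, ∀ s ∈ Cube.boundary ι, γ t s = β t 1) :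
    Continuous fun p : T × (ι → I) => radialInsert (β p.1) (γ p.1) p.2 := by
  unfold radialInsert
  have hr : Continuous fun p : T × (ι → I) => cubeRadius p.2 :=
    continuous_cubeRadius.comp continuous_snd
  refine Continuous.if_le ?_ ?_ hr continuous_const ?_
  · exact hγ.comp (continuous_fst.prodMk (continuous_pi fun i =>
      (continuous_projIcc (h := zero_le_one (α := ℝ))).comp (by fun_prop)))
  · exact hβ.comp (continuous_fst.prodMk
      ((continuous_projIcc (h := zero_le_one (α := ℝ))).comp (by fun_prop)))
  · rintro ⟨t, s⟩ h
    simp only at h ⊢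
    have h1 : projIcc (0 : ℝ) 1 zero_le_one (2 - 2 * cubeRadius s) = 1 := by
      rw [h]; exact projIcc_of_right_le _ (by norm_num)
    rw [h1]
    apply hβγ
    obtain ⟨i, hi⟩ := exists_of_cubeRadius_eq (by norm_num) h
    refine ⟨i, ?_⟩
    rcases (abs_eq (by norm_num)).1 hi with hi | hi
    · right
      exact projIcc_of_right_le _ (by linarith)
    · left
      exact projIcc_of_le_left _ (by linarith)

theorem radialInsert_const {x : X} (γ : Ω^ ι X x) (s : ι → I) :
    radialInsert (fun _ => x) γ s =
      γ (fun i => projIcc (0 : ℝ) 1 zero_le_one (2 * (s i : ℝ) - 1 / 2)) := by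
  unfold radialInsert
  split_ifs with h
  · rfl
  · symm
    apply γ.2
    have : ∃ i, 1 / 2 < |2 * (s i : ℝ) - 1| := by
      by_contra! hne
      exact h ((pi_norm_le_iff_of_nonneg (by norm_num)).2 hne)
    obtain ⟨i, hi⟩ := this
    refine ⟨i, ?_⟩
    rcases lt_abs.1 hi with hi | hi
    · right
      exact projIcc_of_right_le _ (by linarith)
    · left
      exact projIcc_of_le_left _ (by linarith)

/-- A free homotopy of generalized loops along a loop `β` expresses one of them as the result of
the action of `β` on the other. -/
theorem homotopic_actLoop_of_freeHomotopy {x : X} {γ γ' : Ω^ ι X x} (β : Path x x)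
    (H : C(I × (ι → I), X)) (h0 : ∀ s, H (0, s) = γ s) (h1 : ∀ s, H (1, s) = γ' s)
    (hb : ∀ t, ∀ s ∈ Cube.boundary ι, H (t, s) = β t) :
    GenLoop.Homotopic γ (actLoop β γ') := by
  -- At time t the collar carries the part of β on [0, t]: the outer boundary stays at x while the
  -- core H (t, ·) has boundary value β t.
  have hins : Continuous fun p : I × (ι → I) =>
      radialInsert (fun u => β (p.1 * u)) (fun s => H (p.1, s)) p.2 :=
    continuous_radialInsert_family (β := fun t u => β (t * u)) (γ := fun t s => H (t, s))
      (by fun_prop) (by fun_prop) (fun t s hs => by rw [hb t s hs, mul_one])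
  have hzero : ∀ s, radialInsert (fun u => β (0 * u)) (fun s => H (0, s)) s =
      radialInsert (fun _ => x) γ s := by
    intro s
    have e1 : (fun u => β (0 * u)) = fun _ => x := by
      funext u
      rw [zero_mul, β.source]
    rw [e1, funext h0]
  have hbd : ∀ t, ∀ s ∈ Cube.boundary ι,
      radialInsert (fun u => β (t * u)) (fun s => H (t, s)) s = x := by
    intro t s hs
    rw [radialInsert_of_mem_boundary _ _ hs, mul_zero, β.source]
  set γ₁ : Ω^ ι X x := ⟨⟨fun s => radialInsert (fun u => β (0 * u)) (fun s => H (0, s)) s,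
    hins.comp (f := fun s : ι → I => ((0 : I), s)) (by fun_prop)⟩, fun s hs => hbd 0 s hs⟩ with hγ₁
  -- With a constant collar, `γ₁` is γ after the clamped map s ↦ 2 s - 1 / 2. Interpolating that map
  -- with the identity preserves every face of the cube.
  have step1 : GenLoop.Homotopic γ γ₁ := by
    refine ⟨⟨⟨⟨fun p => γ (fun i => projIcc (0 : ℝ) 1 zero_le_one
      ((1 - (p.1 : ℝ)) * p.2 i + p.1 * projIcc (0 : ℝ) 1 zero_le_one (2 * (p.2 i : ℝ) - 1 / 2))),
      γ.1.continuous.comp (continuous_pi fun i => continuous_projIcc.comp ?_)⟩, ?_, ?_⟩, ?_⟩⟩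
    · have : Continuous fun p : I × (ι → I) =>
          projIcc (0 : ℝ) 1 zero_le_one (2 * (p.2 i : ℝ) - 1 / 2) :=
        continuous_projIcc.comp (by fun_prop)
      fun_prop
    · intro s
      refine congrArg γ (funext fun i => ?_)
      simp
    · intro s
      refine Eq.trans ?_ ((hzero s).trans (radialInsert_const γ s)).symm
      refine congrArg γ (funext fun i => ?_)
      simp
    · rintro t s ⟨i, hi⟩
      refine Eq.trans (γ.2 _ ⟨i, ?_⟩) (γ.2 s ⟨i, hi⟩).symm
      rcases hi with hi | hi
      · left
        refine projIcc_of_le_left _ ?_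
        have : (projIcc (0 : ℝ) 1 zero_le_one (2 * (s i : ℝ) - 1 / 2) : I) = 0 :=
          projIcc_of_le_left _ (by rw [hi]; norm_num)
        rw [this]
        change (1 - (t : ℝ)) * (s i : ℝ) + t * ((0 : I) : ℝ) ≤ 0
        rw [hi]
        simp
      · right
        refine projIcc_of_right_le _ ?_
        have : (projIcc (0 : ℝ) 1 zero_le_one (2 * (s i : ℝ) - 1 / 2) : I) = 1 :=
          projIcc_of_right_le _ (by rw [hi]; norm_num)
        rw [this]
        change 1 ≤ (1 - (t : ℝ)) * (s i : ℝ) + t * ((1 : I) : ℝ)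
        rw [hi]
        simp
  have step2 : GenLoop.Homotopic γ₁ (actLoop β γ') := by
    refine ⟨⟨⟨⟨fun p => radialInsert (fun u => β (p.1 * u)) (fun s => H (p.1, s)) p.2, hins⟩,
      fun s => rfl, fun s => ?_⟩, fun t s hs => (hbd t s hs).trans (hbd 0 s hs).symm⟩⟩
    change radialInsert (fun u => β (1 * u)) (fun s => H (1, s)) s = radialInsert β γ' s
    simp only [one_mul, funext h1]
  exact step1.trans step2

/-- The two ways around a square are homotopic. -/
theorem homotopic_trans_of_square {x : X} {p p' β : Path x x} (H : C(I × I, X))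
    (h0 : ∀ s, H (0, s) = p s) (h1 : ∀ s, H (1, s) = p' s) (hb0 : ∀ t, H (t, 0) = β t)
    (hb1 : ∀ t, H (t, 1) = β t) : (p.trans β).Homotopic (β.trans p') := by
  have hx : x = H (0, 0) := by rw [h0, p.source]
  have hx' : x = H (1, 1) := by rw [h1, p'.target]
  let a : Path ((0, 0) : I × I) (0, 1) := ⟨⟨fun s => (0, s), by fun_prop⟩, rfl, rfl⟩
  let b : Path ((0, 1) : I × I) (1, 1) := ⟨⟨fun s => (s, 1), by fun_prop⟩, rfl, rfl⟩
  let c : Path ((0, 0) : I × I) (1, 0) := ⟨⟨fun s => (s, 0), by fun_prop⟩, rfl, rfl⟩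
  let d : Path ((1, 0) : I × I) (1, 1) := ⟨⟨fun s => (1, s), by fun_prop⟩, rfl, rfl⟩
  have : ContractibleSpace I := (convex_Icc (0 : ℝ) 1).contractibleSpace ⟨0, by simp⟩
  have h := (SimplyConnectedSpace.paths_homotopic (a.trans b) (c.trans d)).map H
  have e1 : p.trans β = ((a.trans b).map H.continuous).cast hx hx' := by
    ext t
    simp only [Path.cast_coe, Path.map_coe, Function.comp_apply, Path.trans_apply]
    split_ifs
    · exact (h0 _).symm
    · exact (hb1 _).symm
  have e2 : β.trans p' = ((c.trans d).map H.continuous).cast hx hx' := by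
    ext t
    simp only [Path.cast_coe, Path.map_coe, Function.comp_apply, Path.trans_apply]
    split_ifs
    · exact (hb0 _).symm
    · exact (h1 _).symm
  rw [e1, e2]
  exact h.pathCast _ _

/-- If p₀ = B C and p₁ = A C share their second half, then d = A B⁻¹ and p₁ is homotopic to d p₀. -/
theorem path_double {a : X} {p₀ p₁ d : Path a a}
    (h : ∀ t : I, 1 / 2 ≤ (t : ℝ) → p₀ t = p₁ t)
    (hd₁ : ∀ t : I, (t : ℝ) ≤ 1 / 2 → d t = p₁ t)
    (hd₀ : ∀ t : I, 1 / 2 ≤ (t : ℝ) → d t = p₀ (σ t)) :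
    Path.Homotopic.Quotient.mk p₁ =
      (Path.Homotopic.Quotient.mk d).trans (Path.Homotopic.Quotient.mk p₀) := by
  let half : I := ⟨1 / 2, by norm_num, by norm_num⟩
  have hhalf : p₀ half = p₁ half := h half le_rfl
  let lo : I → I := fun t => ⟨t / 2, by constructor <;> linarith [t.2.1, t.2.2]⟩
  let hi : I → I := fun t => ⟨1 / 2 + t / 2, by constructor <;> linarith [t.2.1, t.2.2]⟩
  have hlo : Continuous lo := by fun_prop
  have hhi : Continuous hi := by fun_prop
  have lo0 : lo 0 = 0 := Subtype.ext (by simp [lo])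
  have lo1 : lo 1 = half := Subtype.ext (by simp [lo, half])
  have hi0 : hi 0 = half := Subtype.ext (by simp [hi, half])
  have hi1 : hi 1 = 1 := Subtype.ext (by simp [hi]; norm_num)
  let A : Path a (p₁ half) := ⟨⟨fun t => p₁ (lo t), by fun_prop⟩,
    by simp [lo0], by simp [lo1]⟩
  let B : Path a (p₁ half) := ⟨⟨fun t => p₀ (lo t), by fun_prop⟩,
    by simp [lo0], by simp [lo1, hhalf]⟩
  let C : Path (p₁ half) a := ⟨⟨fun t => p₁ (hi t), by fun_prop⟩,
    by simp [hi0], by simp [hi1]⟩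
  have e1 : p₁ = A.trans C := by
    ext t
    rw [Path.trans_apply]
    split_ifs with ht
    · exact congrArg p₁ (Subtype.ext (by simp [lo]))
    · exact congrArg p₁ (Subtype.ext (by simp [hi]; ring))
  have e0 : p₀ = B.trans C := by
    ext t
    rw [Path.trans_apply]
    split_ifs with ht
    · exact congrArg p₀ (Subtype.ext (by simp [lo]))
    · rw [h t (not_le.1 ht).le]
      exact congrArg p₁ (Subtype.ext (by simp [hi]; ring))
  have ed : d = A.trans B.symm := by
    ext t
    rw [Path.trans_apply]
    split_ifs with ht
    · rw [hd₁ t ht]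
      exact congrArg p₁ (Subtype.ext (by simp [lo]))
    · rw [hd₀ t (not_le.1 ht).le]
      exact congrArg p₀ (Subtype.ext (by simp [lo]; ring))
  rw [e1, e0, ed, Path.Homotopic.Quotient.mk_trans, Path.Homotopic.Quotient.mk_trans,
    Path.Homotopic.Quotient.mk_trans, Path.Homotopic.Quotient.mk_symm,
    Path.Homotopic.Quotient.trans_assoc, ← Path.Homotopic.Quotient.trans_assoc (.symm _),
    Path.Homotopic.Quotient.symm_trans, Path.Homotopic.Quotient.refl_trans]

/-- The class of a generalized loop. -/
def homotopyClass {m : ℕ} {x : X} (γ : Ω^ (Fin m) X x) : π_ m X x := Quotient.mk _ γ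

/-- If two generalized loops agree on a half of the cube, then the class of one of them depends
only on the classes of the other and of the double of the two other halves. -/
theorem exists_double_operation {m : ℕ} (i : Fin m) (x : X) :
    ∃ op : π_ m X x → π_ m X x → π_ m X x, ∀ F₀ F₁ D : Ω^ (Fin m) X x,
      (∀ s, 1 / 2 ≤ (s i : ℝ) → F₀ s = F₁ s) → (∀ s, (s i : ℝ) ≤ 1 / 2 → D s = F₁ s) →
      (∀ s, 1 / 2 ≤ (s i : ℝ) → D s = F₀ (Function.update s i (σ (s i)))) →
      homotopyClass F₁ = op (homotopyClass D) (homotopyClass F₀) := by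
  -- Currying the coordinate i turns generalized loops into loops in a loop space, where
  -- `path_double` applies.
  let e := homotopyGroupEquivFundamentalGroup (X := X) (x := x) i
  refine ⟨fun c c' => e.symm (Path.Homotopic.Quotient.trans (e c) (e c')),
    fun F₀ F₁ D h hd₁ hd₀ => ?_⟩
  refine ((Equiv.symm_apply_eq e).2 ?_).symm
  symm
  refine path_double (p₀ := GenLoop.toLoop i F₀) (p₁ := GenLoop.toLoop i F₁)
    (d := GenLoop.toLoop i D) ?_ ?_ ?_
  · intro t ht
    ext s
    exact h _ (by simpa using ht)
  · intro t ht
    ext s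
    exact hd₁ _ (by simpa using ht)
  · intro t ht
    ext s
    refine (hd₀ _ (by simpa using ht)).trans (congrArg F₀ ?_)
    funext j
    by_cases hj : j = i
    · subst hj
      simp
    · simp [hj]

end FreeHomotopy

/-! ### Based classes inside a free homotopy class -/

section SphereClasses

variable {m : ℕ} {N : Type*} [TopologicalSpace N]

/-- The generalized loop `γ` is the composition of `f` with the collapse of the cube. -/
def Represents {y : N} (γ : Ω^ (Fin m) N y) (f : C(Sph m, N)) : Prop :=
  ∀ s, γ s = f (collapse m s)

theorem exists_represents (f : C(Sph m, N)) {y : N} (h : f (pole m) = y) :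
    ∃ γ : Ω^ (Fin m) N y, Represents γ f :=
  ⟨⟨f.comp (collapse m), fun s hs => by
    rw [ContinuousMap.comp_apply, collapse_of_mem_boundary hs, h]⟩, fun _ => rfl⟩

theorem homotopic_of_represents (hm : 1 ≤ m) {y : N} {γ γ' : Ω^ (Fin m) N y} {f f' : C(Sph m, N)}
    (h : Represents γ f) (h' : Represents γ' f') (hγ : GenLoop.Homotopic γ γ') :
    f.Homotopic f' := by
  obtain ⟨H⟩ := hγ
  refine homotopic_of_collapse hm H.toContinuousMap (fun s => (H.apply_zero s).trans (h s))
    (fun s => (H.apply_one s).trans (h' s)) fun t s hs s' hs' => ?_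
  exact ((H.eq_fst t hs).trans (γ.2 s hs)).trans ((H.eq_fst t hs').trans (γ.2 s' hs')).symm

/-- The conditions on the homotopy groups of `N`. -/
def FiniteOrbits (m : ℕ) (N : Type*) [TopologicalSpace N] : Prop :=
  (m = 1 ∧ ∀ (x : N) (γ : FundamentalGroup N x), (conjugatesOf γ).Finite) ∨
    (2 ≤ m ∧ ∀ (x : N) (γ : π_ m N x), (orbit γ).Finite)

/-- The classes in `π_m(N, y)` that are represented by maps of a free homotopy class. -/
def classesAt (g : C(Sph m, N)) (y : N) : Set (π_ m N y) :=
  {c | ∃ (f : C(Sph m, N)) (γ : Ω^ (Fin m) N y), f.Homotopic g ∧ Represents γ f ∧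
    homotopyClass γ = c}

/-- A free homotopy between two maps with value y at the pole moves that value along a loop at y. So
all these based classes lie in the orbit, or for m = 1 the conjugacy class, of a single one. -/
theorem finite_classesAt (hN : FiniteOrbits m N) (g : C(Sph m, N)) (y : N) :
    (classesAt g y).Finite := by
  rcases (classesAt g y).eq_empty_or_nonempty with h | ⟨c', f', γ', hf', hγ', rfl⟩
  · rw [h]
    exact Set.finite_empty
  have key : ∀ c ∈ classesAt g y, ∃ (γ : Ω^ (Fin m) N y) (β : Path y y)
      (H : C(I × (Fin m → I), N)), homotopyClass γ = c ∧ (∀ s, H (0, s) = γ s) ∧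
      (∀ s, H (1, s) = γ' s) ∧
      ∀ t, ∀ s ∈ Cube.boundary (Fin m), H (t, s) = β t := by
    rintro c ⟨f, γ, hf, hγ, rfl⟩
    obtain ⟨K⟩ := hf.trans hf'.symm
    by_cases hb : (Cube.boundary (Fin m)).Nonempty
    · obtain ⟨s₀, hs₀⟩ := hb
      refine ⟨γ, ⟨⟨fun t => K (t, pole m), by fun_prop⟩, ?_, ?_⟩,
        K.toContinuousMap.comp ((ContinuousMap.id I).prodMap (collapse m)), rfl,
        fun s => (K.apply_zero _).trans (hγ s).symm, fun s => (K.apply_one _).trans (hγ' s).symm,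
        fun t s hs => ?_⟩
      · exact (K.apply_zero _).trans (by
          rw [← collapse_of_mem_boundary hs₀, ← hγ s₀]; exact γ.2 s₀ hs₀)
      · exact (K.apply_one _).trans (by
          rw [← collapse_of_mem_boundary hs₀, ← hγ' s₀]; exact γ'.2 s₀ hs₀)
      · exact congrArg (fun w => K (t, w)) (collapse_of_mem_boundary hs)
    · exact ⟨γ, Path.refl y, K.toContinuousMap.comp
        ((ContinuousMap.id I).prodMap (collapse m)), rfl,
        fun s => (K.apply_zero _).trans (hγ s).symm, fun s => (K.apply_one _).trans (hγ' s).symm,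
        fun t s hs => absurd ⟨s, hs⟩ hb⟩
  rcases hN with ⟨rfl, hN⟩ | ⟨-, hN⟩
  · have hfin := (hN y (HomotopyGroup.pi1EquivFundamentalGroup (homotopyClass γ'))).preimage
      (HomotopyGroup.pi1EquivFundamentalGroup (X := N) (x := y)).injective.injOn
    refine hfin.subset fun c hc => ?_
    obtain ⟨γ, β, H, rfl, h0, h1, hb⟩ := key c hc
    -- For m = 1 the homotopy is a square with sides γ, β, γ', β, so γ β and β γ' are homotopic,
    -- which is conjugacy.
    have hsq := homotopic_trans_of_square (p := genLoopEquivOfUnique (Fin 1) γ)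
      (p' := genLoopEquivOfUnique (Fin 1) γ') (β := β)
      (H.comp ((ContinuousMap.id I).prodMap ⟨fun (t : I) (_ : Fin 1) => t, by fun_prop⟩))
      (fun s => h0 _) (fun s => h1 _) (fun t => hb t _ ⟨0, Or.inl rfl⟩)
      (fun t => hb t _ ⟨0, Or.inr rfl⟩)
    have hq := Path.Homotopic.Quotient.eq.2 hsq
    rw [Path.Homotopic.Quotient.mk_trans, Path.Homotopic.Quotient.mk_trans] at hq
    let b : FundamentalGroup N y := Path.Homotopic.Quotient.mk β
    refine IsConj.symm (isConj_iff.2 ⟨b, ?_⟩)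
    rw [mul_inv_eq_iff_eq_mul]
    exact hq
  · refine (hN y (homotopyClass γ')).subset fun c hc => ?_
    obtain ⟨γ, β, H, rfl, h0, h1, hb⟩ := key c hc
    exact ⟨Path.Homotopic.Quotient.mk β,
      (Quotient.sound (homotopic_actLoop_of_freeHomotopy β H h0 h1 hb)).symm⟩

end SphereClasses

end GapPotential

end

noncomputable section

namespace GapPotential

/-! ### Finiteness passes through doubles -/

section Doubling

variable {m : ℕ}

/-- The reflection of the sphere in the hyperplane orthogonal to a unit vector. -/
def sphereReflection : C(Sph m × Sph m, Sph m) where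
  toFun p := ⟨(p.2 : EuclideanSpace ℝ (Fin (m + 1))) -
      (2 * inner ℝ (p.1 : EuclideanSpace ℝ (Fin (m + 1))) p.2) •
        (p.1 : EuclideanSpace ℝ (Fin (m + 1))), by
    rw [mem_sphere_zero_iff_norm, ← sq_eq_sq₀ (norm_nonneg _) zero_le_one, norm_sub_sq_real,
      norm_smul, real_inner_smul_right, real_inner_comm, norm_eq_of_mem_sphere,
      norm_eq_of_mem_sphere, Real.norm_eq_abs, mul_one, sq_abs]
    ring⟩
  continuous_toFun := by fun_prop

theorem coe_sphereReflection (v w : Sph m) :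
    (sphereReflection (v, w) : EuclideanSpace ℝ (Fin (m + 1))) =
      w - (2 * inner ℝ (v : EuclideanSpace ℝ (Fin (m + 1))) w) •
        (v : EuclideanSpace ℝ (Fin (m + 1))) := rfl

theorem inner_sphereReflection (v w : Sph m) :
    inner ℝ (v : EuclideanSpace ℝ (Fin (m + 1))) (sphereReflection (v, w)) =
      -(inner ℝ (v : EuclideanSpace ℝ (Fin (m + 1))) w : ℝ) := by
  rw [coe_sphereReflection, inner_sub_right, real_inner_smul_right, real_inner_self_eq_norm_sq,
    norm_eq_of_mem_sphere]
  ring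

theorem sphereReflection_sphereReflection (v w : Sph m) :
    sphereReflection (v, sphereReflection (v, w)) = w := by
  refine Subtype.ext ?_
  rw [coe_sphereReflection, inner_sphereReflection, coe_sphereReflection]
  module

theorem dist_sphereReflection (v w w' : Sph m) :
    dist (sphereReflection (v, w)) (sphereReflection (v, w')) = dist w w' := by
  rw [Subtype.dist_eq, Subtype.dist_eq, dist_eq_norm, dist_eq_norm, coe_sphereReflection,
    coe_sphereReflection]
  rw [← sq_eq_sq₀ (norm_nonneg _) (norm_nonneg _)]
  have : ((w : EuclideanSpace ℝ (Fin (m + 1))) -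
      (2 * inner ℝ (v : EuclideanSpace ℝ (Fin (m + 1))) w) • (v : EuclideanSpace ℝ (Fin (m + 1)))) -
      ((w' : EuclideanSpace ℝ (Fin (m + 1))) -
      (2 * inner ℝ (v : EuclideanSpace ℝ (Fin (m + 1))) w') •
        (v : EuclideanSpace ℝ (Fin (m + 1)))) =
      ((w : EuclideanSpace ℝ (Fin (m + 1))) - w') -
      (2 * inner ℝ (v : EuclideanSpace ℝ (Fin (m + 1)))
        ((w : EuclideanSpace ℝ (Fin (m + 1))) - w')) •
        (v : EuclideanSpace ℝ (Fin (m + 1))) := by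
    rw [inner_sub_right]
    module
  rw [this, norm_sub_sq_real, norm_smul, real_inner_smul_right, real_inner_comm,
    norm_eq_of_mem_sphere, Real.norm_eq_abs, mul_one, sq_abs]
  ring

/-- A point of the sphere orthogonal to the pole. -/
def axis (hm : 1 ≤ m) : Sph m :=
  ⟨-EuclideanSpace.single (Fin.castSucc (⟨0, hm⟩ : Fin m)) 1, by simp⟩

theorem inner_axis (hm : 1 ≤ m) (w : Sph m) :
    inner ℝ (axis hm : EuclideanSpace ℝ (Fin (m + 1))) w =
      -(w : EuclideanSpace ℝ (Fin (m + 1))) (Fin.castSucc (⟨0, hm⟩ : Fin m)) := by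
  simp [axis, inner_neg_left, EuclideanSpace.inner_single_left]

theorem inner_axis_pole (hm : 1 ≤ m) :
    inner ℝ (axis hm : EuclideanSpace ℝ (Fin (m + 1))) (pole m) = 0 := by
  rw [inner_axis]
  simp [pole]
  omega

/-- The minus sign in `axis` is there so that the first half of the cube covers the positive
hemisphere, as `exists_double_operation` requires. -/
theorem inner_axis_collapse_nonneg (hm : 1 ≤ m) {s : Fin m → I}
    (hs : (s ⟨0, hm⟩ : ℝ) ≤ 1 / 2) :
    0 ≤ inner ℝ (axis hm : EuclideanSpace ℝ (Fin (m + 1))) (collapse m s) := by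
  rw [inner_axis, collapse_apply_castSucc, neg_nonneg]
  have h1 : centered s ⟨0, hm⟩ ≤ 0 := by
    unfold centered
    linarith
  have h2 := sub_nonneg.2 (cubeRadius_le_one s)
  exact div_nonpos_of_nonpos_of_nonneg (mul_nonpos_of_nonneg_of_nonpos (by positivity) h1)
    (collapseDen_pos s).le

theorem inner_axis_collapse_nonpos (hm : 1 ≤ m) {s : Fin m → I}
    (hs : 1 / 2 ≤ (s ⟨0, hm⟩ : ℝ)) :
    inner ℝ (axis hm : EuclideanSpace ℝ (Fin (m + 1))) (collapse m s) ≤ 0 := by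
  rw [inner_axis, collapse_apply_castSucc, neg_nonpos]
  have h1 : 0 ≤ centered s ⟨0, hm⟩ := by
    unfold centered
    linarith
  have h2 := sub_nonneg.2 (cubeRadius_le_one s)
  have h3 := collapseDen_pos s
  positivity

theorem sphereReflection_axis_collapse (hm : 1 ≤ m) (s : Fin m → I) :
    sphereReflection (axis hm, collapse m s) =
      collapse m (Function.update s ⟨0, hm⟩ (σ (s ⟨0, hm⟩))) := by
  set i₀ : Fin m := ⟨0, hm⟩ with hi₀
  set s' := Function.update s i₀ (σ (s i₀)) with hs'
  have hc0 : centered s' i₀ = -centered s i₀ := by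
    simp only [centered, hs', Function.update_self, unitInterval.coe_symm_eq]
    ring
  have hc : ∀ i, i ≠ i₀ → centered s' i = centered s i := fun i hi => by
    simp only [centered, hs', Function.update_of_ne hi]
  have habs : ∀ i, |centered s' i| = |centered s i| := fun i => by
    by_cases hi : i = i₀
    · rw [hi, hc0, abs_neg]
    · rw [hc i hi]
  have hr : cubeRadius s' = cubeRadius s := by
    rw [cubeRadius_eq_norm_centered, cubeRadius_eq_norm_centered, Pi.norm_def, Pi.norm_def]
    congr 2
    funext i
    exact Subtype.ext (habs i)
  have hS : ∑ i, centered s' i ^ 2 = ∑ i, centered s i ^ 2 :=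
    Finset.sum_congr rfl fun i _ => by rw [← sq_abs, habs, sq_abs]
  have hd : collapseDen s' = collapseDen s := by rw [collapseDen, collapseDen, hr, hS]
  refine Subtype.ext (PiLp.ext fun j => ?_)
  rw [coe_sphereReflection, inner_axis, ← hi₀]
  simp only [axis, ← hi₀, PiLp.sub_apply, PiLp.smul_apply, PiLp.neg_apply, smul_eq_mul,
    PiLp.single_apply]
  refine Fin.lastCases ?_ (fun i => ?_) j
  · rw [collapse_apply_last, collapse_apply_last, hr, hS, hd, if_neg (Fin.castSucc_ne_last _).symm]
    simp
  · rw [collapse_apply_castSucc s' i, hr, hd]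
    by_cases hi : i = i₀
    · subst hi
      rw [hc0, if_pos rfl, collapse_apply_castSucc]
      ring
    · rw [hc i hi, if_neg (fun h => hi (Fin.castSucc_injective _ h)), collapse_apply_castSucc]
      simp

/-- The map `d` is the double of the restrictions of `f₁` and `f₀` to a hemisphere outside of which
`f₀` and `f₁` agree. -/
structure IsDouble {N : Type*} [TopologicalSpace N] (hm : 1 ≤ m) (f₀ f₁ d : C(Sph m, N)) :
    Prop where
  agree : ∀ w : Sph m, inner ℝ (axis hm : EuclideanSpace ℝ (Fin (m + 1))) w ≤ 0 → f₀ w = f₁ w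
  pos : ∀ w : Sph m, 0 ≤ inner ℝ (axis hm : EuclideanSpace ℝ (Fin (m + 1))) w → d w = f₁ w
  neg : ∀ w : Sph m, inner ℝ (axis hm : EuclideanSpace ℝ (Fin (m + 1))) w ≤ 0 →
    d w = f₀ (sphereReflection (axis hm, w))

variable {N : Type*} [TopologicalSpace N]

/-- The pole lies on the mirror, so f₀, f₁ and d share the base point y. The based classes of f₀ and
d range over finite sets, and `op` of them is the class of f₁. -/
theorem exists_finite_of_isDouble_at (hm : 1 ≤ m) (hN : FiniteOrbits m N) {G D : Set C(Sph m, N)}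
    (hG : G.Finite) (hD : D.Finite) (y : N) :
    ∃ G' : Set C(Sph m, N), G'.Finite ∧ ∀ f₀ f₁ d : C(Sph m, N), IsDouble hm f₀ f₁ d →
      f₀ (pole m) = y → (∃ g ∈ G, f₀.Homotopic g) → (∃ g ∈ D, d.Homotopic g) →
      ∃ g ∈ G', f₁.Homotopic g := by
  obtain ⟨op, hop⟩ := exists_double_operation (⟨0, hm⟩ : Fin m) y
  set T : Set (π_ m N y) := image2 op (⋃ g ∈ D, classesAt g y) (⋃ g ∈ G, classesAt g y) with hT
  have hTf : T.Finite := (hD.biUnion fun g _ => finite_classesAt hN g y).image2 _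
    (hG.biUnion fun g _ => finite_classesAt hN g y)
  have := hTf.to_subtype
  obtain ⟨A, -, hA, hrep⟩ := exists_finite_representatives
    (α := {p : C(Sph m, N) × Ω^ (Fin m) N y // Represents p.2 p.1 ∧ homotopyClass p.2 ∈ T})
    univ (fun p => (⟨homotopyClass p.1.2, p.2.2⟩ : T))
  refine ⟨(fun p => p.1.1) '' A, hA.image _, fun f₀ f₁ d hd hy hf₀ hdD => ?_⟩
  have hp := (inner_axis_pole hm)
  have hy1 : f₁ (pole m) = y := by rw [← hd.agree _ hp.le, hy]
  have hyd : d (pole m) = y := by rw [hd.pos _ hp.ge, hy1]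
  obtain ⟨γ₀, hγ₀⟩ := exists_represents f₀ hy
  obtain ⟨γ₁, hγ₁⟩ := exists_represents f₁ hy1
  obtain ⟨γ, hγ⟩ := exists_represents d hyd
  have hcls := hop γ₀ γ₁ γ
    (fun s hs => by
      rw [hγ₀, hγ₁]
      exact hd.agree _ (inner_axis_collapse_nonpos hm hs))
    (fun s hs => by
      rw [hγ, hγ₁]
      exact hd.pos _ (inner_axis_collapse_nonneg hm hs))
    (fun s hs => by
      rw [hγ, hγ₀, hd.neg _ (inner_axis_collapse_nonpos hm hs), sphereReflection_axis_collapse])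
  have hmem : homotopyClass γ₁ ∈ T := by
    obtain ⟨g, hg, hfg⟩ := hf₀
    obtain ⟨g', hg', hdg⟩ := hdD
    rw [hcls]
    exact mem_image2_of_mem (mem_biUnion hg' ⟨d, γ, hdg, hγ, rfl⟩)
      (mem_biUnion hg ⟨f₀, γ₀, hfg, hγ₀, rfl⟩)
  obtain ⟨⟨⟨g, γ'⟩, hg1, hg2⟩, hgA, hgc⟩ := hrep ⟨(f₁, γ₁), hγ₁, hmem⟩ (mem_univ _)
  exact ⟨g, ⟨_, hgA, rfl⟩, homotopic_of_represents hm hγ₁ hg1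
    (Quotient.exact (congrArg Subtype.val hgc))⟩

variable {E : Type*} [NormedAddCommGroup E] [NormedSpace ℝ E]

/-- The self-map of `N` given by a translation in the ambient space. -/
def RetractionData.shift (R : RetractionData N E) {v : E} (hv : ‖v‖ ≤ R.η) : C(N, N) where
  toFun z := R.ret (R.emb z + v)
  continuous_toFun := R.continuous_ret_comp (by fun_prop) fun z =>
    R.mem_tube_of_dist_le (y := z) (by simpa using hv)

theorem RetractionData.homotopic_shift (R : RetractionData N E) {v : E} (hv : ‖v‖ ≤ R.η) :
    (ContinuousMap.id N).Homotopic (R.shift hv) :=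
  R.homotopic_of_dist_le (u := fun z => R.emb z + v) (by fun_prop) (fun _ => rfl)
    fun z => by simpa using hv

/-- Finitely many base points suffice: `shift` carries the value at the pole exactly to a nearby y.
It is homotopic to the identity, and composing with it on the left preserves doubles. -/
theorem exists_finite_of_isDouble [CompactSpace N] (R : RetractionData N E) (hm : 1 ≤ m)
    (hN : FiniteOrbits m N) {G D : Set C(Sph m, N)} (hG : G.Finite) (hD : D.Finite) :
    ∃ G' : Set C(Sph m, N), G'.Finite ∧ ∀ f₀ f₁ d : C(Sph m, N), IsDouble hm f₀ f₁ d →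
      (∃ g ∈ G, f₀.Homotopic g) → (∃ g ∈ D, d.Homotopic g) → ∃ g ∈ G', f₁.Homotopic g := by
  choose G' hG' hG'h using fun y => exists_finite_of_isDouble_at hm hN hG hD y
  obtain ⟨t, ht⟩ := (isCompact_univ (X := N)).elim_finite_subcover
    (fun y : N => {z | dist (R.emb z) (R.emb y) < R.η})
    (fun y => isOpen_lt (by fun_prop) continuous_const)
    (fun z _ => mem_iUnion.2 ⟨z, by simpa using R.η_pos⟩)
  refine ⟨⋃ y ∈ t, G' y, t.finite_toSet.biUnion fun y _ => hG' y,
    fun f₀ f₁ d hd hf₀ hdD => ?_⟩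
  obtain ⟨y, hy, hdy⟩ := mem_iUnion₂.1 (ht (mem_univ (f₀ (pole m))))
  have hv : ‖R.emb y - R.emb (f₀ (pole m))‖ ≤ R.η := by
    rw [← dist_eq_norm, dist_comm]
    exact le_of_lt hdy
  have hsh : ∀ f : C(Sph m, N), ((R.shift hv).comp f).Homotopic f := fun f =>
    ((R.homotopic_shift hv).symm.comp (ContinuousMap.Homotopic.refl f))
  obtain ⟨g, hg, hfg⟩ := hG'h y ((R.shift hv).comp f₀) ((R.shift hv).comp f₁)
    ((R.shift hv).comp d)
    ⟨fun w hw => congrArg (R.shift hv) (hd.agree w hw),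
      fun w hw => congrArg (R.shift hv) (hd.pos w hw),
      fun w hw => congrArg (R.shift hv) (hd.neg w hw)⟩
    (by simp [RetractionData.shift, R.ret_emb])
    (hf₀.imp fun g hg => ⟨hg.1, (hsh _).trans hg.2⟩)
    (hdD.imp fun g hg => ⟨hg.1, (hsh _).trans hg.2⟩)
  exact ⟨g, mem_biUnion hy hg, (hsh f₁).symm.trans hfg⟩

end Doubling

end GapPotential

end

noncomputable section

namespace GapPotential

/-! ### Conformal maps of the sphere onto small caps -/

section Moebius

variable {m : ℕ}

/-- The denominator of the conformal dilation. -/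
def dilationDen (c μ : ℝ) : ℝ := (1 + c) + μ ^ 2 * (1 - c)

/-- The coefficient of the axis in the numerator of the conformal dilation. -/
def dilationNum (c μ : ℝ) : ℝ := (1 + c) - μ ^ 2 * (1 - c) - 2 * μ * c

theorem abs_inner_sphere_le_one (u w : Sph m) :
    |inner ℝ (u : EuclideanSpace ℝ (Fin (m + 1))) w| ≤ 1 := by
  have := abs_real_inner_le_norm (u : EuclideanSpace ℝ (Fin (m + 1))) w
  rwa [norm_eq_of_mem_sphere, norm_eq_of_mem_sphere, one_mul] at this

theorem dilationDen_pos {c μ : ℝ} (hc : |c| ≤ 1) (hμ : 0 < μ) : 0 < dilationDen c μ := by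
  rw [abs_le] at hc
  unfold dilationDen
  have h1 : 0 < μ ^ 2 := by positivity
  rcases hc.1.lt_or_eq with h | h
  · nlinarith [mul_nonneg h1.le (sub_nonneg.2 hc.2)]
  · rw [← h]
    linarith

/-- The dilation is multiplication by μ in the stereographic coordinate from -u. This identity shows
both that the image lies on the sphere (w = w') and how distances change. -/
theorem inner_dilation (u w w' : Sph m) (μ : ℝ) :
    let c : ℝ := inner ℝ (u : EuclideanSpace ℝ (Fin (m + 1))) w
    let c' : ℝ := inner ℝ (u : EuclideanSpace ℝ (Fin (m + 1))) w'
    inner ℝ ((2 * μ) • (w : EuclideanSpace ℝ (Fin (m + 1))) +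
        dilationNum c μ • (u : EuclideanSpace ℝ (Fin (m + 1))))
      ((2 * μ) • (w' : EuclideanSpace ℝ (Fin (m + 1))) +
        dilationNum c' μ • (u : EuclideanSpace ℝ (Fin (m + 1)))) =
      dilationDen c μ * dilationDen c' μ -
        4 * μ ^ 2 * (1 - inner ℝ (w : EuclideanSpace ℝ (Fin (m + 1))) w') := by
  intro c c'
  simp only [inner_add_left, inner_add_right, real_inner_smul_left, real_inner_smul_right,
    real_inner_self_eq_norm_sq, norm_eq_of_mem_sphere]
  rw [real_inner_comm (u : EuclideanSpace ℝ (Fin (m + 1))) w]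
  change 2 * μ * (2 * μ * _) + 2 * μ * (dilationNum c μ * c') +
    (dilationNum c' μ * (2 * μ * c) + dilationNum c' μ * (dilationNum c μ * 1 ^ 2)) = _
  unfold dilationNum dilationDen
  ring

/-- The conformal dilation of the sphere by the factor `μ` with fixed points `u` and `-u`. -/
def dilation (u : Sph m) : C(Ioi (0 : ℝ) × Sph m, Sph m) where
  toFun p := ⟨(dilationDen (inner ℝ (u : EuclideanSpace ℝ (Fin (m + 1))) p.2) p.1)⁻¹ •
      ((2 * (p.1 : ℝ)) • (p.2 : EuclideanSpace ℝ (Fin (m + 1))) +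
        dilationNum (inner ℝ (u : EuclideanSpace ℝ (Fin (m + 1))) p.2) p.1 •
          (u : EuclideanSpace ℝ (Fin (m + 1)))), by
    have hd := dilationDen_pos (abs_inner_sphere_le_one u p.2) p.1.2
    rw [mem_sphere_zero_iff_norm, norm_smul, norm_inv, Real.norm_eq_abs, abs_of_pos hd,
      inv_mul_eq_one₀ hd.ne', ← sq_eq_sq₀ hd.le (norm_nonneg _), ← real_inner_self_eq_norm_sq,
      inner_dilation, real_inner_self_eq_norm_sq, norm_eq_of_mem_sphere]
    ring⟩
  continuous_toFun := by
    have h1 : Continuous fun p : Ioi (0 : ℝ) × Sph m =>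
        dilationDen (inner ℝ (u : EuclideanSpace ℝ (Fin (m + 1))) p.2) p.1 := by
      unfold dilationDen
      fun_prop
    have h2 : Continuous fun p : Ioi (0 : ℝ) × Sph m =>
        dilationNum (inner ℝ (u : EuclideanSpace ℝ (Fin (m + 1))) p.2) p.1 := by
      unfold dilationNum
      fun_prop
    have h3 := h1.inv₀ fun p => (dilationDen_pos (abs_inner_sphere_le_one u p.2) p.1.2).ne'
    exact Continuous.subtype_mk (h3.smul (by fun_prop)) _

theorem coe_dilation (u w : Sph m) (μ : Ioi (0 : ℝ)) :
    (dilation u (μ, w) : EuclideanSpace ℝ (Fin (m + 1))) =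
      (dilationDen (inner ℝ (u : EuclideanSpace ℝ (Fin (m + 1))) w) μ)⁻¹ •
      ((2 * (μ : ℝ)) • (w : EuclideanSpace ℝ (Fin (m + 1))) +
        dilationNum (inner ℝ (u : EuclideanSpace ℝ (Fin (m + 1))) w) μ •
          (u : EuclideanSpace ℝ (Fin (m + 1)))) := rfl

theorem inner_axis_dilation (u w : Sph m) (μ : Ioi (0 : ℝ)) :
    inner ℝ (u : EuclideanSpace ℝ (Fin (m + 1))) (dilation u (μ, w)) =
      ((1 + inner ℝ (u : EuclideanSpace ℝ (Fin (m + 1))) w) -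
        (μ : ℝ) ^ 2 * (1 - inner ℝ (u : EuclideanSpace ℝ (Fin (m + 1))) w)) /
      dilationDen (inner ℝ (u : EuclideanSpace ℝ (Fin (m + 1))) w) μ := by
  rw [coe_dilation, real_inner_smul_right, inner_add_right, real_inner_smul_right,
    real_inner_smul_right, real_inner_self_eq_norm_sq, norm_eq_of_mem_sphere]
  unfold dilationNum
  ring

theorem dist_sq_sphere (w w' : Sph m) :
    dist w w' ^ 2 = 2 * (1 - inner ℝ (w : EuclideanSpace ℝ (Fin (m + 1))) w') := by
  rw [Subtype.dist_eq, dist_eq_norm, norm_sub_sq_real, norm_eq_of_mem_sphere,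
    norm_eq_of_mem_sphere]
  ring

theorem dist_sq_dilation (u w w' : Sph m) (μ : Ioi (0 : ℝ)) :
    dist (dilation u (μ, w)) (dilation u (μ, w')) ^ 2 = 4 * (μ : ℝ) ^ 2 * dist w w' ^ 2 /
      (dilationDen (inner ℝ (u : EuclideanSpace ℝ (Fin (m + 1))) w) μ *
        dilationDen (inner ℝ (u : EuclideanSpace ℝ (Fin (m + 1))) w') μ) := by
  have hd := dilationDen_pos (abs_inner_sphere_le_one u w) μ.2
  have hd' := dilationDen_pos (abs_inner_sphere_le_one u w') μ.2
  rw [dist_sq_sphere, dist_sq_sphere, coe_dilation, coe_dilation, real_inner_smul_left,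
    real_inner_smul_right, inner_dilation]
  field_simp
  ring

theorem dist_dilation_le (u w w' : Sph m) (μ : Ioi (0 : ℝ))
    (hw : 0 ≤ inner ℝ (u : EuclideanSpace ℝ (Fin (m + 1))) w)
    (hw' : 0 ≤ inner ℝ (u : EuclideanSpace ℝ (Fin (m + 1))) w') :
    dist (dilation u (μ, w)) (dilation u (μ, w')) ≤ 2 * μ * dist w w' := by
  have hμ : (0 : ℝ) < μ := μ.2
  have h1 : ∀ w : Sph m, 0 ≤ inner ℝ (u : EuclideanSpace ℝ (Fin (m + 1))) w →
      1 ≤ dilationDen (inner ℝ (u : EuclideanSpace ℝ (Fin (m + 1))) w) μ := by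
    intro w hw
    have h2 := abs_le.1 (abs_inner_sphere_le_one u w)
    have h3 : 0 ≤ (μ : ℝ) ^ 2 * (1 - inner ℝ (u : EuclideanSpace ℝ (Fin (m + 1))) w) :=
      mul_nonneg (by positivity) (by linarith)
    unfold dilationDen
    linarith
  refine le_of_sq_le_sq ?_ (by positivity)
  rw [dist_sq_dilation]
  have h4 := one_le_mul_of_one_le_of_one_le (h1 w hw) (h1 w' hw')
  refine (div_le_self (by positivity) h4).trans (le_of_eq (by ring))

theorem dist_sq_dilation_axis (u w : Sph m) (μ : Ioi (0 : ℝ)) :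
    dist (dilation u (μ, w)) u ^ 2 =
      4 * (μ : ℝ) ^ 2 * (1 - inner ℝ (u : EuclideanSpace ℝ (Fin (m + 1))) w) /
        dilationDen (inner ℝ (u : EuclideanSpace ℝ (Fin (m + 1))) w) μ := by
  have hd := dilationDen_pos (abs_inner_sphere_le_one u w) μ.2
  rw [dist_sq_sphere, real_inner_comm, inner_axis_dilation, eq_div_iff hd.ne', mul_assoc, sub_mul,
    div_mul_cancel₀ _ hd.ne']
  unfold dilationDen
  ring

/-- This bound forces the cutoff of `upperScale` to vanish linearly at the equator, which makes the
glued scale function in `exists_double` Lipschitz. -/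
theorem le_dist_dilation_of_nonneg (u w : Sph m) (μ : Ioi (0 : ℝ)) (hμ1 : (μ : ℝ) ≤ 1)
    (hw : 0 ≤ inner ℝ (u : EuclideanSpace ℝ (Fin (m + 1))) w) :
    μ * (1 - inner ℝ (u : EuclideanSpace ℝ (Fin (m + 1))) w) ≤ dist (dilation u (μ, w)) u := by
  have hμ : (0 : ℝ) < μ := μ.2
  refine le_of_sq_le_sq ?_ dist_nonneg
  have hd := dilationDen_pos (abs_inner_sphere_le_one u w) μ.2
  have hle := abs_le.1 (abs_inner_sphere_le_one u w)
  rw [dist_sq_dilation_axis, le_div_iff₀ hd]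
  set c : ℝ := inner ℝ (u : EuclideanSpace ℝ (Fin (m + 1))) w
  have h1 : (μ : ℝ) ^ 2 ≤ 1 := by nlinarith
  have h0 : 0 ≤ 1 - c := by linarith
  have h2 : dilationDen c μ ≤ 2 := by
    unfold dilationDen
    nlinarith
  have h3 : (1 - c) * dilationDen c μ ≤ 1 * 2 := mul_le_mul (by linarith) h2 hd.le one_pos.le
  calc (μ * (1 - c)) ^ 2 * dilationDen c μ
      = (μ : ℝ) ^ 2 * (1 - c) * ((1 - c) * dilationDen c μ) := by ring
    _ ≤ (μ : ℝ) ^ 2 * (1 - c) * (1 * 2) := by gcongr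
    _ ≤ 4 * (μ : ℝ) ^ 2 * (1 - c) := by
      have : 0 ≤ (μ : ℝ) ^ 2 * (1 - c) := by positivity
      linarith

theorem dist_dilation_axis_le (u w : Sph m) (μ : Ioi (0 : ℝ))
    (hw : 0 ≤ inner ℝ (u : EuclideanSpace ℝ (Fin (m + 1))) w) :
    dist (dilation u (μ, w)) u ≤ 2 * μ := by
  have hμ : (0 : ℝ) < μ := μ.2
  refine le_of_sq_le_sq ?_ (by positivity)
  have hd := dilationDen_pos (abs_inner_sphere_le_one u w) μ.2
  have hle := abs_le.1 (abs_inner_sphere_le_one u w)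
  rw [dist_sq_dilation_axis, div_le_iff₀ hd]
  set c : ℝ := inner ℝ (u : EuclideanSpace ℝ (Fin (m + 1))) w
  have h0 : 0 ≤ (μ : ℝ) ^ 2 * (1 - c) := mul_nonneg (by positivity) (by linarith)
  have h2 : 1 - c ≤ dilationDen c μ := by
    unfold dilationDen
    linarith
  calc 4 * (μ : ℝ) ^ 2 * (1 - c) ≤ 4 * (μ : ℝ) ^ 2 * dilationDen c μ := by gcongr
    _ = _ := by ring

theorem le_dist_dilation (u w : Sph m) (μ : Ioi (0 : ℝ)) (hμ1 : (μ : ℝ) ≤ 1)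
    (hw : inner ℝ (u : EuclideanSpace ℝ (Fin (m + 1))) w ≤ 0) :
    μ ≤ dist (dilation u (μ, w)) u := by
  have hμ : (0 : ℝ) < μ := μ.2
  refine le_of_sq_le_sq ?_ dist_nonneg
  have hd := dilationDen_pos (abs_inner_sphere_le_one u w) μ.2
  have hle := abs_le.1 (abs_inner_sphere_le_one u w)
  rw [dist_sq_dilation_axis, le_div_iff₀ hd]
  set c : ℝ := inner ℝ (u : EuclideanSpace ℝ (Fin (m + 1))) w
  have h1 : (μ : ℝ) ^ 2 ≤ 1 := by nlinarith
  have h2 : dilationDen c μ ≤ 4 * (1 - c) := by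
    unfold dilationDen
    nlinarith
  calc (μ : ℝ) ^ 2 * dilationDen c μ ≤ (μ : ℝ) ^ 2 * (4 * (1 - c)) := by gcongr
    _ = _ := by ring

theorem dilation_dilation (u w : Sph m) (μ ν : Ioi (0 : ℝ)) (h : (μ : ℝ) * ν = 1) :
    dilation u (μ, dilation u (ν, w)) = w := by
  have hμ : (0 : ℝ) < μ := μ.2
  have hν : (0 : ℝ) < ν := ν.2
  have hμν : (μ : ℝ) = (ν : ℝ)⁻¹ := eq_inv_of_mul_eq_one_left h
  have hd := dilationDen_pos (abs_inner_sphere_le_one u w) ν.2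
  refine Subtype.ext ?_
  rw [coe_dilation u (dilation u (ν, w)), inner_axis_dilation, coe_dilation, hμν]
  set c : ℝ := inner ℝ (u : EuclideanSpace ℝ (Fin (m + 1))) w
  set b := dilationDen c ν with hb
  set c' := ((1 + c) - (ν : ℝ) ^ 2 * (1 - c)) / b with hc'
  have hcb : c' * b = (1 + c) - (ν : ℝ) ^ 2 * (1 - c) := div_mul_cancel₀ _ hd.ne'
  have hb' : b = (1 + c) + (ν : ℝ) ^ 2 * (1 - c) := rfl
  have hD : dilationDen c' (ν : ℝ)⁻¹ = 4 / b := by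
    rw [eq_div_iff hd.ne']
    unfold dilationDen
    have : ((1 + c') + (ν : ℝ)⁻¹ ^ 2 * (1 - c')) * b =
        (b + c' * b) + (ν : ℝ)⁻¹ ^ 2 * (b - c' * b) := by ring
    rw [this, hcb, hb']
    field_simp
    ring
  have hA : 2 * (ν : ℝ)⁻¹ * (b⁻¹ * dilationNum c ν) + dilationNum c' (ν : ℝ)⁻¹ = 0 := by
    have : (2 * (ν : ℝ)⁻¹ * (b⁻¹ * dilationNum c ν) + dilationNum c' (ν : ℝ)⁻¹) * b = 0 := by
      have e : (2 * (ν : ℝ)⁻¹ * (b⁻¹ * dilationNum c ν) + dilationNum c' (ν : ℝ)⁻¹) * b =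
          2 * (ν : ℝ)⁻¹ * dilationNum c ν * (b⁻¹ * b) + ((b + c' * b) -
            (ν : ℝ)⁻¹ ^ 2 * (b - c' * b) - 2 * (ν : ℝ)⁻¹ * (c' * b)) := by
        unfold dilationNum
        ring
      rw [e, hcb, inv_mul_cancel₀ hd.ne', hb']
      unfold dilationNum
      field_simp
      ring
    exact (mul_eq_zero.1 this).resolve_right hd.ne'
  rw [hD, smul_smul (2 * (ν : ℝ)⁻¹), smul_add (2 * (ν : ℝ)⁻¹ * b⁻¹), smul_smul, smul_smul,
    add_assoc, ← add_smul]
  rw [show 2 * (ν : ℝ)⁻¹ * b⁻¹ * dilationNum c ν + dilationNum c' (ν : ℝ)⁻¹ = 0 by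
    linear_combination hA, zero_smul, add_zero, smul_smul]
  have : (4 / b)⁻¹ * (2 * (ν : ℝ)⁻¹ * b⁻¹ * (2 * ν)) = 1 := by
    field_simp
    ring
  rw [this, one_smul]

/-- Reflect along axis - x; if this vanishes, reflect along the pole, which is orthogonal to the
axis. -/
theorem exists_sphereReflection_eq (hm : 1 ≤ m) (x : Sph m) :
    ∃ v : Sph m, sphereReflection (v, axis hm) = x := by
  by_cases hx : axis hm = x
  · refine ⟨pole m, Subtype.ext ?_⟩
    rw [coe_sphereReflection, real_inner_comm, inner_axis_pole, mul_zero, zero_smul, sub_zero, hx]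
  · set z : EuclideanSpace ℝ (Fin (m + 1)) := (axis hm : EuclideanSpace ℝ (Fin (m + 1))) - x with hz
    have hz0 : 0 < ‖z‖ := norm_pos_iff.2 (sub_ne_zero.2 fun h => hx (Subtype.ext h))
    have hzz : ‖z‖ ^ 2 = 2 * inner ℝ z (axis hm : EuclideanSpace ℝ (Fin (m + 1))) := by
      rw [hz, inner_sub_left, norm_sub_sq_real, real_inner_self_eq_norm_sq,
        norm_eq_of_mem_sphere, norm_eq_of_mem_sphere, real_inner_comm]
      ring
    refine ⟨⟨‖z‖⁻¹ • z, by simp [norm_smul, hz0.ne']⟩, Subtype.ext ?_⟩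
    rw [coe_sphereReflection]
    simp only [real_inner_smul_left, smul_smul]
    have : 2 * (‖z‖⁻¹ * inner ℝ z (axis hm : EuclideanSpace ℝ (Fin (m + 1)))) * ‖z‖⁻¹ = 1 := by
      have : inner ℝ z (axis hm : EuclideanSpace ℝ (Fin (m + 1))) = ‖z‖ ^ 2 / 2 := by linarith
      rw [this]
      field_simp
    rw [this, one_smul, hz, sub_sub_cancel]

theorem sphereReflection_homotopic (hm : 1 ≤ m) (v v' : Sph m) :
    (⟨fun w => sphereReflection (v, w), by fun_prop⟩ : C(Sph m, Sph m)).Homotopic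
      ⟨fun w => sphereReflection (v', w), by fun_prop⟩ := by
  have hrank : 1 < Module.rank ℝ (EuclideanSpace ℝ (Fin (m + 1))) := by
    rw [← Module.finrank_eq_rank, finrank_euclideanSpace, Fintype.card_fin]
    exact_mod_cast (by omega : 1 < m + 1)
  have : PathConnectedSpace (Sph m) :=
    isPathConnected_iff_pathConnectedSpace.1 (isPathConnected_sphere hrank 0 zero_le_one)
  let p := PathConnectedSpace.somePath v v'
  exact ⟨⟨⟨fun q => sphereReflection (p q.1, q.2), by fun_prop⟩, fun w => by simp,
    fun w => by simp⟩⟩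

theorem dilation_homotopic (u : Sph m) (μ : Ioi (0 : ℝ)) :
    (⟨fun w => dilation u (μ, w), by fun_prop⟩ : C(Sph m, Sph m)).Homotopic
      (ContinuousMap.id _) := by
  have h1 : ∀ t : I, (0 : ℝ) < (1 - t) * μ + t := by
    intro t
    have hμ : (0 : ℝ) < μ := μ.2
    rcases t.2.2.lt_or_eq with h | h
    · have : 0 < (1 - (t : ℝ)) * μ := mul_pos (by linarith) hμ
      linarith [t.2.1]
    · rw [h]
      norm_num
  refine ⟨⟨⟨fun q => dilation u (⟨_, h1 q.1⟩, q.2), by fun_prop⟩, fun w => ?_, fun w => ?_⟩⟩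
  · simp
  · have : (⟨(1 - ((1 : I) : ℝ)) * μ + ((1 : I) : ℝ), h1 1⟩ : Ioi (0 : ℝ)) =
        ⟨1, mem_Ioi.2 one_pos⟩ :=
      Subtype.ext (by simp)
    change dilation u (_, w) = w
    rw [this]
    refine Subtype.ext ?_
    rw [coe_dilation]
    simp only [dilationDen, dilationNum]
    norm_num
    rw [smul_smul]
    norm_num
    left
    ring

/-- Homeomorphisms of the sphere, all homotopic to a fixed map, that contract a fixed hemisphere
to a given small cap. -/
theorem exists_cap_map (hm : 1 ≤ m) :
    ∃ Ψ : C(Sph m, Sph m), ∀ (x : Sph m) (s : ℝ), 0 < s → s ≤ 1 →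
      ∃ Φ Φ' : C(Sph m, Sph m), (∀ w, Φ (Φ' w) = w) ∧ Φ.Homotopic Ψ ∧ Φ'.Homotopic Ψ ∧
        (∀ w : Sph m, inner ℝ (axis hm : EuclideanSpace ℝ (Fin (m + 1))) w ≤ 0 →
          s ≤ dist (Φ w) x) ∧
        (∀ w : Sph m, 0 ≤ inner ℝ (axis hm : EuclideanSpace ℝ (Fin (m + 1))) w →
          s * (1 - inner ℝ (axis hm : EuclideanSpace ℝ (Fin (m + 1))) w) ≤ dist (Φ w) x ∧
            dist (Φ w) x ≤ 2 * s) ∧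
        ∀ w w' : Sph m, 0 ≤ inner ℝ (axis hm : EuclideanSpace ℝ (Fin (m + 1))) w →
          0 ≤ inner ℝ (axis hm : EuclideanSpace ℝ (Fin (m + 1))) w' →
          dist (Φ w) (Φ w') ≤ 2 * s * dist w w' := by
  -- A dilation is homotopic to the identity, and all reflections are homotopic because the sphere
  -- is path connected. Composing with a cap map thus has the same effect on homotopy classes for
  -- every x and s.
  refine ⟨⟨fun w => sphereReflection (pole m, w), by fun_prop⟩, fun x s hs hs1 => ?_⟩
  obtain ⟨v, hv⟩ := exists_sphereReflection_eq hm x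
  let μ : Ioi (0 : ℝ) := ⟨s, hs⟩
  let ν : Ioi (0 : ℝ) := ⟨s⁻¹, inv_pos.2 hs⟩
  let r : C(Sph m, Sph m) := ⟨fun w => sphereReflection (v, w), by fun_prop⟩
  let d : C(Sph m, Sph m) := ⟨fun w => dilation (axis hm) (μ, w), by fun_prop⟩
  let d' : C(Sph m, Sph m) := ⟨fun w => dilation (axis hm) (ν, w), by fun_prop⟩
  refine ⟨r.comp d, d'.comp r, fun w => ?_, ?_, ?_, fun w hw => ?_, fun w hw => ?_,
    fun w w' hw hw' => ?_⟩
  · change sphereReflection (v, dilation _ (μ, dilation _ (ν, sphereReflection (v, w)))) = w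
    rw [dilation_dilation _ _ _ _ (mul_inv_cancel₀ hs.ne'), sphereReflection_sphereReflection]
  · exact ContinuousMap.Homotopic.comp (sphereReflection_homotopic hm v (pole m))
      (dilation_homotopic (axis hm) μ)
  · exact ContinuousMap.Homotopic.comp (dilation_homotopic (axis hm) ν)
      (sphereReflection_homotopic hm v (pole m))
  · change s ≤ dist (sphereReflection (v, dilation (axis hm) (μ, w))) x
    rw [← hv, dist_sphereReflection]
    exact le_dist_dilation _ _ μ hs1 hw
  · change _ ≤ dist (sphereReflection (v, dilation (axis hm) (μ, w))) x ∧
      dist (sphereReflection (v, dilation (axis hm) (μ, w))) x ≤ _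
    rw [← hv, dist_sphereReflection]
    exact ⟨le_dist_dilation_of_nonneg _ _ μ hs1 hw, dist_dilation_axis_le _ _ μ hw⟩
  · change dist (sphereReflection (v, dilation (axis hm) (μ, w)))
      (sphereReflection (v, dilation (axis hm) (μ, w'))) ≤ _
    rw [dist_sphereReflection]
    exact dist_dilation_le _ _ _ μ hw hw'

end Moebius

end GapPotential

end

noncomputable section

namespace GapPotential

/-! ### Grouping bad points into separated clusters -/

section Clusters

variable {X : Type*} [PseudoMetricSpace X]

/-- Two points of the half-space over `X` are at a hyperbolic distance controlled by `L`. -/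
def Near (L : ℝ) (p q : X × ℝ) : Prop :=
  dist p.1 q.1 ≤ L * p.2 ∧ dist p.1 q.1 ≤ L * q.2 ∧ p.2 ≤ L * q.2 ∧ q.2 ≤ L * p.2

theorem Near.symm {L : ℝ} {p q : X × ℝ} (h : Near L p q) : Near L q p := by
  obtain ⟨h1, h2, h3, h4⟩ := h
  exact ⟨by rwa [dist_comm], by rwa [dist_comm], h4, h3⟩

theorem Near.trans {L M : ℝ} (hL : 1 ≤ L) (hM : 1 ≤ M) {p q z : X × ℝ} (hp : 0 < p.2)
    (hz : 0 < z.2) (h : Near L p q) (h' : Near M q z) : Near (2 * L * M) p z := by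
  obtain ⟨h1, h2, h3, h4⟩ := h
  obtain ⟨k1, k2, k3, k4⟩ := h'
  have ht := dist_triangle p.1 q.1 z.1
  have hL0 : 0 < L := by linarith
  have hM0 : 0 < M := by linarith
  have e1 : M * q.2 ≤ M * (L * p.2) := by gcongr
  have e2 : L * q.2 ≤ L * (M * z.2) := by gcongr
  have e3 : L * p.2 ≤ M * (L * p.2) := le_mul_of_one_le_left (by positivity) hM
  have e4 : M * z.2 ≤ L * (M * z.2) := le_mul_of_one_le_left (by positivity) hL
  have e5 : 0 < M * (L * p.2) := by positivity
  have e6 : 0 < L * (M * z.2) := by positivity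
  refine ⟨?_, ?_, ?_, ?_⟩ <;> nlinarith

theorem Near.mono {L M : ℝ} (hLM : L ≤ M) {p q : X × ℝ} (hp : 0 < p.2) (hq : 0 < q.2)
    (h : Near L p q) : Near M p q := by
  obtain ⟨h1, h2, h3, h4⟩ := h
  have e1 : L * p.2 ≤ M * p.2 := by gcongr
  have e2 : L * q.2 ≤ M * q.2 := by gcongr
  exact ⟨h1.trans e1, h2.trans e2, h3.trans e2, h4.trans e1⟩

/-- A covering by few points can be coarsened to a covering by points that are far from each other
and from the level `1`, compared to the scale of the covering. -/
theorem exists_coarsening (Lam : ℝ → ℝ) (hLam : ∀ L, 1 ≤ L → 1 ≤ Lam L) (K : ℕ) :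
    ∀ L₀ : ℝ, 1 ≤ L₀ → ∃ Lmax : ℝ, L₀ ≤ Lmax ∧ ∀ (B : Set (X × ℝ)) (Q : Finset (X × ℝ)),
      Q.card ≤ K → (∀ p ∈ B, 0 < p.2) → (∀ q ∈ Q, 0 < q.2) →
      (∀ p ∈ B, 1 ≤ p.2 * L₀ ∨ ∃ q ∈ Q, Near L₀ p q) →
      ∃ Q' ⊆ Q, ∃ L, L₀ ≤ L ∧ L ≤ Lmax ∧ (∀ p ∈ B, 1 ≤ p.2 * L ∨ ∃ q ∈ Q', Near L p q) ∧
        (∀ q ∈ Q', q.2 * Lam L < 1) ∧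
        ∀ q ∈ Q', ∀ q' ∈ Q', q ≠ q' → ¬ Near (Lam L) q q' := by
  classical
  induction K with
  | zero =>
    intro L₀ _
    refine ⟨L₀, le_rfl, fun B Q hQ _ _ hcov => ⟨Q, subset_rfl, L₀, le_rfl, le_rfl, hcov, ?_, ?_⟩⟩
    all_goals
      rw [Nat.le_zero, Finset.card_eq_zero] at hQ
      simp [hQ]
  | succ K ih =>
    intro L₀ hL₀
    have hl := hLam L₀ hL₀
    -- The constant of `Near.trans`: if q is `Lam L₀`-near another point, every point L₀-near q is
    -- L₁-near that one. If q is too close to level 1, the same constant absorbs the points near q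
    -- into the top. Each failure removes a point, so at most K enlargements occur.
    set L₁ := 2 * L₀ * Lam L₀ with hL₁
    have hL₀₁ : L₀ ≤ L₁ := by nlinarith
    obtain ⟨Lmax, hLmax, h⟩ := ih L₁ (hL₀.trans hL₀₁)
    refine ⟨Lmax, hL₀₁.trans hLmax, fun B Q hQ hB hQ0 hcov => ?_⟩
    have remove : ∀ q ∈ Q, (∀ p ∈ B, Near L₀ p q → 1 ≤ p.2 * L₁ ∨ ∃ q' ∈ Q.erase q, Near L₁ p q') →
        ∃ Q' ⊆ Q, ∃ L, L₀ ≤ L ∧ L ≤ Lmax ∧ (∀ p ∈ B, 1 ≤ p.2 * L ∨ ∃ q ∈ Q', Near L p q) ∧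
        (∀ q ∈ Q', q.2 * Lam L < 1) ∧
        ∀ q ∈ Q', ∀ q' ∈ Q', q ≠ q' → ¬ Near (Lam L) q q' := by
      intro q hq hrem
      obtain ⟨Q', hQ', L, hL, hLm, h'⟩ := h B (Q.erase q)
        (by rw [Finset.card_erase_of_mem hq]; omega) hB
        (fun q' hq' => hQ0 q' (Finset.mem_of_mem_erase hq')) (fun p hp => by
          have hp0 := hB p hp
          rcases hcov p hp with h1 | ⟨q', hq', h1⟩
          · left
            nlinarith
          · by_cases hqq : q' = q
            · subst hqq
              exact hrem p hp h1
            · exact Or.inr ⟨q', Finset.mem_erase.2 ⟨hqq, hq'⟩, h1.mono hL₀₁ hp0 (hQ0 q' hq')⟩)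
      exact ⟨Q', hQ'.trans (Finset.erase_subset _ _), L, hL₀₁.trans hL, hLm, h'⟩
    by_cases htop : ∃ q ∈ Q, 1 ≤ q.2 * Lam L₀
    · obtain ⟨q, hq, hqt⟩ := htop
      refine remove q hq fun p hp hpq => Or.inl ?_
      have hp0 := hB p hp
      have h1 : q.2 * Lam L₀ ≤ (L₀ * p.2) * Lam L₀ := by
        gcongr
        exact hpq.2.2.2
      have : 0 < L₀ * p.2 * Lam L₀ := by positivity
      nlinarith
    · by_cases hsep : ∃ q ∈ Q, ∃ q' ∈ Q, q ≠ q' ∧ Near (Lam L₀) q q'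
      · obtain ⟨q, hq, q', hq', hne, hqq⟩ := hsep
        refine remove q hq fun p hp hpq => Or.inr ⟨q', Finset.mem_erase.2 ⟨hne.symm, hq'⟩, ?_⟩
        exact hpq.trans hL₀ hl (hB p hp) (hQ0 q' hq') hqq
      · push Not at htop hsep
        exact ⟨Q, subset_rfl, L₀, le_rfl, hL₀₁.trans hLmax, hcov, htop, hsep⟩

theorem exists_maximal_card {α : Type*} (P : Finset α → Prop) (h0 : P ∅) {K : ℕ}
    (hK : ∀ Q, P Q → Q.card ≤ K) : ∃ Q, P Q ∧ ∀ Q', P Q' → Q'.card ≤ Q.card := by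
  by_contra! h
  have : ∀ n : ℕ, ∃ Q, P Q ∧ n ≤ Q.card := by
    intro n
    induction n with
    | zero => exact ⟨∅, h0, Nat.zero_le _⟩
    | succ n ih =>
      obtain ⟨Q, hQ, hn⟩ := ih
      obtain ⟨Q', hQ', hlt⟩ := h Q hQ
      exact ⟨Q', hQ', by omega⟩
  obtain ⟨Q, hQ, hn⟩ := this (K + 1)
  have := hK Q hQ
  omega

/-- Take a family in B of maximal cardinality with disjoint spread pairs. Any further bad point
meets one of its members, so the radii are comparable up to 2 / θ and the balls intersect. -/
theorem exists_net {m : ℕ} {θ : ℝ} (hθ : 0 < θ) {K : ℕ} {B : Set (Sph m × ℝ)}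
    (hB : ∀ p ∈ B, 0 < p.2)
    (hK : ∀ Q : Finset (Sph m × ℝ), (∀ q ∈ Q, q ∈ B) →
      (Q : Set (Sph m × ℝ)).PairwiseDisjoint (fun q => spreadPairs θ q.1 q.2) → Q.card ≤ K) :
    ∃ Q : Finset (Sph m × ℝ), Q.card ≤ K ∧ (∀ q ∈ Q, q ∈ B) ∧
      ∀ p ∈ B, ∃ q ∈ Q, Near (1 + 2 / θ) p q := by
  classical
  obtain ⟨Q, ⟨hQB, hQd⟩, hmax⟩ := exists_maximal_card
    (fun Q : Finset (Sph m × ℝ) => (∀ q ∈ Q, q ∈ B) ∧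
      (Q : Set (Sph m × ℝ)).PairwiseDisjoint (fun q => spreadPairs θ q.1 q.2))
    (by simp) (K := K) (fun Q hQ => hK Q hQ.1 hQ.2)
  refine ⟨Q, hK Q hQB hQd, hQB, fun p hp => ?_⟩
  have hp0 := hB p hp
  have hθ2 : 0 < 2 / θ := by positivity
  by_cases hpQ : p ∈ Q
  · refine ⟨p, hpQ, ?_, ?_, ?_, ?_⟩
    all_goals
      have : 0 < 2 / θ * p.2 := by positivity
      rw [one_add_mul]
      first
        | (rw [dist_self]; linarith)
        | linarith
  · by_contra! hno
    have hdis : ∀ q ∈ Q, Disjoint (spreadPairs θ p.1 p.2) (spreadPairs θ q.1 q.2) := by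
      intro q hq
      have hq0 := hB q (hQB q hq)
      by_contra hnd
      have h1 : ¬ 2 * q.2 < θ * p.2 := fun h => hnd (disjoint_spreadPairs_of_lt h)
      have h2 : ¬ 2 * p.2 < θ * q.2 := fun h => hnd (disjoint_spreadPairs_of_lt h).symm
      have h3 : ¬ p.2 + q.2 ≤ dist p.1 q.1 := fun h => hnd (disjoint_spreadPairs_of_add_le h)
      have h1' : p.2 ≤ 2 / θ * q.2 := by
        rw [div_mul_eq_mul_div, le_div_iff₀ hθ]
        linarith
      have h2' : q.2 ≤ 2 / θ * p.2 := by
        rw [div_mul_eq_mul_div, le_div_iff₀ hθ]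
        linarith
      refine hno q hq ⟨?_, ?_, ?_, ?_⟩ <;> rw [one_add_mul] <;> linarith
    have := hmax (insert p Q) ⟨fun q hq => by
        rcases Finset.mem_insert.1 hq with rfl | hq
        · exact hp
        · exact hQB q hq, by
        rw [Finset.coe_insert]
        exact hQd.insert fun q hq _ => hdis q hq⟩
    rw [Finset.card_insert_of_notMem hpQ] at this
    omega

end Clusters

end GapPotential

end

noncomputable section

namespace GapPotential

/-! ### Cutoff functions -/

section Cutoff

/-- The piecewise affine cutoff that is `1` up to `a` and `0` from `2 * a` on. -/
def cutoff (a t : ℝ) : ℝ := max 0 (min 1 (2 - t / a))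

theorem cutoff_nonneg (a t : ℝ) : 0 ≤ cutoff a t := le_max_left _ _

theorem cutoff_le_one (a t : ℝ) : cutoff a t ≤ 1 := max_le zero_le_one (min_le_left _ _)

theorem cutoff_eq_one {a t : ℝ} (ha : 0 < a) (h : t ≤ a) : cutoff a t = 1 := by
  have : t / a ≤ 1 := (div_le_one ha).2 h
  rw [cutoff, min_eq_left (by linarith), max_eq_right zero_le_one]

theorem cutoff_le {a t b : ℝ} (hb : 0 ≤ b) (h : 2 - t / a ≤ b) : cutoff a t ≤ b :=
  max_le hb ((min_le_right _ _).trans h)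

theorem lt_of_cutoff_pos {a t : ℝ} (ha : 0 < a) (h : 0 < cutoff a t) : t < 2 * a := by
  by_contra! hle
  have : 2 ≤ t / a := (le_div_iff₀ ha).2 hle
  linarith [cutoff_le (a := a) (t := t) le_rfl (by linarith)]

theorem continuous_cutoff (a : ℝ) : Continuous (cutoff a) := by
  unfold cutoff
  fun_prop

theorem abs_cutoff_sub_le {a : ℝ} (ha : 0 < a) (t t' : ℝ) :
    |cutoff a t - cutoff a t'| ≤ |t - t'| / a := by
  unfold cutoff
  rw [max_comm 0, max_comm 0, min_comm 1, min_comm 1]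
  refine (abs_max_sub_max_le_abs _ _ _).trans ?_
  refine (abs_min_sub_min_le_max _ _ _ _).trans ?_
  rw [sub_self, abs_zero, max_eq_left (abs_nonneg _), ← abs_of_pos ha, ← abs_div, abs_of_pos ha,
    abs_sub_comm]
  refine le_of_eq (congrArg _ ?_)
  ring

end Cutoff

/-! ### Scale functions avoiding the boxes of bad points -/

section Ladder

variable {X : Type*} [PseudoMetricSpace X]

/-- A finite set of scales at points of `X` such that every bad point below height `1 / L` is at
distance at most `L` from one of them, and that are themselves far from each other. -/
structure ScaleConfig (Good : X → ℝ → Prop) (L h₀ : ℝ) (Q : Finset (X × ℝ)) : Prop where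
  one_le : 1 ≤ L
  pos : ∀ q ∈ Q, 0 < q.2
  small : ∀ q ∈ Q, q.2 * (8192 * L ^ 4) < 1
  sep : ∀ q ∈ Q, ∀ q' ∈ Q, q ≠ q' → ¬ Near (8192 * L ^ 4) q q'
  h_pos : 0 < h₀
  h_le : ∀ q ∈ Q, h₀ ≤ q.2 / (8 * L)
  h_top : h₀ ≤ 1 / (2 * L)
  good_of_le : ∀ x v, 0 < v → v ≤ h₀ → Good x v
  near_of_bad : ∀ x v, 0 < v → v * L < 1 → ¬ Good x v → ∃ q ∈ Q, Near L (x, v) q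

/-- The height of the tower at `q`, as a function on `X`. -/
def tower (L : ℝ) (q : X × ℝ) (x : X) : ℝ := cutoff (4 * L * q.2) (dist x q.1)

theorem continuous_tower (L : ℝ) (q : X × ℝ) : Continuous (tower L q) :=
  (continuous_cutoff _).comp (by fun_prop)

/-- The scale function that passes just above all the points of `A`. -/
def ladder (L h₀ : ℝ) (A : Finset (X × ℝ)) (x : X) : ℝ :=
  A.fold max h₀ fun q => tower L q x * (8 * L * q.2)

theorem ladder_insert [DecidableEq (X × ℝ)] (L h₀ : ℝ) {A : Finset (X × ℝ)} {q : X × ℝ}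
    (hq : q ∉ A) (x : X) :
    ladder L h₀ (insert q A) x = max (tower L q x * (8 * L * q.2)) (ladder L h₀ A x) :=
  Finset.fold_insert hq

theorem le_ladder (L h₀ : ℝ) (A : Finset (X × ℝ)) (x : X) : h₀ ≤ ladder L h₀ A x :=
  (Finset.le_fold_max _).2 (Or.inl le_rfl)

theorem tower_le_ladder (L h₀ : ℝ) {A : Finset (X × ℝ)} {q : X × ℝ} (hq : q ∈ A) (x : X) :
    tower L q x * (8 * L * q.2) ≤ ladder L h₀ A x :=
  (Finset.le_fold_max _).2 (Or.inr ⟨q, hq, le_rfl⟩)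

theorem ladder_eq (L h₀ : ℝ) (A : Finset (X × ℝ)) (x : X) :
    ladder L h₀ A x = h₀ ∨ ∃ q ∈ A, ladder L h₀ A x = tower L q x * (8 * L * q.2) := by
  classical
  induction A using Finset.induction_on with
  | empty => exact Or.inl rfl
  | insert q A hq ih =>
    rw [ladder_insert L h₀ hq]
    rcases max_choice (tower L q x * (8 * L * q.2)) (ladder L h₀ A x) with h | h
    · exact Or.inr ⟨q, Finset.mem_insert_self _ _, h⟩
    · rw [h]
      exact ih.imp id fun ⟨q', hq', e⟩ => ⟨q', Finset.mem_insert_of_mem hq', e⟩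

theorem continuous_ladder (L h₀ : ℝ) (A : Finset (X × ℝ)) : Continuous (ladder L h₀ A) := by
  classical
  induction A using Finset.induction_on with
  | empty => exact continuous_const
  | insert q A hq ih =>
    have e : ladder L h₀ (insert q A) =
        fun x => max (tower L q x * (8 * L * q.2)) (ladder L h₀ A x) :=
      funext fun x => ladder_insert L h₀ hq x
    rw [e]
    exact ((continuous_tower L q).mul continuous_const).max ih

namespace ScaleConfig

variable {Good : X → ℝ → Prop} {L h₀ : ℝ} {Q : Finset (X × ℝ)}

theorem L_pos (h : ScaleConfig Good L h₀ Q) : 0 < L := by linarith [h.one_le]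

theorem height_lt (h : ScaleConfig Good L h₀ Q) {q : X × ℝ} (hq : q ∈ Q) :
    8 * L * q.2 < 1 / (2 * L) := by
  have hL := h.one_le
  have hL0 := h.L_pos
  have hq0 := h.pos q hq
  rw [lt_div_iff₀ (by positivity)]
  have h1 : L ^ 2 ≤ L ^ 4 := pow_le_pow_right₀ hL (by norm_num)
  have h2 := h.small q hq
  nlinarith

/-- Boxes of distinct points are disjoint: a point in both is 64 L ^ 2-near each centre, and
`Near.trans` gives 2 · 64 ^ 2 L ^ 4 = 8192 L ^ 4, the separation constant. -/
theorem eq_of_mem_boxes (h : ScaleConfig Good L h₀ Q) {p q : X × ℝ} (hp : p ∈ Q) (hq : q ∈ Q)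
    {x : X} {v : ℝ} (hxp : dist x p.1 ≤ 8 * L * p.2) (hvp : v ≤ 8 * L * p.2)
    (hpv : p.2 ≤ 8 * L * v) (hxq : dist x q.1 ≤ 8 * L * q.2) (hvq : v ≤ 8 * L * q.2)
    (hqv : q.2 ≤ 8 * L * v) : p = q := by
  by_contra hne
  have hL := h.one_le
  have hL0 := h.L_pos
  have key : ∀ z ∈ Q, dist x z.1 ≤ 8 * L * z.2 → v ≤ 8 * L * z.2 → z.2 ≤ 8 * L * v →
      Near (64 * L ^ 2) (x, v) z := by
    intro z hz h1 h2 h3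
    have hz0 := h.pos z hz
    have hv0 : 0 < v := by
      have : 0 < 8 * L * v := hz0.trans_le h3
      exact pos_of_mul_pos_right this (by positivity)
    have e1 : 8 * L * z.2 ≤ 64 * L ^ 2 * v := by
      calc 8 * L * z.2 ≤ 8 * L * (8 * L * v) := by gcongr
        _ = _ := by ring
    have e2 : 8 * L ≤ 64 * L ^ 2 := by nlinarith
    have e3 : 8 * L * z.2 ≤ 64 * L ^ 2 * z.2 := by gcongr
    have e4 : 8 * L * v ≤ 64 * L ^ 2 * v := by gcongr
    exact ⟨h1.trans e1, h1.trans e3, h2.trans e3, h3.trans e4⟩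
  have h1 := (key p hp hxp hvp hpv).symm
  have h2 := key q hq hxq hvq hqv
  have h64 : 1 ≤ 64 * L ^ 2 := by nlinarith
  refine h.sep p hp q hq hne ?_
  have := h1.trans h64 h64 (h.pos p hp) (h.pos q hq) h2
  convert this using 1
  ring

/-- The points of `A` come after the points of `Q` that are not in `A`. -/
def IsLower (Q A : Finset (X × ℝ)) : Prop := ∀ p ∈ Q, p ∉ A → ∀ q ∈ A, q.2 ≤ p.2

theorem tower_eq_one (h : ScaleConfig Good L h₀ Q) {q : X × ℝ} (hq : q ∈ Q) {x : X}
    (hx : dist x q.1 ≤ 4 * L * q.2) : tower L q x = 1 :=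
  cutoff_eq_one (by have := h.pos q hq; have := h.L_pos; positivity) hx

theorem dist_lt_of_tower_pos (h : ScaleConfig Good L h₀ Q) {q : X × ℝ} (hq : q ∈ Q) {x : X}
    (hx : 0 < tower L q x) : dist x q.1 < 8 * L * q.2 := by
  have := lt_of_cutoff_pos (by have := h.pos q hq; have := h.L_pos; positivity) hx
  linarith

theorem tower_mul_le (h : ScaleConfig Good L h₀ Q) {q : X × ℝ} (hq : q ∈ Q) (x : X) :
    tower L q x * (8 * L * q.2) ≤ 8 * L * q.2 := by
  have := h.pos q hq
  have := h.L_pos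
  exact mul_le_of_le_one_left (by positivity) (cutoff_le_one _ _)

theorem ladder_le (h : ScaleConfig Good L h₀ Q) {A : Finset (X × ℝ)} (hA : A ⊆ Q) (x : X) :
    ladder L h₀ A x ≤ 1 / (2 * L) := by
  rcases ladder_eq L h₀ A x with e | ⟨q, hq, e⟩
  · rw [e]
    exact h.h_top
  · rw [e]
    exact (h.tower_mul_le (hA hq) x).trans (h.height_lt (hA hq)).le

/-- A bad point (x, v) would be L-near some p. If p lies in A, its tower already reaches 8 L p.2 > v
above x. Otherwise p is at least as high as the points of A and as q, so (x, v) lies in the box of p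
and in the box of the tower that realises the maximum. Disjointness leaves only p = q, which `hbox`
excludes. -/
theorem good_max_ladder (h : ScaleConfig Good L h₀ Q) {A : Finset (X × ℝ)} {q : X × ℝ}
    (hA : A ⊆ Q) (hq : q ∈ Q) (hqA : q ∉ A) (hlow : IsLower Q A)
    (hlow' : ∀ p ∈ Q, p ∉ A → q.2 ≤ p.2) {x : X} {w : ℝ} (hw : w ≤ 8 * L * q.2)
    (hwx : 0 < w → dist x q.1 ≤ 8 * L * q.2)
    (hbox : dist x q.1 ≤ L * q.2 → w ≤ L * q.2 → w * L < q.2) :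
    Good x (max (ladder L h₀ A x) w) := by
  have hL := h.one_le
  have hL0 := h.L_pos
  have hq0 := h.pos q hq
  by_contra hbad
  set v := max (ladder L h₀ A x) w with hv
  have hv0 : h₀ < v := by
    by_contra! hle
    exact hbad (h.good_of_le x v (h.h_pos.trans_le ((le_ladder L h₀ A x).trans (le_max_left _ _)))
      hle)
  have hvpos : 0 < v := h.h_pos.trans hv0
  have hvL : v ≤ 1 / (2 * L) := max_le (h.ladder_le hA x) (hw.trans (h.height_lt hq).le)
  have hvL1 : v * L < 1 := by
    rw [le_div_iff₀ (by positivity)] at hvL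
    linarith
  obtain ⟨p, hp, n1, n2, n3, n4⟩ := h.near_of_bad x v hvpos hvL1 hbad
  simp only at n1 n2 n3 n4
  have hp0 := h.pos p hp
  have hLp : 0 < L * p.2 := by positivity
  have hLv : 0 < L * v := by positivity
  have ladder_case : v = ladder L h₀ A x → ∃ p' ∈ A, dist x p'.1 ≤ 8 * L * p'.2 ∧
      v = tower L p' x * (8 * L * p'.2) := by
    intro e
    rcases ladder_eq L h₀ A x with e' | ⟨p', hp', e'⟩
    · linarith
    · refine ⟨p', hp', (h.dist_lt_of_tower_pos (hA hp') ?_).le, e.trans e'⟩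
      have hp'0 := h.pos p' (hA hp')
      have : 0 < tower L p' x * (8 * L * p'.2) := by rw [← e', ← e]; exact hvpos
      exact pos_of_mul_pos_left this (by positivity)
  by_cases hpA : p ∈ A
  · have h1 : tower L p x = 1 := h.tower_eq_one hp (by linarith)
    have h2 := (tower_le_ladder L h₀ hpA x).trans (le_max_left _ w)
    rw [h1] at h2
    linarith
  · rcases max_choice (ladder L h₀ A x) w with e | e
    · obtain ⟨p', hp', hx', e'⟩ := ladder_case e
      have h1 := hlow p hp hpA p' hp'
      have h2 := h.tower_mul_le (hA hp') x
      refine hpA (h.eq_of_mem_boxes hp (hA hp') (x := x) (v := v) ?_ ?_ ?_ hx' ?_ ?_ ▸ hp') <;>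
        linarith
    · have hvw : v = w := e
      by_cases hpq : p = q
      · subst hpq
        have := hbox n2 (hvw ▸ n3)
        rw [← hvw] at this
        linarith
      · have h1 := hlow' p hp hpA
        refine hpq (h.eq_of_mem_boxes hp hq (x := x) (v := v) ?_ ?_ ?_
          (hwx (hvw ▸ hvpos)) ?_ ?_) <;> linarith

theorem good_above_ladder (h : ScaleConfig Good L h₀ Q) {x : X} {v : ℝ}
    (hv : ladder L h₀ Q x ≤ v) (hv1 : v ≤ 1 / (2 * L)) : Good x v := by
  have hL0 := h.L_pos
  by_contra hbad
  have hvpos : 0 < v := h.h_pos.trans_le ((le_ladder L h₀ Q x).trans hv)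
  have hvL1 : v * L < 1 := by
    rw [le_div_iff₀ (by positivity)] at hv1
    linarith
  obtain ⟨p, hp, n1, n2, n3, n4⟩ := h.near_of_bad x v hvpos hvL1 hbad
  simp only at n1 n2 n3 n4
  have hp0 := h.pos p hp
  have hLp : 0 < L * p.2 := by positivity
  have h1 : tower L p x = 1 := h.tower_eq_one hp (by linarith)
  have h2 := (tower_le_ladder L h₀ hp x).trans hv
  rw [h1] at h2
  linarith

/-- Over the box of q the lower towers stay below its bottom: otherwise the point over x at the full
height 8 L p.2 of a tower would lie in two boxes. -/
theorem ladder_le_of_dist_le (h : ScaleConfig Good L h₀ Q) {A : Finset (X × ℝ)} {q : X × ℝ}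
    (hA : A ⊆ Q) (hq : q ∈ Q) (hqA : q ∉ A) (hlow : ∀ p ∈ A, p.2 ≤ q.2) {x : X}
    (hx : dist x q.1 ≤ 8 * L * q.2) : ladder L h₀ A x ≤ q.2 / (8 * L) := by
  have hL := h.one_le
  have hL0 := h.L_pos
  rcases ladder_eq L h₀ A x with e | ⟨p, hp, e⟩
  · rw [e]
    exact h.h_le q hq
  · by_contra! hlt
    have hp0 := h.pos p (hA hp)
    have h1 := h.tower_mul_le (hA hp) x
    have hpos : 0 < tower L p x := by
      have h3 : 0 < tower L p x * (8 * L * p.2) := by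
        rw [← e]
        exact h.h_pos.trans_le (le_ladder L h₀ A x)
      exact pos_of_mul_pos_left h3 (by positivity)
    have h2 := h.dist_lt_of_tower_pos (hA hp) hpos
    have h3 := hlow p hp
    have h4 : 8 * L * p.2 ≤ 8 * L * q.2 := by gcongr
    rw [e, div_lt_iff₀ (by positivity)] at hlt
    have h5 : q.2 ≤ 8 * L * (8 * L * p.2) := by
      have : tower L p x * (8 * L * p.2) * (8 * L) ≤ 8 * L * p.2 * (8 * L) := by gcongr
      linarith
    have h6 : p.2 ≤ 8 * L * (8 * L * p.2) := by nlinarith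
    exact hqA (h.eq_of_mem_boxes (hA hp) hq (x := x) (v := 8 * L * p.2) h2.le le_rfl h6 hx h4 h5
      ▸ hp)

end ScaleConfig

end Ladder

end GapPotential

end

noncomputable section

namespace GapPotential

/-! ### Folding the sphere onto a hemisphere -/

section Fold

variable {m : ℕ}

/-- The folding of the sphere onto the hemisphere around a unit vector. -/
def sphereFold (v w : Sph m) : Sph m :=
  open Classical in
  if inner ℝ (v : EuclideanSpace ℝ (Fin (m + 1))) w ≤ 0 then sphereReflection (v, w) else w

theorem sphereFold_of_nonpos {v w : Sph m}
    (h : inner ℝ (v : EuclideanSpace ℝ (Fin (m + 1))) w ≤ 0) :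
    sphereFold v w = sphereReflection (v, w) := if_pos h

theorem sphereFold_of_nonneg {v w : Sph m}
    (h : 0 ≤ inner ℝ (v : EuclideanSpace ℝ (Fin (m + 1))) w) : sphereFold v w = w := by
  rcases h.lt_or_eq with h | h
  · exact if_neg h.not_ge
  · rw [sphereFold_of_nonpos h.ge]
    refine Subtype.ext ?_
    rw [coe_sphereReflection, ← h]
    simp

theorem inner_sphereFold (v w : Sph m) :
    inner ℝ (v : EuclideanSpace ℝ (Fin (m + 1))) (sphereFold v w) =
      |(inner ℝ (v : EuclideanSpace ℝ (Fin (m + 1))) w : ℝ)| := by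
  rcases le_total (inner ℝ (v : EuclideanSpace ℝ (Fin (m + 1))) w) 0 with h | h
  · rw [sphereFold_of_nonpos h, inner_sphereReflection, abs_of_nonpos h]
  · rw [sphereFold_of_nonneg h, abs_of_nonneg h]

theorem dist_sphereReflection_le {v w w' : Sph m}
    (h : 0 ≤ inner ℝ (v : EuclideanSpace ℝ (Fin (m + 1))) w)
    (h' : inner ℝ (v : EuclideanSpace ℝ (Fin (m + 1))) w' ≤ 0) :
    dist w (sphereReflection (v, w')) ≤ dist w w' := by
  rw [← sq_le_sq₀ dist_nonneg dist_nonneg, dist_sq_sphere, dist_sq_sphere, coe_sphereReflection,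
    inner_sub_right, real_inner_smul_right, real_inner_comm]
  rw [real_inner_comm] at h
  nlinarith [mul_nonneg h (neg_nonneg.2 h'),
    real_inner_comm (v : EuclideanSpace ℝ (Fin (m + 1))) w,
    real_inner_comm (w' : EuclideanSpace ℝ (Fin (m + 1))) w]

theorem dist_sphereFold_le (v w w' : Sph m) :
    dist (sphereFold v w) (sphereFold v w') ≤ dist w w' := by
  rcases le_total (inner ℝ (v : EuclideanSpace ℝ (Fin (m + 1))) w) 0 with h | h <;>
    rcases le_total (inner ℝ (v : EuclideanSpace ℝ (Fin (m + 1))) w') 0 with h' | h'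
  · rw [sphereFold_of_nonpos h, sphereFold_of_nonpos h', dist_sphereReflection]
  · rw [sphereFold_of_nonpos h, sphereFold_of_nonneg h', dist_comm, dist_comm w]
    exact dist_sphereReflection_le h' h
  · rw [sphereFold_of_nonneg h, sphereFold_of_nonpos h']
    exact dist_sphereReflection_le h h'
  · rw [sphereFold_of_nonneg h, sphereFold_of_nonneg h']

end Fold

/-! ### Maps obtained from admissible scale functions -/

section Smoothing

variable {m : ℕ} {N E : Type*} [EMetricSpace N] [NormedAddCommGroup E] [NormedSpace ℝ E]

theorem continuous_tentAverage {X : Type*} [TopologicalSpace X] {F : Sph m → E}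
    (hF : Continuous F) {a : X → Sph m} {b : X → ℝ} (ha : Continuous a) (hb : Continuous b)
    (hb0 : ∀ x, 0 < b x) (hb1 : ∀ x, b x ≤ 1) :
    Continuous fun x => tentAverage F (a x) (b x) := by
  obtain ⟨M, hM⟩ := (isCompact_range hF).isBounded.exists_pos_norm_le
  obtain ⟨C, -, hCF⟩ := exists_dist_tentAverage_le (E := E) m M hM.1
  refine continuous_iff_continuousAt.2 fun x => ?_
  rw [ContinuousAt, tendsto_iff_dist_tendsto_zero]
  have hlim : Filter.Tendsto (fun y => C * ((dist (a x) (a y) + |b x - b y|) / b x)) (𝓝 x)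
      (𝓝 0) := by
    have hc : Continuous fun y => C * ((dist (a x) (a y) + |b x - b y|) / b x) :=
      continuous_const.mul (((continuous_const.dist ha).add (by fun_prop)).div_const _)
    simpa using hc.tendsto x
  refine squeeze_zero (fun _ => dist_nonneg) (fun y => ?_) hlim
  rw [dist_comm]
  exact hCF F hF (fun y => hM.2 _ ⟨y, rfl⟩) _ _ _ _ (hb0 x) (hb1 x) (hb0 y) (hb1 y)

namespace RetractionData

variable (R : RetractionData N E) (f : C(Sph m, N))

/-- A scale function on the sphere whose graph contains no bad point. -/
structure Admissible (V : Sph m → ℝ) : Prop where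
  continuous : Continuous V
  pos : ∀ x, 0 < V x
  le_one : ∀ x, V x ≤ 1
  good : ∀ x, ¬ R.IsBad f x (V x)

variable {R f}

/-- The map obtained by averaging `f` at the scales given by an admissible scale function. -/
def smoothing {V : Sph m → ℝ} (hV : R.Admissible f V) : C(Sph m, N) where
  toFun x := R.ret (tentAverage (fun y => R.emb (f y)) x (V x))
  continuous_toFun := R.continuous_ret_comp
    (continuous_tentAverage (by fun_prop) continuous_id hV.continuous hV.pos hV.le_one)
    fun x => not_not.1 (hV.good x)

theorem smoothing_apply {V : Sph m → ℝ} (hV : R.Admissible f V) (x : Sph m) :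
    smoothing hV x = R.ret (tentAverage (fun y => R.emb (f y)) x (V x)) := rfl

theorem smoothing_homotopic {V V' : Sph m → ℝ} (hV : R.Admissible f V) (hV' : R.Admissible f V')
    (u : I → Sph m → ℝ) (hu : Continuous fun p : I × Sph m => u p.1 p.2)
    (hut : ∀ t, R.Admissible f (u t)) (h0 : ∀ x, u 0 x = V x) (h1 : ∀ x, u 1 x = V' x) :
    (smoothing hV).Homotopic (smoothing hV') :=
  R.homotopic_of_tube (fun p => tentAverage (fun y => R.emb (f y)) p.2 (u p.1 p.2))
    (continuous_tentAverage (by fun_prop) continuous_snd hu (fun p => (hut p.1).pos p.2)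
      fun p => (hut p.1).le_one p.2)
    (fun p => not_not.1 ((hut p.1).good p.2))
    (fun x => by rw [smoothing_apply, h0]) (fun x => by rw [smoothing_apply, h1])

end RetractionData

end Smoothing

end GapPotential

end

noncomputable section

namespace GapPotential

/-! ### Passing below and above one box -/

section Step

variable {m : ℕ} {N E : Type*} [EMetricSpace N] [NormedAddCommGroup E] [NormedSpace ℝ E]
  {R : RetractionData N E} {f : C(Sph m, N)} {L h₀ : ℝ} {Q A : Finset (Sph m × ℝ)}
  {q : Sph m × ℝ}

open RetractionData

namespace ScaleConfig

theorem half_inv_le_one (h : ScaleConfig (fun x v => ¬ R.IsBad f x v) L h₀ Q) :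
    1 / (2 * L) ≤ 1 := by
  have := h.one_le
  rw [div_le_one (by linarith)]
  linarith

theorem admissible_max_ladder (h : ScaleConfig (fun x v => ¬ R.IsBad f x v) L h₀ Q) (hA : A ⊆ Q)
    (hq : q ∈ Q) (hqA : q ∉ A) (hlow : IsLower Q A) (hlow' : ∀ p ∈ Q, p ∉ A → q.2 ≤ p.2)
    {w : Sph m → ℝ} (hwc : Continuous w) (hw : ∀ x, w x ≤ 8 * L * q.2)
    (hwx : ∀ x, 0 < w x → dist x q.1 ≤ 8 * L * q.2)
    (hbox : ∀ x, dist x q.1 ≤ L * q.2 → w x ≤ L * q.2 → w x * L < q.2) :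
    R.Admissible f fun x => max (ladder L h₀ A x) (w x) where
  continuous := (continuous_ladder L h₀ A).max hwc
  pos x := h.h_pos.trans_le ((le_ladder L h₀ A x).trans (le_max_left _ _))
  le_one x := (max_le (h.ladder_le hA x) ((hw x).trans (h.height_lt hq).le)).trans
    h.half_inv_le_one
  good x := h.good_max_ladder hA hq hqA hlow hlow' (hw x) (hwx x) (hbox x)

/-- The lower scale function of a step of the sweep over `q`. -/
def lowerScale (L h₀ : ℝ) (A : Finset (Sph m × ℝ)) (q : Sph m × ℝ) (x : Sph m) : ℝ :=
  max (ladder L h₀ A x) (tower L q x * (q.2 / (8 * L)))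

/-- The upper scale function of a step of the sweep over `q`. -/
def upperScale (L h₀ : ℝ) (A : Finset (Sph m × ℝ)) (q : Sph m × ℝ) (x : Sph m) : ℝ :=
  max (ladder L h₀ A x) (tower L q x * (q.2 / (8 * L)) +
    cutoff (L * q.2) (dist x q.1) * (8 * L * q.2 - q.2 / (8 * L)))

theorem low_le (h : ScaleConfig (fun x v => ¬ R.IsBad f x v) L h₀ Q) (hq : q ∈ Q) :
    q.2 / (8 * L) ≤ q.2 := by
  have := h.one_le
  have := h.pos q hq
  exact div_le_self (by linarith) (by linarith)

theorem le_high (h : ScaleConfig (fun x v => ¬ R.IsBad f x v) L h₀ Q) (hq : q ∈ Q) :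
    8 * q.2 ≤ 8 * L * q.2 := by
  have := h.one_le
  have := h.pos q hq
  nlinarith

/-- The family joins the ladder of A to `lowerScale`; the added term stays below q.2 / (8 L), where
nothing is L-near q. -/
theorem admissible_lower (h : ScaleConfig (fun x v => ¬ R.IsBad f x v) L h₀ Q) (hA : A ⊆ Q)
    (hq : q ∈ Q) (hqA : q ∉ A) (hlow : IsLower Q A) (hlow' : ∀ p ∈ Q, p ∉ A → q.2 ≤ p.2) (t : I) :
    R.Admissible f fun x =>
      max (ladder L h₀ A x) ((t : ℝ) * (tower L q x * (q.2 / (8 * L)))) := by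
  have hL := h.L_pos
  have hq0 := h.pos q hq
  have hl : 0 < q.2 / (8 * L) := by positivity
  have hw : ∀ x, (t : ℝ) * (tower L q x * (q.2 / (8 * L))) ≤ q.2 / (8 * L) := fun x =>
    (mul_le_of_le_one_left (mul_nonneg (cutoff_nonneg _ _) hl.le) t.2.2).trans
      (mul_le_of_le_one_left hl.le (cutoff_le_one _ _))
  refine h.admissible_max_ladder hA hq hqA hlow hlow'
    (continuous_const.mul ((continuous_tower L q).mul continuous_const)) (fun x => ?_)
    (fun x hx => ?_) fun x _ _ => ?_
  · have := h.low_le hq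
    have := h.le_high hq
    linarith [hw x]
  · have h1 := pos_of_mul_pos_right hx t.2.1
    exact (h.dist_lt_of_tower_pos hq (pos_of_mul_pos_left h1 hl.le)).le
  · have h1 : (t : ℝ) * (tower L q x * (q.2 / (8 * L))) * L ≤ q.2 / (8 * L) * L := by
      gcongr
      exact hw x
    have h2 : q.2 / (8 * L) * L = q.2 / 8 := by
      field_simp
    linarith

/-- The family joins the ladder of A ∪ {q} to `upperScale`. Over the ball of radius L q.2, the only
place where points are L-near q, the term added to the ladder of A is constantly 8 L q.2; outside it
may descend freely. -/
theorem admissible_upper (h : ScaleConfig (fun x v => ¬ R.IsBad f x v) L h₀ Q) (hA : A ⊆ Q)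
    (hq : q ∈ Q) (hqA : q ∉ A) (hlow : IsLower Q A) (hlow' : ∀ p ∈ Q, p ∉ A → q.2 ≤ p.2) (t : I) :
    R.Admissible f fun x => max (ladder L h₀ A x)
      ((1 - (t : ℝ)) * (tower L q x * (8 * L * q.2)) + t * (tower L q x * (q.2 / (8 * L)) +
        cutoff (L * q.2) (dist x q.1) * (8 * L * q.2 - q.2 / (8 * L)))) := by
  have hL := h.L_pos
  have hL1 := h.one_le
  have hq0 := h.pos q hq
  have hl : 0 < q.2 / (8 * L) := by positivity
  have hh := h.le_high hq
  have hlq := h.low_le hq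
  refine h.admissible_max_ladder hA hq hqA hlow hlow' ?_ (fun x => ?_)
    (fun x hx => ?_) fun x hx hx' => ?_
  · have := continuous_tower (X := Sph m) L q
    have := continuous_cutoff (L * q.2)
    fun_prop
  · have h1 := h.tower_mul_le hq x
    have h2 : tower L q x * (q.2 / (8 * L)) ≤ q.2 / (8 * L) :=
      mul_le_of_le_one_left hl.le (cutoff_le_one _ _)
    have h3 : cutoff (L * q.2) (dist x q.1) * (8 * L * q.2 - q.2 / (8 * L)) ≤
        8 * L * q.2 - q.2 / (8 * L) := mul_le_of_le_one_left (by linarith) (cutoff_le_one _ _)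
    have h4 := mul_le_mul_of_nonneg_left h1 (sub_nonneg.2 t.2.2)
    have h5 := mul_le_mul_of_nonneg_left (add_le_add h2 h3) t.2.1
    linarith
  · by_contra! hlt
    have h1 : tower L q x = 0 := by
      refine le_antisymm ?_ (cutoff_nonneg _ _)
      by_contra! hpos
      exact hlt.not_gt (h.dist_lt_of_tower_pos hq hpos)
    have h2 : cutoff (L * q.2) (dist x q.1) = 0 := by
      refine le_antisymm ?_ (cutoff_nonneg _ _)
      by_contra! hpos
      have := lt_of_cutoff_pos (by positivity) hpos
      nlinarith
    simp [h1, h2] at hx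
  · have h1 : tower L q x = 1 := h.tower_eq_one hq (by nlinarith)
    rw [h1, cutoff_eq_one (by positivity) hx] at hx'
    nlinarith

theorem smoothing_ladder_homotopic_lower (h : ScaleConfig (fun x v => ¬ R.IsBad f x v) L h₀ Q)
    (hA : A ⊆ Q) (hq : q ∈ Q) (hqA : q ∉ A) (hlow : IsLower Q A)
    (hlow' : ∀ p ∈ Q, p ∉ A → q.2 ≤ p.2) (hV : R.Admissible f (ladder L h₀ A))
    (hV' : R.Admissible f (lowerScale L h₀ A q)) : (smoothing hV).Homotopic (smoothing hV') := by
  refine smoothing_homotopic hV hV' _ ?_ (h.admissible_lower hA hq hqA hlow hlow') (fun x => ?_)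
    fun x => ?_
  · have := continuous_tower (X := Sph m) L q
    have := continuous_ladder (X := Sph m) L h₀ A
    fun_prop
  · have := h.h_pos.trans_le (le_ladder L h₀ A x)
    simp [this.le]
  · simp [lowerScale]

theorem smoothing_ladder_homotopic_upper (h : ScaleConfig (fun x v => ¬ R.IsBad f x v) L h₀ Q)
    [DecidableEq (Sph m × ℝ)]
    (hA : A ⊆ Q) (hq : q ∈ Q) (hqA : q ∉ A) (hlow : IsLower Q A)
    (hlow' : ∀ p ∈ Q, p ∉ A → q.2 ≤ p.2) (hV : R.Admissible f (ladder L h₀ (insert q A)))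
    (hV' : R.Admissible f (upperScale L h₀ A q)) : (smoothing hV).Homotopic (smoothing hV') := by
  refine smoothing_homotopic hV hV' _ ?_ (h.admissible_upper hA hq hqA hlow hlow') (fun x => ?_)
    fun x => ?_
  · have := continuous_tower (X := Sph m) L q
    have := continuous_ladder (X := Sph m) L h₀ A
    have := continuous_cutoff (L * q.2)
    fun_prop
  · simp [ladder_insert L h₀ hqA, max_comm]
  · simp [upperScale]

theorem admissible_ladder (h : ScaleConfig (fun x v => ¬ R.IsBad f x v) L h₀ Q) (hA : A ⊆ Q)
    (hq : q ∈ Q) (hqA : q ∉ A) (hlow : IsLower Q A) (hlow' : ∀ p ∈ Q, p ∉ A → q.2 ≤ p.2) :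
    R.Admissible f (ladder L h₀ A) := by
  have h0 := h.admissible_lower hA hq hqA hlow hlow' 0
  convert h0 using 2 with x
  have := h.h_pos.trans_le (le_ladder L h₀ A x)
  simp [this.le]

theorem admissible_of_ladder_le (h : ScaleConfig (fun x v => ¬ R.IsBad f x v) L h₀ Q)
    {V : Sph m → ℝ} (hV : Continuous V) (hlow : ∀ x, ladder L h₀ Q x ≤ V x)
    (hle : ∀ x, V x ≤ 1 / (2 * L)) : R.Admissible f V where
  continuous := hV
  pos x := h.h_pos.trans_le ((le_ladder L h₀ Q x).trans (hlow x))
  le_one x := (hle x).trans h.half_inv_le_one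
  good x := h.good_above_ladder (hlow x) (hle x)

theorem smoothing_ladder_homotopic_const (h : ScaleConfig (fun x v => ¬ R.IsBad f x v) L h₀ Q)
    (hV : R.Admissible f (ladder L h₀ Q)) (hV' : R.Admissible f fun _ => 1 / (2 * L)) :
    (smoothing hV).Homotopic (smoothing hV') := by
  refine smoothing_homotopic hV hV'
    (fun t x => ladder L h₀ Q x + (t : ℝ) * (1 / (2 * L) - ladder L h₀ Q x)) ?_ (fun t => ?_)
    (fun x => ?_) fun x => ?_
  · have := continuous_ladder (X := Sph m) L h₀ Q
    fun_prop
  · have hle := h.ladder_le (subset_refl Q)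
    refine h.admissible_of_ladder_le ?_ (fun x => ?_) fun x => ?_
    · have := continuous_ladder (X := Sph m) L h₀ Q
      fun_prop
    · exact le_add_of_nonneg_right (mul_nonneg t.2.1 (sub_nonneg.2 (hle x)))
    · have := mul_le_of_le_one_left (sub_nonneg.2 (hle x)) t.2.2
      linarith
  · simp
  · simp

end ScaleConfig

end Step

end GapPotential

end

noncomputable section

namespace GapPotential

/-! ### The double of the lower and the upper map -/

section Step

variable {m : ℕ} {N E : Type*} [EMetricSpace N] [NormedAddCommGroup E] [NormedSpace ℝ E]
  {R : RetractionData N E} {f : C(Sph m, N)} {L h₀ : ℝ} {Q A : Finset (Sph m × ℝ)}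
  {q : Sph m × ℝ}

open RetractionData

namespace ScaleConfig

theorem admissible_lowerScale (h : ScaleConfig (fun x v => ¬ R.IsBad f x v) L h₀ Q) (hA : A ⊆ Q)
    (hq : q ∈ Q) (hqA : q ∉ A) (hlow : IsLower Q A) (hlow' : ∀ p ∈ Q, p ∉ A → q.2 ≤ p.2) :
    R.Admissible f (lowerScale L h₀ A q) := by
  have h1 := h.admissible_lower hA hq hqA hlow hlow' 1
  simp only [Set.Icc.coe_one, one_mul] at h1
  exact h1

theorem admissible_upperScale (h : ScaleConfig (fun x v => ¬ R.IsBad f x v) L h₀ Q) (hA : A ⊆ Q)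
    (hq : q ∈ Q) (hqA : q ∉ A) (hlow : IsLower Q A) (hlow' : ∀ p ∈ Q, p ∉ A → q.2 ≤ p.2) :
    R.Admissible f (upperScale L h₀ A q) := by
  have h1 := h.admissible_upper hA hq hqA hlow hlow' 1
  simp only [Set.Icc.coe_one, one_mul, sub_self, zero_mul, zero_add] at h1
  exact h1

theorem lowerScale_eq (h : ScaleConfig (fun x v => ¬ R.IsBad f x v) L h₀ Q) (hA : A ⊆ Q)
    (hq : q ∈ Q) (hqA : q ∉ A) (hmax : ∀ p ∈ A, p.2 ≤ q.2) {x : Sph m}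
    (hx : dist x q.1 ≤ 4 * L * q.2) : lowerScale L h₀ A q x = q.2 / (8 * L) := by
  have hL := h.L_pos
  have hq0 := h.pos q hq
  have hLq : 0 < L * q.2 := by positivity
  rw [lowerScale, h.tower_eq_one hq hx, one_mul,
    max_eq_right (h.ladder_le_of_dist_le hA hq hqA hmax (by linarith))]

theorem upperScale_eq (h : ScaleConfig (fun x v => ¬ R.IsBad f x v) L h₀ Q) (hA : A ⊆ Q)
    (hq : q ∈ Q) (hqA : q ∉ A) (hmax : ∀ p ∈ A, p.2 ≤ q.2) {x : Sph m}
    (hx : dist x q.1 ≤ 4 * L * q.2) : upperScale L h₀ A q x =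
      q.2 / (8 * L) + cutoff (L * q.2) (dist x q.1) * (8 * L * q.2 - q.2 / (8 * L)) := by
  have hL := h.L_pos
  have hq0 := h.pos q hq
  have hLq : 0 < L * q.2 := by positivity
  have h1 := h.ladder_le_of_dist_le hA hq hqA hmax (x := x) (by linarith)
  have h2 := h.low_le hq
  have h3 := h.le_high hq
  rw [upperScale, h.tower_eq_one hq hx, one_mul, max_eq_right]
  have := mul_nonneg (cutoff_nonneg (L * q.2) (dist x q.1))
    (show 0 ≤ 8 * L * q.2 - q.2 / (8 * L) by linarith)
  linarith

theorem upperScale_eq_lowerScale {x : Sph m} (hx : cutoff (L * q.2) (dist x q.1) = 0) :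
    upperScale L h₀ A q x = lowerScale L h₀ A q x := by
  rw [upperScale, lowerScale, hx, zero_mul, add_zero]

/-- Both scales agree outside the ball of radius 2 L q.2, and Φ sends the negative hemisphere there.
On the rest all scales lie between q.2 / (8 L) and 8 L q.2, and Φ contracts at a rate of order L
q.2, so the double has a Lipschitz constant depending only on C and L. -/
theorem exists_double (h : ScaleConfig (fun x v => ¬ R.IsBad f x v) L h₀ Q) (hm : 1 ≤ m)
    (hA : A ⊆ Q) (hq : q ∈ Q) (hqA : q ∉ A) (hmax : ∀ p ∈ A, p.2 ≤ q.2) {C : ℝ} (hC : 0 < C)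
    (hCf : ∀ (x x' : Sph m) (r r' : ℝ), 0 < r → r ≤ 1 → 0 < r' → r' ≤ 1 →
      dist (tentAverage (fun y => R.emb (f y)) x r) (tentAverage (fun y => R.emb (f y)) x' r') ≤
        C * ((dist x x' + |r - r'|) / r))
    {Φ : C(Sph m, Sph m)}
    (hΦ1 : ∀ w : Sph m, inner ℝ (axis hm : EuclideanSpace ℝ (Fin (m + 1))) w ≤ 0 →
      2 * L * q.2 ≤ dist (Φ w) q.1)
    (hΦ2 : ∀ w : Sph m, 0 ≤ inner ℝ (axis hm : EuclideanSpace ℝ (Fin (m + 1))) w →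
      2 * L * q.2 * (1 - inner ℝ (axis hm : EuclideanSpace ℝ (Fin (m + 1))) w) ≤ dist (Φ w) q.1 ∧
        dist (Φ w) q.1 ≤ 2 * (2 * L * q.2))
    (hΦ3 : ∀ w w' : Sph m, 0 ≤ inner ℝ (axis hm : EuclideanSpace ℝ (Fin (m + 1))) w →
      0 ≤ inner ℝ (axis hm : EuclideanSpace ℝ (Fin (m + 1))) w' →
      dist (Φ w) (Φ w') ≤ 2 * (2 * L * q.2) * dist w w')
    (hV : R.Admissible f (lowerScale L h₀ A q)) (hU : R.Admissible f (upperScale L h₀ A q)) :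
    ∃ (u : Sph m → E) (d : C(Sph m, N)),
      IsDouble hm ((smoothing hU).comp Φ) ((smoothing hV).comp Φ) d ∧
      (∀ w w', dist (u w) (u w') ≤ 288 * C * L ^ 2 * dist w w') ∧ (∀ w, u w ∈ R.tube) ∧
      ∀ w, d w = R.ret (u w) := by
  have hL := h.L_pos
  have hq0 := h.pos q hq
  have hLq : 0 < L * q.2 := by positivity
  have hl : 0 < q.2 / (8 * L) := by positivity
  have hlq := h.low_le hq
  have hh := h.le_high hq
  set l := q.2 / (8 * L) with hl_def
  set T : Sph m → Sph m := fun w => Φ (sphereFold (axis hm) w) with hT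
  set c : Sph m → ℝ := fun w => inner ℝ (axis hm : EuclideanSpace ℝ (Fin (m + 1))) w with hc
  -- One formula for both hemispheres: κ vanishes for c ≥ 0 (lower scale) and equals the cutoff for
  -- c ≤ 0 (upper scale). As a minimum of two Lipschitz functions it is Lipschitz across the
  -- equator.
  set κ : Sph m → ℝ := fun w => min (2 * max 0 (-c w)) (cutoff (L * q.2) (dist (T w) q.1)) with hκ
  set ℓ : Sph m → ℝ := fun w => l + κ w * (8 * L * q.2 - l) with hℓ
  have hfold : ∀ w, 0 ≤ inner ℝ (axis hm : EuclideanSpace ℝ (Fin (m + 1)))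
      (sphereFold (axis hm) w) := fun w => by
    rw [inner_sphereFold]
    exact abs_nonneg _
  have hTq : ∀ w, dist (T w) q.1 ≤ 4 * L * q.2 := fun w => by
    have := (hΦ2 _ (hfold w)).2
    linarith
  have hpos : ∀ w, 0 ≤ c w → T w = Φ w ∧ ℓ w = lowerScale L h₀ A q (T w) := by
    intro w hw
    refine ⟨by simp only [hT]; rw [sphereFold_of_nonneg hw], ?_⟩
    rw [h.lowerScale_eq hA hq hqA hmax (hTq w)]
    simp only [hℓ, hκ]
    rw [max_eq_left (by linarith), mul_zero, min_eq_left (cutoff_nonneg _ _), zero_mul, add_zero]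
  have hneg : ∀ w, c w ≤ 0 →
      T w = Φ (sphereReflection (axis hm, w)) ∧ ℓ w = upperScale L h₀ A q (T w) := by
    intro w hw
    refine ⟨by simp only [hT]; rw [sphereFold_of_nonpos hw], ?_⟩
    rw [h.upperScale_eq hA hq hqA hmax (hTq w)]
    simp only [hℓ, hκ]
    rw [max_eq_right (by linarith), min_eq_right]
    -- The cutoff is at most -2 c here, because `hΦ2` gives dist (T w) q.1 ≥ 2 L q.2 (1 + c).
    refine cutoff_le (by linarith) ?_
    have h1 := (hΦ2 _ (hfold w)).1
    rw [inner_sphereFold, abs_of_nonpos hw] at h1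
    have h2 : 2 * (1 + c w) ≤ dist (T w) q.1 / (L * q.2) := by
      rw [le_div_iff₀ hLq]
      calc 2 * (1 + c w) * (L * q.2) = 2 * L * q.2 * (1 - -c w) := by ring
        _ ≤ _ := h1
    linarith
  have hcut : ∀ w, c w ≤ 0 → cutoff (L * q.2) (dist (Φ w) q.1) = 0 := by
    intro w hw
    refine le_antisymm (cutoff_le le_rfl ?_) (cutoff_nonneg _ _)
    have h1 := hΦ1 w hw
    have h2 : 2 ≤ dist (Φ w) q.1 / (L * q.2) := by
      rw [le_div_iff₀ hLq]
      linarith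
    linarith
  have hTd : ∀ w w', dist (T w) (T w') ≤ 4 * L * q.2 * dist w w' := by
    intro w w'
    refine (hΦ3 _ _ (hfold w) (hfold w')).trans ?_
    calc 2 * (2 * L * q.2) * dist (sphereFold (axis hm) w) (sphereFold (axis hm) w')
        ≤ 2 * (2 * L * q.2) * dist w w' := by
          gcongr
          exact dist_sphereFold_le _ _ _
      _ = _ := by ring
  have hκd : ∀ w w', |κ w - κ w'| ≤ 4 * dist w w' := by
    intro w w'
    refine (abs_min_sub_min_le_max _ _ _ _).trans (max_le ?_ ?_)
    · have h1 : |max 0 (-c w) - max 0 (-c w')| ≤ |c w - c w'| := by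
        refine (abs_max_sub_max_le_max _ _ _ _).trans (max_le (by simp) (le_of_eq ?_))
        rw [← abs_neg]
        congr 1
        ring
      have h2 : |c w - c w'| ≤ dist w w' := by
        simp only [hc]
        rw [← inner_sub_right, Subtype.dist_eq, dist_eq_norm]
        refine (abs_real_inner_le_norm _ _).trans (le_of_eq ?_)
        rw [norm_eq_of_mem_sphere, one_mul]
      rw [← mul_sub, abs_mul, abs_two]
      have := dist_nonneg (x := w) (y := w')
      linarith
    · refine (abs_cutoff_sub_le hLq _ _).trans ?_
      rw [div_le_iff₀ hLq]
      calc |dist (T w) q.1 - dist (T w') q.1| ≤ dist (T w) (T w') := abs_dist_sub_le _ _ _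
        _ ≤ 4 * L * q.2 * dist w w' := hTd w w'
        _ = _ := by ring
  have hℓd : ∀ w w', |ℓ w - ℓ w'| ≤ 32 * L * q.2 * dist w w' := by
    intro w w'
    have h1 : ℓ w - ℓ w' = (κ w - κ w') * (8 * L * q.2 - l) := by
      simp only [hℓ]
      ring
    rw [h1, abs_mul, abs_of_nonneg (show 0 ≤ 8 * L * q.2 - l by linarith)]
    calc |κ w - κ w'| * (8 * L * q.2 - l) ≤ 4 * dist w w' * (8 * L * q.2) :=
          mul_le_mul (hκd w w') (by linarith) (by linarith) (by positivity)
      _ = _ := by ring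
  have hκ0 : ∀ w, 0 ≤ κ w := fun w =>
    le_min (mul_nonneg zero_le_two (le_max_left _ _)) (cutoff_nonneg _ _)
  have hκ1 : ∀ w, κ w ≤ 1 := fun w => (min_le_right _ _).trans (cutoff_le_one _ _)
  have hlℓ : ∀ w, l ≤ ℓ w := fun w =>
    le_add_of_nonneg_right (mul_nonneg (hκ0 w) (by linarith))
  have hℓ1 : ∀ w, ℓ w ≤ 1 := fun w => by
    have h1 := mul_le_of_le_one_left (show 0 ≤ 8 * L * q.2 - l by linarith) (hκ1 w)
    have h2 := h.height_lt hq
    have h3 := h.half_inv_le_one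
    simp only [hℓ]
    linarith
  set u : Sph m → E := fun w => tentAverage (fun y => R.emb (f y)) (T w) (ℓ w) with hu
  have hud : ∀ w w', dist (u w) (u w') ≤ 288 * C * L ^ 2 * dist w w' := by
    intro w w'
    refine (hCf _ _ _ _ (hl.trans_le (hlℓ w)) (hℓ1 w) (hl.trans_le (hlℓ w')) (hℓ1 w')).trans ?_
    -- 36 = 4 + 32 from `hTd` and `hℓd`; dividing by l = q.2 / (8 L) gives 288 L ^ 2.
    have h1 : (dist (T w) (T w') + |ℓ w - ℓ w'|) / ℓ w ≤ 36 * L * q.2 * dist w w' / l := by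
      refine div_le_div₀ (by positivity) ?_ hl (hlℓ w)
      have := hTd w w'
      have := hℓd w w'
      linarith
    refine (mul_le_mul_of_nonneg_left h1 hC.le).trans (le_of_eq ?_)
    rw [hl_def]
    field_simp
    ring
  have hut : ∀ w, u w ∈ R.tube := by
    intro w
    rcases le_total 0 (c w) with hw | hw
    · simp only [hu]
      rw [(hpos w hw).2]
      exact not_not.1 (hV.good _)
    · simp only [hu]
      rw [(hneg w hw).2]
      exact not_not.1 (hU.good _)
  have huc : Continuous u :=
    (LipschitzWith.of_dist_le_mul (K := ⟨288 * C * L ^ 2, by positivity⟩) hud).continuous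
  refine ⟨u, ⟨fun w => R.ret (u w), R.continuous_ret_comp huc hut⟩, ⟨fun w hw => ?_, fun w hw => ?_,
    fun w hw => ?_⟩, hud, hut, fun _ => rfl⟩
  · simp only [ContinuousMap.comp_apply, smoothing_apply]
    rw [upperScale_eq_lowerScale (hcut w hw)]
  · simp only [ContinuousMap.comp_apply, smoothing_apply, ContinuousMap.coe_mk, hu]
    rw [(hpos w hw).2, (hpos w hw).1]
  · simp only [ContinuousMap.comp_apply, smoothing_apply, ContinuousMap.coe_mk, hu]
    rw [(hneg w hw).2, (hneg w hw).1]

end ScaleConfig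

end Step

end GapPotential

end

noncomputable section

namespace GapPotential

/-! ### Sweeping over the boxes -/

section Sweep

variable {m : ℕ} {N E : Type*} [EMetricSpace N] [NormedAddCommGroup E] [NormedSpace ℝ E]

open RetractionData ScaleConfig

theorem ScaleConfig.admissible_ladder_of_isLower {R : RetractionData N E} {f : C(Sph m, N)}
    {L h₀ : ℝ} {Q A : Finset (Sph m × ℝ)}
    (h : ScaleConfig (fun x v => ¬ R.IsBad f x v) L h₀ Q) (hA : A ⊆ Q) (hlow : IsLower Q A) :
    R.Admissible f (ladder L h₀ A) := by
  classical
  rcases (Q \ A).eq_empty_or_nonempty with hne | hne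
  · have hQA : A = Q := hA.antisymm (Finset.sdiff_eq_empty_iff_subset.1 hne)
    subst hQA
    exact h.admissible_of_ladder_le (continuous_ladder L h₀ A) (fun _ => le_rfl) (h.ladder_le hA)
  · obtain ⟨q, hq, hmin⟩ := (Q \ A).exists_min_image (fun q => q.2) hne
    obtain ⟨hqQ, hqA⟩ := Finset.mem_sdiff.1 hq
    exact h.admissible_ladder hA hqQ hqA hlow fun p hp hpA => hmin p (Finset.mem_sdiff.2 ⟨hp, hpA⟩)

theorem RetractionData.exists_norm_emb_le {N E : Type*} [TopologicalSpace N] [CompactSpace N]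
    [NormedAddCommGroup E] (R : RetractionData N E) :
    ∃ M : ℝ, 0 < M ∧ ∀ y, ‖R.emb y‖ ≤ M := by
  obtain ⟨M, hM, h⟩ := (isCompact_range R.emb.continuous).isBounded.exists_pos_norm_le
  exact ⟨M, hM, fun y => h _ ⟨y, rfl⟩⟩

variable [CompactSpace N] [ProperSpace E]

/-- One step of the sweep preserves finiteness of the set of free homotopy classes. -/
theorem exists_finite_step (R : RetractionData N E) (hm : 1 ≤ m) (hN : FiniteOrbits m N)
    {Lmax : ℝ} (hLmax : 0 < Lmax) {G : Set C(Sph m, N)} (hG : G.Finite) :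
    ∃ G' : Set C(Sph m, N), G'.Finite ∧ ∀ (f : C(Sph m, N)) (L h₀ : ℝ)
      (Q A A' : Finset (Sph m × ℝ)) (q : Sph m × ℝ), L ≤ Lmax →
      ScaleConfig (fun x v => ¬ R.IsBad f x v) L h₀ Q → A ⊆ Q → q ∈ Q → q ∉ A →
      (∀ p, p ∈ A' ↔ p = q ∨ p ∈ A) → IsLower Q A → (∀ p ∈ Q, p ∉ A → q.2 ≤ p.2) →
      ∀ (hV' : R.Admissible f (ladder L h₀ A')) (hV : R.Admissible f (ladder L h₀ A)),
      (∃ g ∈ G, (smoothing hV').Homotopic g) → ∃ g ∈ G', (smoothing hV).Homotopic g := by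
  classical
  obtain ⟨Ψ, hΨ⟩ := exists_cap_map hm
  obtain ⟨M, hM, hRM⟩ := R.exists_norm_emb_le
  obtain ⟨C, hC, hCF⟩ := exists_dist_tentAverage_le (E := E) m M hM
  obtain ⟨D, hD, hDh⟩ := R.exists_finite_homotopy_representatives (Sph m) (288 * C * Lmax ^ 2)
    (by positivity)
  -- Each Φ is homotopic to the fixed Ψ, so composing with Ψ once accounts for all positions and
  -- sizes of the cap, and `G'` does not depend on f or q.
  obtain ⟨G', hG', hG'h⟩ := exists_finite_of_isDouble R hm hN (hG.image fun g => g.comp Ψ) hD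
  refine ⟨(fun g => g.comp Ψ) '' G', hG'.image _, ?_⟩
  rintro f L h₀ Q A A' q hLL h hA hq hqA hA' hlow hlow' hV' hV ⟨g, hg, hgh⟩
  have hL := h.L_pos
  have hq0 := h.pos q hq
  obtain rfl : A' = insert q A := by
    ext p
    rw [hA', Finset.mem_insert]
  have hmax : ∀ p ∈ A, p.2 ≤ q.2 := hlow q hq hqA
  have hs : 2 * L * q.2 ≤ 1 := by
    have h1 := h.height_lt hq
    have h2 := h.half_inv_le_one
    nlinarith
  obtain ⟨Φ, Φ', hΦΦ, hΦ, hΦ', hΦ1, hΦ2, hΦ3⟩ := hΨ q.1 (2 * L * q.2) (by positivity) hs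
  have hl := h.admissible_lowerScale hA hq hqA hlow hlow'
  have hu := h.admissible_upperScale hA hq hqA hlow hlow'
  obtain ⟨u, d, hd, hud, hut, hdu⟩ := h.exists_double hm hA hq hqA hmax hC
    (hCF _ (by fun_prop) fun y => hRM _) hΦ1 hΦ2 hΦ3 hl hu
  have h0 : ((smoothing hu).comp Φ).Homotopic (g.comp Ψ) :=
    (((h.smoothing_ladder_homotopic_upper hA hq hqA hlow hlow' hV' hu).symm).trans hgh).comp hΦ
  have h1 : ∃ g ∈ D, d.Homotopic g := by
    refine hDh u d (fun w w' => (hud w w').trans ?_) hut hdu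
    gcongr
  obtain ⟨g', hg', hgh'⟩ := hG'h _ _ _ hd ⟨_, ⟨g, hg, rfl⟩, h0⟩ h1
  refine ⟨_, ⟨g', hg', rfl⟩, (h.smoothing_ladder_homotopic_lower hA hq hqA hlow hlow' hV hl).trans
    ?_⟩
  -- Composing with Φ' undoes the rescaling, again at the cost of composing with Ψ.
  have h2 : ((smoothing hl).comp Φ).comp Φ' = smoothing hl := by
    ext w
    simp [hΦΦ]
  rw [← h2]
  exact hgh'.comp hΦ'

/-- The map at the top of the sweep lies in a finite set of free homotopy classes. -/
theorem exists_finite_top (R : RetractionData N E) {Lmax : ℝ} (hLmax : 0 < Lmax) :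
    ∃ G : Set C(Sph m, N), G.Finite ∧ ∀ (f : C(Sph m, N)) (L h₀ : ℝ) (Q : Finset (Sph m × ℝ)),
      L ≤ Lmax → ScaleConfig (fun x v => ¬ R.IsBad f x v) L h₀ Q →
      ∀ (hV : R.Admissible f (ladder L h₀ Q)), ∃ g ∈ G, (smoothing hV).Homotopic g := by
  obtain ⟨M, hM, hRM⟩ := R.exists_norm_emb_le
  obtain ⟨C, hC, hCF⟩ := exists_dist_tentAverage_le (E := E) m M hM
  obtain ⟨G, hG, hGh⟩ := R.exists_finite_homotopy_representatives (Sph m) (C * (2 * Lmax))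
    (by positivity)
  refine ⟨G, hG, fun f L h₀ Q hLL h hV => ?_⟩
  have hL := h.L_pos
  have hV' : R.Admissible f fun _ => 1 / (2 * L) :=
    h.admissible_of_ladder_le continuous_const (h.ladder_le (subset_refl Q)) fun _ => le_rfl
  have hlip : ∀ x y, dist (tentAverage (fun z => R.emb (f z)) x (1 / (2 * L)))
      (tentAverage (fun z => R.emb (f z)) y (1 / (2 * L))) ≤ C * (2 * Lmax) * dist x y := by
    intro x y
    refine (hCF _ (by fun_prop) (fun y => hRM _) x y _ _ (hV'.pos x) (hV'.le_one x) (hV'.pos x)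
      (hV'.le_one x)).trans ?_
    rw [sub_self, abs_zero, add_zero, div_div_eq_mul_div, div_one, mul_comm (dist x y), ← mul_assoc]
    gcongr
  obtain ⟨g, hg, hgh⟩ := hGh _ (smoothing hV') hlip (fun x => not_not.1 (hV'.good x)) fun _ => rfl
  exact ⟨g, hg, (h.smoothing_ladder_homotopic_const hV hV').trans hgh⟩

/-- Induction on the number k of points still above the ladder. For k = 0 the map is the top one;
otherwise the lowest remaining point is added to A, which keeps A a lower set. -/
theorem exists_finite_sweep (R : RetractionData N E) (hm : 1 ≤ m) (hN : FiniteOrbits m N)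
    {Lmax : ℝ} (hLmax : 0 < Lmax) (k : ℕ) :
    ∃ G : Set C(Sph m, N), G.Finite ∧ ∀ (f : C(Sph m, N)) (L h₀ : ℝ)
      (Q A : Finset (Sph m × ℝ)), L ≤ Lmax → ScaleConfig (fun x v => ¬ R.IsBad f x v) L h₀ Q →
      A ⊆ Q → IsLower Q A → Q.card = A.card + k →
      ∀ (hV : R.Admissible f (ladder L h₀ A)), ∃ g ∈ G, (smoothing hV).Homotopic g := by
  classical
  induction k with
  | zero =>
    obtain ⟨G, hG, hGh⟩ := exists_finite_top (m := m) R hLmax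
    refine ⟨G, hG, fun f L h₀ Q A hL h hA _ hcard hV => ?_⟩
    obtain rfl := Finset.eq_of_subset_of_card_le hA hcard.le
    exact hGh f L h₀ A hL h hV
  | succ k ih =>
    obtain ⟨G, hG, hGh⟩ := ih
    obtain ⟨G', hG', hGh'⟩ := exists_finite_step R hm hN hLmax hG
    refine ⟨G', hG', fun f L h₀ Q A hL h hA hlow hcard hV => ?_⟩
    have hne : (Q \ A).Nonempty := by
      rw [← Finset.card_pos, Finset.card_sdiff_of_subset hA]
      omega
    obtain ⟨q, hq, hmin⟩ := (Q \ A).exists_min_image (fun q => q.2) hne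
    obtain ⟨hqQ, hqA⟩ := Finset.mem_sdiff.1 hq
    have hlow' : ∀ p ∈ Q, p ∉ A → q.2 ≤ p.2 := fun p hp hpA =>
      hmin p (Finset.mem_sdiff.2 ⟨hp, hpA⟩)
    have hA' : insert q A ⊆ Q := Finset.insert_subset hqQ hA
    have hlowA' : IsLower Q (insert q A) := by
      intro p hp hpA z hz
      have hpA' : p ∉ A := fun hp' => hpA (Finset.mem_insert_of_mem hp')
      rcases Finset.mem_insert.1 hz with rfl | hz
      · exact hlow' p hp hpA'
      · exact hlow p hp hpA' z hz
    have hV' := h.admissible_ladder_of_isLower hA' hlowA'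
    refine hGh' f L h₀ Q A (insert q A) q hL h hA hqQ hqA (fun p => Finset.mem_insert) hlow hlow'
      hV' hV ?_
    refine hGh f L h₀ Q _ hL h hA' hlowA' ?_ hV'
    rw [Finset.card_insert_of_notMem hqA, hcard]
    ring

/-- The map at the bottom of the sweep lies in a finite set of free homotopy classes. -/
theorem exists_finite_bottom (R : RetractionData N E) (hm : 1 ≤ m) (hN : FiniteOrbits m N)
    {Lmax : ℝ} (hLmax : 0 < Lmax) (K : ℕ) :
    ∃ G : Set C(Sph m, N), G.Finite ∧ ∀ (f : C(Sph m, N)) (L h₀ : ℝ) (Q : Finset (Sph m × ℝ)),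
      L ≤ Lmax → ScaleConfig (fun x v => ¬ R.IsBad f x v) L h₀ Q → Q.card ≤ K →
      ∀ (hV : R.Admissible f fun _ => h₀), ∃ g ∈ G, (smoothing hV).Homotopic g := by
  choose G hG hGh using exists_finite_sweep R hm hN hLmax
  refine ⟨⋃ k ∈ Finset.range (K + 1), G k, (Finset.range (K + 1)).finite_toSet.biUnion
    fun k _ => hG k, fun f L h₀ Q hL h hQ hV => ?_⟩
  -- The ladder of the empty set is the constant h₀.
  obtain ⟨g, hg, hgh⟩ := hGh Q.card f L h₀ Q ∅ hL h (Finset.empty_subset _)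
    (fun _ _ _ _ hz => absurd hz (Finset.notMem_empty _)) (by simp) hV
  exact ⟨g, mem_iUnion₂.2 ⟨Q.card, Finset.mem_range.2 (by omega), hg⟩, hgh⟩

/-- A map with few separated bad balls lies in a finite set of free homotopy classes. -/
theorem exists_finite_of_card_bad_le (R : RetractionData N E) (hm : 1 ≤ m)
    (hN : FiniteOrbits m N) {θ : ℝ} (hθ : 0 < θ) (K : ℕ) :
    ∃ G : Set C(Sph m, N), G.Finite ∧ ∀ f : C(Sph m, N),
      (∀ Q : Finset (Sph m × ℝ), (∀ q ∈ Q, 0 < q.2 ∧ q.2 ≤ 1 ∧ R.IsBad f q.1 q.2) →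
        (Q : Set (Sph m × ℝ)).PairwiseDisjoint (fun q => spreadPairs θ q.1 q.2) → Q.card ≤ K) →
      ∃ g ∈ G, f.Homotopic g := by
  have hL₀ : 1 ≤ 1 + 2 / θ := le_add_of_nonneg_right (by positivity)
  obtain ⟨Lmax, hLmax, hcoarse⟩ := exists_coarsening (X := Sph m) (fun L => 8192 * L ^ 4)
    (fun L hL => by
      have := one_le_pow₀ hL (n := 4)
      linarith) K _ hL₀
  obtain ⟨G, hG, hGh⟩ := exists_finite_bottom R hm hN (Lmax := Lmax) (by linarith) K
  refine ⟨G, hG, fun f hf => ?_⟩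
  set B : Set (Sph m × ℝ) := {q | 0 < q.2 ∧ q.2 ≤ 1 ∧ R.IsBad f q.1 q.2} with hB
  obtain ⟨Q, hQK, hQB, hQ⟩ := exists_net hθ (B := B) (fun p hp => hp.1) (K := K) hf
  obtain ⟨Q', hQ'Q, L, hL0, hL1, hcov, hsmall, hsep⟩ := hcoarse B Q hQK (fun p hp => hp.1)
    (fun q hq => (hQB q hq).1) fun p hp => Or.inr (hQ p hp)
  have hL : 1 ≤ L := hL₀.trans hL0
  have hcont : UniformContinuous fun y => R.emb (f y) :=
    CompactSpace.uniformContinuous_of_continuous (by fun_prop)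
  obtain ⟨δ, hδ, hδη⟩ := Metric.uniformContinuous_iff.1 hcont R.η R.η_pos
  have hclose : ∀ x v, 0 < v → v ≤ 1 → v ≤ δ →
      dist (tentAverage (fun y => R.emb (f y)) x v) (R.emb (f x)) ≤ R.η := by
    intro x v hv hv1 hvδ
    refine dist_tentAverage_le_of_forall (by fun_prop) hv hv1 fun y hy => (hδη ?_).le
    rw [dist_comm]
    linarith
  obtain ⟨ρ, hρ, hρQ⟩ : ∃ ρ : ℝ, 0 < ρ ∧ ∀ q ∈ Q', ρ ≤ q.2 / (8 * L) := by
    rcases Q'.eq_empty_or_nonempty with rfl | hne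
    · exact ⟨1, one_pos, by simp⟩
    · obtain ⟨q, hq, hmin⟩ := Q'.exists_min_image (fun q => q.2 / (8 * L)) hne
      have := (hQB q (hQ'Q hq)).1
      exact ⟨q.2 / (8 * L), by positivity, hmin⟩
  -- h₀ depends on f, through its modulus of continuity δ and its bad points, whereas G was fixed
  -- before f.
  set h₀ := min ρ (min δ (1 / (2 * L))) with hh₀
  have hh0 : 0 < h₀ := lt_min hρ (lt_min hδ (by positivity))
  have hhδ : h₀ ≤ δ := (min_le_right _ _).trans (min_le_left _ _)
  have hhL : h₀ ≤ 1 / (2 * L) := (min_le_right _ _).trans (min_le_right _ _)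
  have hh1 : h₀ ≤ 1 := hhL.trans (by
    rw [div_le_one (by linarith)]
    linarith)
  have hgood : ∀ x v, 0 < v → v ≤ h₀ → ¬ R.IsBad f x v := fun x v hv hvh =>
    not_not.2 (R.mem_tube_of_dist_le (hclose x v hv (hvh.trans hh1) (hvh.trans hhδ)))
  have hconfig : ScaleConfig (fun x v => ¬ R.IsBad f x v) L h₀ Q' :=
    { one_le := hL
      pos := fun q hq => (hQB q (hQ'Q hq)).1
      small := hsmall
      sep := hsep
      h_pos := hh0
      h_le := fun q hq => (min_le_left _ _).trans (hρQ q hq)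
      h_top := hhL
      good_of_le := hgood
      near_of_bad := fun x v hv hvL hbad => by
        have hv1 : v ≤ 1 := by nlinarith
        exact (hcov (x, v) ⟨hv, hv1, not_not.1 hbad⟩).resolve_left (not_le.2 hvL) }
  have hV : R.Admissible f fun _ => h₀ :=
    ⟨continuous_const, fun _ => hh0, fun _ => hh1, fun x => hgood x h₀ hh0 le_rfl⟩
  obtain ⟨g, hg, hgh⟩ := hGh f L h₀ Q' hL1 hconfig ((Finset.card_le_card hQ'Q).trans hQK) hV
  refine ⟨g, hg, (R.homotopic_of_dist_le (u := fun x => tentAverage (fun y => R.emb (f y)) x h₀)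
    ?_ (fun _ => rfl) fun x => hclose x h₀ hh0 hh1 hhδ).trans hgh⟩
  exact continuous_tentAverage (by fun_prop) continuous_id continuous_const (fun _ => hh0)
    fun _ => hh1

end Sweep

end GapPotential

end

/-! ### Conclusion -/

noncomputable section

namespace GapPotential

theorem RetractionData.exists_dist_emb_le {N E : Type*} [EMetricSpace N] [CompactSpace N]
    [NormedAddCommGroup E] (R : RetractionData N E) :
    ∃ ε : ℝ, 0 < ε ∧ ∀ y y', edist y y' < ENNReal.ofReal ε →
      dist (R.emb y) (R.emb y') ≤ R.η / 2 := by
  have huc : UniformContinuous R.emb :=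
    CompactSpace.uniformContinuous_of_continuous R.emb.continuous
  obtain ⟨δ, hδ, h⟩ := EMetric.uniformContinuous_iff.1 huc (ENNReal.ofReal (R.η / 2))
    (ENNReal.ofReal_pos.2 (half_pos R.η_pos))
  obtain ⟨ε, hε, hεδ⟩ := ENNReal.lt_iff_exists_nnreal_btwn.1 hδ
  refine ⟨ε, by exact_mod_cast hε, fun y y' hy => ?_⟩
  rw [ENNReal.ofReal_coe_nnreal] at hy
  have := h (hy.trans hεδ)
  rw [edist_dist, ENNReal.ofReal_lt_ofReal_iff (half_pos R.η_pos)] at this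
  exact this.le

end GapPotential

end


theorem mainTheorem3 {m n : ℕ} (hm : 1 ≤ m)
    {N : Type*} [EMetricSpace N] [ChartedSpace (EuclideanSpace ℝ (Fin n)) N]
    [IsManifold (𝓡 n) ∞ N]
    [Bundle.RiemannianBundle (fun x : N => TangentSpace (𝓡 n) x)]
    [IsContMDiffRiemannianBundle (𝓡 n) ∞ (EuclideanSpace ℝ (Fin n))
      (fun x : N => TangentSpace (𝓡 n) x)]
    [IsRiemannianManifold (𝓡 n) N] [CompactSpace N]
    (hN : (m = 1 ∧ ∀ (x : N) (γ : FundamentalGroup N x), (conjugatesOf γ).Finite) ∨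
      (2 ≤ m ∧ ∀ (x : N) (γ : π_ m N x), (GapPotential.orbit γ).Finite)) :
    ∃ ε₀ : ℝ, 0 < ε₀ ∧ ∀ ε : ℝ, 0 < ε → ε < ε₀ → ∀ Λ : ℝ, 0 < Λ →
      ∃ G : Set C(GapPotential.Sph m, N), G.Finite ∧
        ∀ f : C(GapPotential.Sph m, N),
          GapPotential.gapPotential ε f ≤ ENNReal.ofReal Λ → ∃ g ∈ G, f.Homotopic g := by
  rcases isEmpty_or_nonempty N with hempty | hne
  · exact ⟨1, one_pos, fun _ _ _ _ _ =>
      ⟨∅, Set.finite_empty, fun f => isEmptyElim (f (GapPotential.pole m))⟩⟩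
  -- Of the Whitney embedding only the topological closed embedding is kept.
  obtain ⟨k, e, -, he, -⟩ := @exists_embedding_euclidean_of_compact _ _ _ _ _ _ (𝓡 n) N _ _ _ _ _
  obtain ⟨η, hη, ρ, hρ, hρe⟩ :=
    GapPotential.exists_retraction_cthickening (F := EuclideanSpace ℝ (Fin n)) he hne
  let R : GapPotential.RetractionData N (EuclideanSpace ℝ (Fin k)) :=
    ⟨⟨e, he.continuous⟩, η, hη, ρ, hρ, hρe⟩
  obtain ⟨M, hM, hRM⟩ := R.exists_norm_emb_le
  obtain ⟨θ, hθ, -, hcard⟩ := R.exists_card_bad_le hm hM hRM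
  obtain ⟨ε₀, hε₀, hclose⟩ := R.exists_dist_emb_le
  refine ⟨ε₀, hε₀, fun ε _ hεε₀ Λ _ => ?_⟩
  -- Λ enters only through the number K of separated bad balls; ε₀ depends on the embedding and its
  -- tube alone.
  obtain ⟨K, hK⟩ := hcard Λ
  obtain ⟨G, hG, hGh⟩ := GapPotential.exists_finite_of_card_bad_le R hm hN hθ K
  refine ⟨G, hG, fun f hf => hGh f (hK ε (fun y y' h => hclose y y' (h.trans_lt ?_)) f hf)⟩
  exact (ENNReal.ofReal_lt_ofReal_iff hε₀).2 hεε₀
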